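/- Let $N\ge 2$, let $s\in\mathbb Z$ be coprime to $N$, and put $\epsilon^{x}=\exp(\pi i s x/N)$ for $x\in\mathbb C$ (so $\epsilon^2$ is a primitive $N$-th root of unity), $[x]_\epsilon=\frac{\epsilon^x-\epsilon^{-x}}{\epsilon-\epsilon^{-1}}$, $[n]_\epsilon!=\prod_{k=1}^n[k]_\epsilon$, $[p;n]_\epsilon!=\prod_{k=0}^{n-1}[p-k]_\epsilon$. Fix any choice, for every $x\in\mathbb C$, of a square root of $[x]_\epsilon$; all square roots of products (and quotients) of such numbers below are the products (quotients) of the chosen square roots of the factors. *Representations.* For $\mu\in\mathbb C$ and $d\ge1$ consider on $\mathbb C^d$, with basis $e_0,\dots,e_{d-1}$, the operators $$X^+e_z=\sqrt{[2\mu-z+1]_\epsilon}\sqrt{[z]_\epsilon}\,e_{z-1},\quad X^-e_z=\sqrt{[2\mu-z]_\epsilon}\sqrt{[z+1]_\epsilon}\,e_{z+1},\quad He_z=(2\mu-2z)e_z ,$$ where $X^+e_0=0$ and $X^-e_{d-1}=0$. For $d=N$, $\mu=p\in\mathbb C$ this is the color representation $V^{(p)}_\epsilon$; for $\mu=j$,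 $2j\in\mathbb Z$, $0\le 2j\le N-2$, $d=2j+1$ it is the spin $j$ representation $V^{(j)}_\epsilon$. *R-matrices.* Let $\hat X^{\pm}_1=X^{\pm}$, $\hat H_1=H$, $\hat X_0^{\pm}=X^{\mp}$, $\hat H_0=-H$. An operator $R$ on the tensor product of two such representations is called an R-matrix with parameter $x\neq 0$ if for $i=0,1$ and both signs $$R\,(\epsilon^{\hat H_i/2}\otimes \epsilon^{\hat H_i/2})=(\epsilon^{\hat H_i/2}\otimes \epsilon^{\hat H_i/2})\,R,$$ $$R\,(x^{\pm\delta_{i0}}\hat X_i^\pm\otimes \epsilon^{\hat H_i/2}+\epsilon^{-\hat H_i/2}\otimes\hat X_i^\pm)=(x^{\pm\delta_{i0}}\hat X_i^\pm\otimes \epsilon^{-\hat H_i/2}+\epsilon^{\hat H_i/2}\otimes\hat X_i^\pm)\,R .$$ Matrix elements are $R(e_{b_1}\otimes e_{b_2})=\sum_{a_1,a_2}R^{a_1a_2}_{b_1b_2}\,e_{a_1}\otimes e_{a_2}$. *Clebsch–Gordan coefficients.* Put $$\begin{aligned}C(\mu_1,\mu_2,\mu_1+\mu_2-n;z_1,z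_2,z_3)_\epsilon={}&\delta_{z_3,z_1+z_2-n}\sqrt{[2\mu_1+2\mu_2-2n+1]_\epsilon}\,\sqrt{[n]_\epsilon![z_1]_\epsilon![z_2]_\epsilon![z_3]_\epsilon!}\;\epsilon^{(n-n^2)/2+(n-z_2)\mu_1+(n+z_1)\mu_2}\\&\times\sum_\nu\frac{(-1)^\nu\epsilon^{-\nu(2\mu_1+2\mu_2-n+1)}}{[\nu]_\epsilon![n-\nu]_\epsilon![z_1-\nu]_\epsilon![z_2-n+\nu]_\epsilon!}\sqrt{\frac{[2\mu_1-n;z_1-\nu]_\epsilon!\,[2\mu_1-z_1;n-\nu]_\epsilon!\,[2\mu_2-n;z_2+\nu-n]_\epsilon!\,[2\mu_2-z_2;\nu]_\epsilon!}{[2\mu_1+2\mu_2-n+1;z_1+z_2+1]_\epsilon!}},\end{aligned}$$ where $\max\{0,n-z_2\}\le\nu\le\min\{n,z_1\}$, with in addition $\nu\le 2j_2-z_2$ if $\mu_2=j_2$ is a spin, and $\nu\ge n+z_1-2j_1$ if $\mu_1=j_1$ is a spin. Let $$g(\mu_1,\mu_2,n;u)_\epsilon=(-1)^n\prod_{k=0}^{n-1}\frac{[u-\mu_1-\mu_2+k]_\epsilon}{[u+\mu_1+\mu_2-k]_\epsilon},\qquad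 g(\mu_1,\mu_2,0;u)_\epsilon=1.$$ **(1) Two color representations.** Let $p_1,p_2,u\in\mathbb C$ be generic, i.e. $[2p_1+2p_2+k]_\epsilon\ne0$ for all $k\in\mathbb Z$ and $[u+p_1+p_2-k]_\epsilon\neq0$ for $0\le k\le N-2$ (so that no denominator below vanishes). Define the operator $R_{p_1p_2}(\epsilon;u)$ on $V_\epsilon^{(p_1)}\otimes V_\epsilon^{(p_2)}$ by $$R_{p_1p_2}(\epsilon;u)^{a_1a_2}_{b_1b_2}=\sum_{n=0}^{N-1}g(p_1,p_2,n;u)_\epsilon\,C(p_1,p_2,p_1+p_2-n;b_1,b_2,b_1+b_2-n)_\epsilon\,C(p_2,p_1,p_1+p_2-n;a_2,a_1,a_1+a_2-n)_\epsilon$$ if $a_1+a_2=b_1+b_2$, only those $n$ with $0\le b_1+b_2-n\le N-1$ being counted, and $R_{p_1p_2}(\epsilon;u)^{a_1a_2}_{b_1b_2}=0$ otherwise. Then $R_{p_1p_2}(\epsilon;u)$ is an R-matrix with parameter $x=\epsilon^{-2u}$, and $R_{p_1p_2}(\epsilon;u)^{00}_{00}=1$. If moreover $[2p_i-k]_\epsilon\ne0$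 for $i=1,2$ and $0\le k\le N-2$ (both representations are irreducible), every R-matrix on $V_\epsilon^{(p_1)}\otimes V_\epsilon^{(p_2)}$ with parameter $\epsilon^{-2u}$ is a scalar multiple of it. **(2) Colored vertex model.** For $\alpha=\epsilon^{p_2}$, $\beta=\epsilon^{p_1}$ and $a,b,c,d\in\{0,\dots,N-1\}$ put $X_{\alpha\beta}(u)^{ab}_{cd}=R_{p_1p_2}(\epsilon;u)^{ba}_{cd}$. These Boltzmann weights define an $N$-state colored vertex model: let $p_1,p_2,p_3,u_1,u_2,u_3\in\mathbb C$ be such that $(p_i,p_j,u_i-u_j)$ is generic in the sense of (1) for all $i<j$, and put $\alpha_i=\epsilon^{p_i}$. Then, for all indices in $\{0,\dots,N-1\}$, $$\sum_{c_1,c_2,c_3}X_{\alpha_1\alpha_2}(u_1-u_2)^{a_1a_2}_{c_2c_1}X_{\alpha_1\alpha_3}(u_1-u_3)^{c_1a_3}_{c_3b_1}X_{\alpha_2\alpha_3}(u_2-u_3)^{c_2c_3}_{b_3b_2}=\sum_{c_1,c_2,c_3}X_{\alpha_2\alpha_3}(u_2-u_3)^{a_2a_3}_{c_3c_2}X_{\alpha_1\alpha_3}(u_1-u_3)^{a_1c_3}_{b_3c_1}X_{\alpha_1\alpha_2}(u_1-u_2)^{c_1c_2}_{b_2b_1}.$$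 (Here the weight $X_{\alpha_i\alpha_j}(u)$ is formed with the given parameters: $X_{\alpha_i\alpha_j}(u)^{ab}_{cd}=R_{p_jp_i}(\epsilon;u)^{ba}_{cd}$.) **(3) Mixed case.** Let $p_1,u\in\mathbb C$ and $2j_2\in\mathbb Z$ with $0\le 2j_2\le N-2$, and suppose that $[2p_1+k]_\epsilon\ne0$ for all $k\in\mathbb Z$ and $[u+p_1+j_2-k]_\epsilon\ne0$ for $0\le k\le 2j_2-1$. Define $R_{p_1j_2}(\epsilon;u)$ on $V_\epsilon^{(p_1)}\otimes V_\epsilon^{(j_2)}$ by $$R_{p_1j_2}(\epsilon;u)^{a_1a_2}_{b_1b_2}=\sum_{n=0}^{2j_2}g(p_1,j_2,n;u)_\epsilon\,C(p_1,j_2,p_1+j_2-n;b_1,b_2,b_1+b_2-n)_\epsilon\,C(j_2,p_1,p_1+j_2-n;a_2,a_1,a_1+a_2-n)_\epsilon$$ if $a_1+a_2=b_1+b_2$, again counting only $n$ with $0\le b_1+b_2-n\le N-1$, and $0$ otherwise. Then $R_{p_1j_2}(\epsilon;u)$ is an R-matrix with parameter $\epsilon^{-2u}$, its $(00,00)$ matrix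 element is $1$, and every R-matrix on $V_\epsilon^{(p_1)}\otimes V_\epsilon^{(j_2)}$ with parameter $\epsilon^{-2u}$ is a scalar multiple of it. -/

import Mathlib

noncomputable section

namespace ColoredVertex

open scoped Kronecker

/-- The power `ε ^ x = exp (π i s x / N)` of `ε = exp (π i s / N)`, for complex `x`. -/
def epsPow (N : ℕ) (s : ℤ) (x : ℂ) : ℂ :=
  Complex.exp (Real.pi * Complex.I * s * x / N)

/-- The number `[x]_ε = (ε ^ x - ε ^ (-x)) / (ε - ε⁻¹)`. -/
def qNum (N : ℕ) (s : ℤ) (x : ℂ) : ℂ :=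
  (epsPow N s x - epsPow N s (-x)) / (epsPow N s 1 - epsPow N s (-1))

/-- `[n]_ε ! = ∏_{k = 1}^{n} [k]_ε`. -/
def qFact (N : ℕ) (s : ℤ) (n : ℕ) : ℂ :=
  ∏ k ∈ Finset.range n, qNum N s ((k : ℂ) + 1)

/-- `[p; n]_ε ! = ∏_{k = 0}^{n - 1} [p - k]_ε`. -/
def qFalling (N : ℕ) (s : ℤ) (p : ℂ) (n : ℕ) : ℂ :=
  ∏ k ∈ Finset.range n, qNum N s (p - (k : ℂ))

/-- `r x` is, for every complex `x`, one of the square roots of `[x]_ε`. -/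
def IsRootChoice (N : ℕ) (s : ℤ) (r : ℂ → ℂ) : Prop :=
  ∀ x : ℂ, r x ^ 2 = qNum N s x

/-- The square root of `[n]_ε !` formed with the chosen roots of its factors. -/
def rootFact (r : ℂ → ℂ) (n : ℕ) : ℂ :=
  ∏ k ∈ Finset.range n, r ((k : ℂ) + 1)

/-- The square root of `[p; n]_ε !` formed with the chosen roots of its factors. -/
def rootFalling (r : ℂ → ℂ) (p : ℂ) (n : ℕ) : ℂ :=
  ∏ k ∈ Finset.range n, r (p - (k : ℂ))

theorem rootFact_sq {N : ℕ} {s : ℤ} {r : ℂ → ℂ} (hr : IsRootChoice N s r) (n : ℕ) :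
    rootFact r n ^ 2 = qFact N s n := by
  simp only [rootFact, qFact, ← Finset.prod_pow, hr _]

theorem rootFalling_sq {N : ℕ} {s : ℤ} {r : ℂ → ℂ} (hr : IsRootChoice N s r) (p : ℂ) (n : ℕ) :
    rootFalling r p n ^ 2 = qFalling N s p n := by
  simp only [rootFalling, qFalling, ← Finset.prod_pow, hr _]

/-! ### Clebsch-Gordan coefficients -/

/-- The common expression for the Clebsch-Gordan coefficients
`C(μ₁, μ₂, μ₁ + μ₂ - n; z₁, z₂, z₃)_ε`, the range `S` of the summation variable `ν` being
left open. -/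
def cgExpr (N : ℕ) (s : ℤ) (r : ℂ → ℂ) (S : Finset ℕ) (μ₁ μ₂ : ℂ) (n z₁ z₂ z₃ : ℕ) : ℂ :=
  if z₃ + n = z₁ + z₂ then
    r (2 * μ₁ + 2 * μ₂ - 2 * n + 1)
      * (rootFact r n * rootFact r z₁ * rootFact r z₂ * rootFact r z₃)
      * epsPow N s (((n : ℂ) - (n : ℂ) ^ 2) / 2 + ((n : ℂ) - z₂) * μ₁ + ((n : ℂ) + z₁) * μ₂)
      * ∑ ν ∈ S,
          ((-1) ^ ν * epsPow N s (-(ν : ℂ) * (2 * μ₁ + 2 * μ₂ - n + 1))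
              / (qFact N s ν * qFact N s (n - ν) * qFact N s (z₁ - ν) * qFact N s (z₂ + ν - n)))
            * (rootFalling r (2 * μ₁ - n) (z₁ - ν) * rootFalling r (2 * μ₁ - z₁) (n - ν)
                * rootFalling r (2 * μ₂ - n) (z₂ + ν - n) * rootFalling r (2 * μ₂ - z₂) ν
              / rootFalling r (2 * μ₁ + 2 * μ₂ - n + 1) (z₁ + z₂ + 1))
  else 0

/-- Two color representations `p₁`, `p₂`: here `max {0, n - z₂} ≤ ν ≤ min {n, z₁}`. -/
def cgColorColor (N : ℕ) (s : ℤ) (r : ℂ → ℂ) (p₁ p₂ : ℂ) (n z₁ z₂ z₃ : ℕ) : ℂ :=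
  cgExpr N s r (Finset.Icc (n - z₂) (min n z₁)) p₁ p₂ n z₁ z₂ z₃

/-- Color representation `p₁` and spin `j₂ = m / 2`:
here `max {0, n - z₂} ≤ ν ≤ min {n, z₁, m - z₂}`. -/
def cgColorSpin (N : ℕ) (s : ℤ) (r : ℂ → ℂ) (p₁ : ℂ) (m : ℕ) (n z₁ z₂ z₃ : ℕ) : ℂ :=
  cgExpr N s r (Finset.Icc (n - z₂) (min (min n z₁) (m - z₂))) p₁ ((m : ℂ) / 2) n z₁ z₂ z₃

/-- Spin `j₁ = m / 2` and color representation `p₂`: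
here `max {0, n - z₂, n + z₁ - m} ≤ ν ≤ min {n, z₁}`. -/
def cgSpinColor (N : ℕ) (s : ℤ) (r : ℂ → ℂ) (m : ℕ) (p₂ : ℂ) (n z₁ z₂ z₃ : ℕ) : ℂ :=
  cgExpr N s r (Finset.Icc (max (n - z₂) (n + z₁ - m)) (min n z₁)) ((m : ℂ) / 2) p₂ n z₁ z₂ z₃

/-! ### The explicit matrices -/

/-- `g(p₁, p₂, n; u)_ε = (-1)^n ∏_{k < n} [u - p₁ - p₂ + k]_ε / [u + p₁ + p₂ - k]_ε`. -/
def gCoeff (N : ℕ) (s : ℤ) (p₁ p₂ : ℂ) (n : ℕ) (u : ℂ) : ℂ :=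
  (-1) ^ n * ∏ k ∈ Finset.range n,
    (qNum N s (u - p₁ - p₂ + (k : ℂ)) / qNum N s (u + p₁ + p₂ - (k : ℂ)))

/-- The matrix with row index `a = (a₁, a₂)` and column index `b = (b₁, b₂)` given by the sum over
`0 ≤ n ≤ N - 1`. The inner sum runs over the basis vectors `z` of the component
`V^(p₁ + p₂ - n)`; a term is nonzero only for `z = b₁ + b₂ - n = a₁ + a₂ - n`. -/
def rColor (N : ℕ) (s : ℤ) (r : ℂ → ℂ) (p₁ p₂ u : ℂ) :
    Matrix (Fin N × Fin N) (Fin N × Fin N) ℂ :=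
  Matrix.of fun a b =>
    ∑ n ∈ Finset.range N, ∑ z ∈ Finset.range N,
      gCoeff N s p₁ p₂ n u * cgColorColor N s r p₁ p₂ n b.1 b.2 z
        * cgColorColor N s r p₂ p₁ n a.2 a.1 z

/-- The matrix for a color representation `p₁` and the spin `j₂ = m / 2` representation: the sum
over `0 ≤ n ≤ 2 j₂`. -/
def rMixed (N : ℕ) (s : ℤ) (r : ℂ → ℂ) (p₁ : ℂ) (m : ℕ) (u : ℂ) :
    Matrix (Fin N × Fin (m + 1)) (Fin N × Fin (m + 1)) ℂ :=
  Matrix.of fun a b =>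
    ∑ n ∈ Finset.range (m + 1), ∑ z ∈ Finset.range N,
      gCoeff N s p₁ ((m : ℂ) / 2) n u * cgColorSpin N s r p₁ m n b.1 b.2 z
        * cgSpinColor N s r m p₁ n a.2 a.1 z

/-- Boltzmann weights of the `N`-state colored vertex model:
`X_{αβ}(u)^{ab}_{cd} = R_{p₁ p₂}(ε; u)^{ba}_{cd}`, where `α = ε ^ p₂` and `β = ε ^ p₁`.
The argument `pα` is the `p₂` belonging to `α`, and `pβ` is the `p₁` belonging to `β`. -/
def weight (N : ℕ) (s : ℤ) (r : ℂ → ℂ) (pα pβ u : ℂ) (a b c d : Fin N) : ℂ :=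
  rColor N s r pβ pα u (b, a) (c, d)

/-! ### Representations -/

/-- `X⁺` on the `d`-dimensional representation with parameter `μ` (row `a`, column `b`).
For `d = N` this is the color representation `V_ε^(μ)`, for `d = 2 μ + 1` the spin `μ`
representation. -/
def repXp (r : ℂ → ℂ) (μ : ℂ) (d : ℕ) : Matrix (Fin d) (Fin d) ℂ :=
  Matrix.of fun a b =>
    if (a : ℕ) + 1 = (b : ℕ) then r (2 * μ - ((a : ℕ) : ℂ)) * r (((a : ℕ) : ℂ) + 1) else 0

/-- `X⁻` on the `d`-dimensional representation with parameter `μ`. -/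
def repXm (r : ℂ → ℂ) (μ : ℂ) (d : ℕ) : Matrix (Fin d) (Fin d) ℂ :=
  Matrix.of fun a b =>
    if (a : ℕ) = (b : ℕ) + 1 then r (2 * μ - ((a : ℕ) : ℂ) + 1) * r ((a : ℕ) : ℂ) else 0

/-- `ε ^ (c H)` on the `d`-dimensional representation with parameter `μ`. -/
def repQH (N : ℕ) (s : ℤ) (c μ : ℂ) (d : ℕ) : Matrix (Fin d) (Fin d) ℂ :=
  Matrix.diagonal fun a => epsPow N s (c * (2 * μ - 2 * ((a : ℕ) : ℂ)))

/-- The image of the affine generator `X_i⁺`: `X⁻` for `i = 0` and `X⁺` for `i = 1`. -/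
def hatXp (r : ℂ → ℂ) (i : Fin 2) (μ : ℂ) (d : ℕ) : Matrix (Fin d) (Fin d) ℂ :=
  if i = 0 then repXm r μ d else repXp r μ d

/-- The image of the affine generator `X_i⁻`: `X⁺` for `i = 0` and `X⁻` for `i = 1`. -/
def hatXm (r : ℂ → ℂ) (i : Fin 2) (μ : ℂ) (d : ℕ) : Matrix (Fin d) (Fin d) ℂ :=
  if i = 0 then repXp r μ d else repXm r μ d

/-- The image of `ε ^ (c H_i)`, where `H_0 ↦ -H` and `H_1 ↦ H`. -/
def hatQH (N : ℕ) (s : ℤ) (i : Fin 2) (c μ : ℂ) (d : ℕ) : Matrix (Fin d) (Fin d) ℂ :=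
  if i = 0 then repQH N s (-c) μ d else repQH N s c μ d

/-- `T` is an `R`-matrix with spectral parameter `x` on the tensor product of the representations
`(μ₁, d₁)` and `(μ₂, d₂)`: it intertwines the comultiplication and the opposite comultiplication
of the quantum affine algebra, the parameter `x` being inserted in the first factor. -/
structure IsRMatrix (N : ℕ) (s : ℤ) (r : ℂ → ℂ) (μ₁ : ℂ) (d₁ : ℕ) (μ₂ : ℂ) (d₂ : ℕ) (x : ℂ)
    (T : Matrix (Fin d₁ × Fin d₂) (Fin d₁ × Fin d₂) ℂ) : Prop where
  cartan : ∀ i : Fin 2,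
    T * (hatQH N s i (1 / 2) μ₁ d₁ ⊗ₖ hatQH N s i (1 / 2) μ₂ d₂)
      = (hatQH N s i (1 / 2) μ₁ d₁ ⊗ₖ hatQH N s i (1 / 2) μ₂ d₂) * T
  raising : ∀ i : Fin 2,
    T * ((if i = 0 then x else 1) • (hatXp r i μ₁ d₁ ⊗ₖ hatQH N s i (1 / 2) μ₂ d₂)
          + hatQH N s i (-1 / 2) μ₁ d₁ ⊗ₖ hatXp r i μ₂ d₂)
      = ((if i = 0 then x else 1) • (hatXp r i μ₁ d₁ ⊗ₖ hatQH N s i (-1 / 2) μ₂ d₂)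
          + hatQH N s i (1 / 2) μ₁ d₁ ⊗ₖ hatXp r i μ₂ d₂) * T
  lowering : ∀ i : Fin 2,
    T * ((if i = 0 then x⁻¹ else 1) • (hatXm r i μ₁ d₁ ⊗ₖ hatQH N s i (1 / 2) μ₂ d₂)
          + hatQH N s i (-1 / 2) μ₁ d₁ ⊗ₖ hatXm r i μ₂ d₂)
      = ((if i = 0 then x⁻¹ else 1) • (hatXm r i μ₁ d₁ ⊗ₖ hatQH N s i (-1 / 2) μ₂ d₂)
          + hatQH N s i (1 / 2) μ₁ d₁ ⊗ₖ hatXm r i μ₂ d₂) * T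

/-- No denominator in the entries of `rColor` vanishes. -/
def Generic (N : ℕ) (s : ℤ) (p₁ p₂ u : ℂ) : Prop :=
  (∀ k : ℤ, qNum N s (2 * p₁ + 2 * p₂ + k) ≠ 0) ∧
    ∀ k : ℕ, k + 1 < N → qNum N s (u + p₁ + p₂ - k) ≠ 0

/-- No denominator in the entries of `rMixed` vanishes. -/
def GenericMixed (N : ℕ) (s : ℤ) (p₁ : ℂ) (m : ℕ) (u : ℂ) : Prop :=
  (∀ k : ℤ, qNum N s (2 * p₁ + k) ≠ 0) ∧
    ∀ k : ℕ, k < m → qNum N s (u + p₁ + (m : ℂ) / 2 - k) ≠ 0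

/-- `[2 p - k]_ε ≠ 0` for `0 ≤ k ≤ N - 2`: no matrix element of `X⁺`, `X⁻` between neighbouring basis
vectors of `V_ε^(p)` vanishes, which is the criterion for `V_ε^(p)` to be irreducible. -/
def IrreducibleColor (N : ℕ) (s : ℤ) (p : ℂ) : Prop :=
  ∀ k : ℕ, k + 1 < N → qNum N s (2 * p - k) ≠ 0

end ColoredVertex

end

noncomputable section

namespace ColoredVertex

open scoped Kronecker

/-! ### Quantum numbers -/

section QuantumNumbers

variable {N : ℕ} {s : ℤ}

local notation "ε" => epsPow N s
local notation "qn" => qNum N s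

/-! The R-matrix acts by scalars on the Clebsch-Gordan decomposition. Put P = p₁ + p₂. For generic P
the vectors `cgVec`, indexed by a component n and a depth z, form an orthogonal basis of V₁ ⊗ V₂ for
the symmetric bilinear dot product: X⁻ raises z, X⁺ is its transpose, the norms follow from the
q-Vandermonde identity, and completeness is a dimension count.

For scalars G n let `rGen` send the n-th component of V₁ ⊗ V₂ to G n times the n-th component for
the exchanged order of factors. It intertwines X₁^± whatever G is. For X₀⁺ consider the defect Q = R
Δ(X₀⁺) - Δ'(X₀⁺) R. It commutes with X⁻, so it is determined by the highest weight vectors v_n. A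
vector killed by X⁺ and orthogonal to all highest weight vectors is zero, and for Q v_n both
conditions reduce to the recursion G (n+1) (ε^(P-n) - x ε^(-(P-n))) = G n (x ε^(P-n) - ε^(-(P-n))),
needed only up to the factor θ₁ n θ₂ n (`rGen_mul_aff`). At x = ε^(-2u) this is the recursion of g.
Transposition gives X₀⁻.

For a spin j₂ = m/2 one takes p₂ = m/2 in dimension N. The root of [0] decouples the first m + 1
basis vectors, and it also makes θ₂ m vanish, so G may be cut off after n = m; restricting to the
block gives `rMixed`.

Uniqueness: a solution whose (00,00) entry is 0 vanishes. The relations for two independent raising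
operators propagate zeros through the weights, with determinant ε^(P-k) - x ε^(-(P-k)), nonzero
exactly by the condition on u (`eq_zero_of_affineRel`).

Yang-Baxter: the difference of the two sides intertwines all threefold coproducts and kills e₀ ⊗ e₀
⊗ e₀. Clear denominators and scale the spectral parameters x, y, xy to tx, ty, t²xy; the difference
becomes polynomial in t. At t = 0 the affine generators degenerate to operators that are simple
enough to show that only the zero matrix satisfies the relations and kills that vector
(`eq_zero_of_triple_relations`). Dividing by powers of t, the whole family vanishes. This needs
irreducible factors and [2] ≠ 0. Reducible factors follow by continuity in the p_i, with square
roots chosen continuously at the given point. For N = 2, where [2] = 0, the weights are those of a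
free-fermion six vertex model and the equation is checked entry by entry. -/

theorem eps_add (x y : ℂ) : ε (x + y) = ε x * ε y := by
  simp only [epsPow, ← Complex.exp_add]; congr 1; ring

@[simp] theorem eps_zero : ε 0 = 1 := by simp [epsPow]

@[simp] theorem eps_ne_zero (x : ℂ) : ε x ≠ 0 := Complex.exp_ne_zero _

theorem eps_neg (x : ℂ) : ε (-x) = (ε x)⁻¹ := by
  refine eq_inv_of_mul_eq_one_left ?_
  rw [← eps_add, neg_add_cancel, eps_zero]

theorem eps_sub (x y : ℂ) : ε (x - y) = ε x / ε y := by
  rw [sub_eq_add_neg, eps_add, eps_neg, div_eq_mul_inv]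

theorem eps_two_mul (x : ℂ) : ε (2 * x) = ε x ^ 2 := by
  rw [two_mul, eps_add, sq]

theorem continuous_epsPow : Continuous (epsPow N s) := by
  unfold epsPow; fun_prop

theorem continuous_qNum : Continuous (qNum N s) := by
  unfold qNum
  exact ((continuous_epsPow).sub (continuous_epsPow.comp continuous_neg)).div_const _

@[simp] theorem qNum_zero : qn 0 = 0 := by simp [qNum]

theorem qNum_neg (x : ℂ) : qn (-x) = -qn x := by
  simp only [qNum, neg_neg]; ring

/-- The addition formula for quantum numbers. -/
theorem qNum_add (x y : ℂ) : qn (x + y) = qn x * ε y + ε (-x) * qn y := by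
  simp only [qNum, neg_add, eps_add]; ring

theorem qNum_add' (x y : ℂ) : qn (x + y) = qn x * ε (-y) + ε x * qn y := by
  simp only [qNum, neg_add, eps_add]; ring

theorem eps_eq_one_iff (hN : 2 ≤ N) (x : ℂ) : ε (2 * x) = 1 ↔ ∃ k : ℤ, (s : ℂ) * x = k * N := by
  have hN0 : (N : ℂ) ≠ 0 := by exact_mod_cast (by omega : N ≠ 0)
  have hpi : (Real.pi : ℂ) ≠ 0 := by exact_mod_cast Real.pi_ne_zero
  rw [epsPow, Complex.exp_eq_one_iff]
  refine exists_congr fun k => ?_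
  constructor
  · intro h
    field_simp at h
    linear_combination h
  · intro h
    field_simp
    linear_combination h

theorem eps_sq_nat_eq_one_iff (hN : 2 ≤ N) (hs : IsCoprime s (N : ℤ)) (k : ℤ) :
    ε (2 * k) = 1 ↔ (N : ℤ) ∣ k := by
  rw [eps_eq_one_iff hN]
  constructor
  · rintro ⟨m, hm⟩
    have h : s * k = m * N := by exact_mod_cast hm
    exact hs.symm.dvd_of_dvd_mul_left ⟨m, by rw [h, mul_comm]⟩
  · rintro ⟨m, rfl⟩
    exact ⟨s * m, by push_cast; ring⟩

theorem eps_one_sub_ne_zero (hN : 2 ≤ N) (hs : IsCoprime s (N : ℤ)) : ε 1 - ε (-1) ≠ 0 := by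
  intro h
  have h1 : ε (2 * ((1 : ℤ) : ℂ)) = 1 := by
    rw [Int.cast_one, eps_two_mul, sq]
    nth_rewrite 2 [sub_eq_zero.mp h]
    rw [← eps_add, add_neg_cancel, eps_zero]
  have := Int.le_of_dvd one_pos ((eps_sq_nat_eq_one_iff hN hs 1).mp h1)
  omega

theorem qNum_mul_den (hN : 2 ≤ N) (hs : IsCoprime s (N : ℤ)) (x : ℂ) :
    qn x * (ε 1 - ε (-1)) = ε x - ε (-x) :=
  div_mul_cancel₀ _ (eps_one_sub_ne_zero hN hs)

theorem qNum_eq_zero_iff (hN : 2 ≤ N) (hs : IsCoprime s (N : ℤ)) (x : ℂ) :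
    qn x = 0 ↔ ε (2 * x) = 1 := by
  rw [qNum, div_eq_zero_iff, or_iff_left (eps_one_sub_ne_zero hN hs), sub_eq_zero, eps_neg,
    eps_two_mul, sq]
  exact ⟨fun h => by nth_rewrite 2 [h]; exact mul_inv_cancel₀ (eps_ne_zero x),
    fun h => eq_inv_of_mul_eq_one_left h⟩

theorem qNum_one (hN : 2 ≤ N) (hs : IsCoprime s (N : ℤ)) : qn 1 = 1 :=
  div_self (eps_one_sub_ne_zero hN hs)

theorem qNum_int_eq_zero_iff (hN : 2 ≤ N) (hs : IsCoprime s (N : ℤ)) (k : ℤ) :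
    qn k = 0 ↔ (N : ℤ) ∣ k := by
  rw [qNum_eq_zero_iff hN hs, eps_sq_nat_eq_one_iff hN hs]

theorem qNum_natCast_self (hN : 2 ≤ N) (hs : IsCoprime s (N : ℤ)) : qn N = 0 := by
  have := (qNum_int_eq_zero_iff hN hs (N : ℤ)).mpr dvd_rfl
  exact_mod_cast this

theorem qNum_natCast_ne_zero (hN : 2 ≤ N) (hs : IsCoprime s (N : ℤ)) {k : ℕ} (h0 : 0 < k)
    (hk : k < N) : qn k ≠ 0 := by
  intro h
  have h' : qn ((k : ℤ) : ℂ) = 0 := by exact_mod_cast h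
  have := Int.le_of_dvd (by exact_mod_cast h0) ((qNum_int_eq_zero_iff hN hs k).mp h')
  omega

theorem qNum_succ_ne_zero (hN : 2 ≤ N) (hs : IsCoprime s (N : ℤ)) {k : ℕ} (hk : k + 1 < N) :
    qn ((k : ℂ) + 1) ≠ 0 := by
  have := qNum_natCast_ne_zero hN hs (Nat.succ_pos k) hk
  exact_mod_cast this

theorem qNum_two (hN : 2 ≤ N) (hs : IsCoprime s (N : ℤ)) : qn 2 = ε 1 + ε (-1) := by
  rw [← one_add_one_eq_two, qNum_add, qNum_one hN hs, one_mul, mul_one]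

/-- The shift may change the sign of [x], but ε^(2N) = 1 preserves its vanishing. Conditions over
all integers thus become finitely many. -/
theorem qNum_add_mul_self (hN : 2 ≤ N) (hs : IsCoprime s (N : ℤ)) (x : ℂ) (k : ℤ) :
    qn (x + k * N) = 0 ↔ qn x = 0 := by
  have : ε (2 * ((k * N : ℤ) : ℂ)) = 1 :=
    (eps_sq_nat_eq_one_iff hN hs _).mpr (Dvd.intro_left k rfl)
  push_cast at this
  rw [qNum_eq_zero_iff hN hs, qNum_eq_zero_iff hN hs, mul_add, eps_add, this, mul_one]

theorem qFact_succ (n : ℕ) : qFact N s (n + 1) = qFact N s n * qn ((n : ℂ) + 1) :=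
  Finset.prod_range_succ _ _

@[simp] theorem qFact_zero : qFact N s 0 = 1 := Finset.prod_range_zero _

theorem qFact_ne_zero (hN : 2 ≤ N) (hs : IsCoprime s (N : ℤ)) {n : ℕ} (hn : n < N) :
    qFact N s n ≠ 0 := by
  refine Finset.prod_ne_zero_iff.mpr fun k hk => qNum_succ_ne_zero hN hs ?_
  have := Finset.mem_range.mp hk
  omega

theorem qFalling_succ (p : ℂ) (n : ℕ) :
    qFalling N s p (n + 1) = qFalling N s p n * qn (p - n) :=
  Finset.prod_range_succ _ _

end QuantumNumbers

/-! ### Clebsch-Gordan vectors with prescribed roots -/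

/-- `1 / [a - i]_ε !`, understood as `0` if `a < i`. -/
def invFactSub (N : ℕ) (s : ℤ) (a i : ℕ) : ℂ :=
  if i ≤ a then (qFact N s (a - i))⁻¹ else 0

/-- The product of the roots `θ` over `[n, n + b - i)` and `[b, b + j)`. -/
def thetaProd (θ : ℕ → ℂ) (n b i j : ℕ) : ℂ :=
  (∏ k ∈ Finset.range (b - i), θ (n + k)) * ∏ k ∈ Finset.range j, θ (b + k)

/-- A summand of the Clebsch-Gordan coefficient, the roots of `[2 p₁ - k]_ε`, `[2 p₂ - k]_ε` being
`θ₁ k`, `θ₂ k`. -/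
def cgTerm (N : ℕ) (s : ℤ) (p₁ p₂ : ℂ) (θ₁ θ₂ : ℕ → ℂ) (n b₁ b₂ i j : ℕ) : ℂ :=
  (-1) ^ i * epsPow N s (-(i : ℂ) * (2 * p₁ + 2 * p₂ - n + 1))
    * ((qFact N s i)⁻¹ * (qFact N s j)⁻¹ * invFactSub N s b₁ i * invFactSub N s b₂ j)
    * (thetaProd θ₁ n b₁ i j * thetaProd θ₂ n b₂ j i)

/-- The sum in the Clebsch-Gordan coefficient. -/
def cgSum (N : ℕ) (s : ℤ) (p₁ p₂ : ℂ) (θ₁ θ₂ : ℕ → ℂ) (n b₁ b₂ : ℕ) : ℂ :=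
  ∑ ij ∈ Finset.HasAntidiagonal.antidiagonal n, cgTerm N s p₁ p₂ θ₁ θ₂ n b₁ b₂ ij.1 ij.2

section Recursion

variable {N : ℕ} {s : ℤ}

local notation "ε" => epsPow N s
local notation "qn" => qNum N s

theorem qNum_mul_inv_qFact (hN : 2 ≤ N) (hs : IsCoprime s (N : ℤ)) {k : ℕ} (hk : k + 1 < N) :
    qn ((k : ℂ) + 1) * (qFact N s (k + 1))⁻¹ = (qFact N s k)⁻¹ := by
  rw [qFact_succ, mul_inv, mul_comm, mul_assoc, inv_mul_cancel₀ (qNum_succ_ne_zero hN hs hk),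
    mul_one]

/-- This is the contribution of one tensor factor to the action of X⁻ on a summand. All terms share
the roots of the right side; the first has in addition θ (b-1) twice and the second θ (b+j-1) twice,
since n - i = j makes the two root intervals end at the same index. The squares are [p-b+1] and
[p-b+1-j], which `hcd` combines. -/
theorem lower_term (hN : 2 ≤ N) (hs : IsCoprime s (N : ℤ)) {p : ℂ} {θ : ℕ → ℂ}
    (hθ : ∀ k : ℕ, θ k ^ 2 = qn (p - k)) {n b i j : ℕ} (hij : i + j = n) (hb : b < N) {c d : ℂ}
    (hcd : qn (p - b + 1) - c * qn (p - b + 1 - j) = d * qn j) (hc : j = 0 → c = 1) :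
    (if b = 0 then 0 else θ (b - 1) * (invFactSub N s (b - 1) i * thetaProd θ n (b - 1) i j))
        - c * qn ((b : ℂ) - i) * (invFactSub N s b i * thetaProd θ n b i j)
      = d * qn j * (invFactSub N s b (i + 1) * thetaProd θ n b (i + 1) (j - 1)) := by
  subst hij
  rcases lt_trichotomy b i with h | rfl | h
  · have h1 : ¬ i ≤ b - 1 := by omega
    simp [invFactSub, h1, not_le.mpr h, show ¬ i + 1 ≤ b by omega]
  · rcases b with _ | b <;> simp [invFactSub]
  · obtain ⟨a, rfl⟩ := Nat.exists_eq_add_of_lt h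
    have e1 : i + a + 1 - i = a + 1 := by omega
    have e2 : i + a - i = a := by omega
    have e3 : i + a + 1 - (i + 1) = a := by omega
    have hq : qn (((i + a + 1 : ℕ) : ℂ) - i) * (qFact N s (a + 1))⁻¹ = (qFact N s a)⁻¹ := by
      rw [← qNum_mul_inv_qFact hN hs (show a + 1 < N by omega)]
      congr 2; push_cast; ring
    simp only [invFactSub, if_neg (Nat.succ_ne_zero _), Nat.add_sub_cancel, e1, e2, e3,
      if_pos (show i ≤ i + a by omega), if_pos (show i ≤ i + a + 1 by omega),
      if_pos (show i + 1 ≤ i + a + 1 by omega)]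
    rw [show ∀ x y z : ℂ, c * x * (y * z) = c * (x * y) * z by intros; ring, hq]
    -- For j = 0 the truncated index j - 1 is harmless because [0] = 0, and the two terms on the
    -- left agree when c = 1.
    rcases j with _ | j
    · simp only [hc rfl, thetaProd, e1, e2, Finset.range_zero, Finset.prod_empty,
        Finset.prod_range_succ _ a, Nat.cast_zero, qNum_zero, Nat.add_zero]
      ring
    · have h1 : θ (i + a) ^ 2 = qn (p - ((i + a + 1 : ℕ) : ℂ) + 1) := by
        rw [hθ]; congr 1; push_cast; ring
      have h2 : θ (i + a + 1 + j) ^ 2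
          = qn (p - ((i + a + 1 : ℕ) : ℂ) + 1 - ((j + 1 : ℕ) : ℂ)) := by
        rw [hθ]; congr 1; push_cast; ring
      rw [← h1, ← h2] at hcd
      have f1 : ∏ k ∈ Finset.range (a + 1), θ (i + (j + 1) + k)
          = (∏ k ∈ Finset.range a, θ (i + (j + 1) + k)) * θ (i + a + 1 + j) := by
        rw [Finset.prod_range_succ, show i + (j + 1) + a = i + a + 1 + j by omega]
      have f2 : ∏ k ∈ Finset.range (j + 1), θ (i + a + k)
          = (∏ k ∈ Finset.range j, θ (i + a + 1 + k)) * θ (i + a) := by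
        rw [Finset.prod_range_succ', Nat.add_zero]
        congr 1
        exact Finset.prod_congr rfl fun k _ => congrArg θ (by omega)
      have f3 := Finset.prod_range_succ (fun k => θ (i + a + 1 + k)) j
      simp only [thetaProd, e1, e2, e3, Nat.add_sub_cancel, f1, f2, f3]
      rw [← hcd]
      ring

/-- This is X⁻ on a Clebsch-Gordan vector, stripped of prefactors. The addition formula splits [b₁ +
b₂ - n] into [b₁ - i] and [b₂ - j], one for each tensor factor. `lower_term` then leaves one error
term for each factor, and these cancel between neighbouring summands. -/
theorem cg_lower_aux (hN : 2 ≤ N) (hs : IsCoprime s (N : ℤ)) {p₁ p₂ : ℂ} {θ₁ θ₂ : ℕ → ℂ}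
    (hθ₁ : ∀ k : ℕ, θ₁ k ^ 2 = qn (2 * p₁ - k)) (hθ₂ : ∀ k : ℕ, θ₂ k ^ 2 = qn (2 * p₂ - k))
    {n b₁ b₂ : ℕ} (hn : n < N) (hb₁ : b₁ < N) (hb₂ : b₂ < N) :
    ε (-b₂) * (if b₁ = 0 then 0 else θ₁ (b₁ - 1) * cgSum N s p₁ p₂ θ₁ θ₂ n (b₁ - 1) b₂)
      + ε b₁ * (if b₂ = 0 then 0 else θ₂ (b₂ - 1) * cgSum N s p₁ p₂ θ₁ θ₂ n b₁ (b₂ - 1))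
      = qn ((b₁ : ℂ) + b₂ - n) * cgSum N s p₁ p₂ θ₁ θ₂ n b₁ b₂ := by
  set S : ℕ → ℂ := fun i => (-1) ^ i * ε (-(i : ℂ) * (2 * p₁ + 2 * p₂ - n + 1)) with hS
  set H₁ : ℕ → ℕ → ℂ := fun i j => S i * (qFact N s i)⁻¹ * (qFact N s j)⁻¹
    * (invFactSub N s b₂ j * thetaProd θ₂ n b₂ j i) * ε (-b₂) * (ε (j - (2 * p₁ - b₁ + 1)) * qn j
      * (invFactSub N s b₁ (i + 1) * thetaProd θ₁ n b₁ (i + 1) (j - 1))) with hH₁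
  set H₂ : ℕ → ℕ → ℂ := fun i j => S i * (qFact N s i)⁻¹ * (qFact N s j)⁻¹
    * (invFactSub N s b₁ i * thetaProd θ₁ n b₁ i j) * ε b₁ * (ε (2 * p₂ - b₂ + 1 - i) * qn i
      * (invFactSub N s b₂ (j + 1) * thetaProd θ₂ n b₂ (j + 1) (i - 1))) with hH₂
  -- The error of the first factor at (i, j+1) cancels that of the second at (i+1, j). The two
  -- boundary errors carry [0].
  have key : ∑ ij ∈ Finset.HasAntidiagonal.antidiagonal n, (H₁ ij.1 ij.2 + H₂ ij.1 ij.2) = 0 := by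
    rw [Finset.sum_add_distrib]
    rcases n with _ | n
    · simp [hH₁, hH₂]
    · rw [Finset.Nat.sum_antidiagonal_succ', Finset.Nat.sum_antidiagonal_succ
        (f := fun ij : ℕ × ℕ => H₂ ij.1 ij.2)]
      have z1 : H₁ (n + 1) 0 = 0 := by simp [hH₁]
      have z2 : H₂ 0 (n + 1) = 0 := by simp [hH₂]
      rw [z1, z2, zero_add, zero_add, ← Finset.sum_add_distrib]
      refine Finset.sum_eq_zero fun ij hij => ?_
      obtain ⟨i, j⟩ := ij
      have hij' : i + j = n := Finset.HasAntidiagonal.mem_antidiagonal.mp hij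
      have hi := qNum_mul_inv_qFact hN hs (show i + 1 < N by omega)
      have hj := qNum_mul_inv_qFact hN hs (show j + 1 < N by omega)
      -- The sign and the power of ε in the summand are exactly those that make neighbouring errors
      -- opposite.
      have hsgn : S i * (ε (-b₂) * ε (((j + 1 : ℕ) : ℂ) - (2 * p₁ - b₁ + 1)))
          + S (i + 1) * (ε b₁ * ε (2 * p₂ - b₂ + 1 - ((i + 1 : ℕ) : ℂ))) = 0 := by
        simp only [hS]
        rw [mul_assoc, mul_assoc, ← eps_add, ← eps_add, ← eps_add, ← eps_add, pow_succ,
          ← hij']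
        push_cast
        rw [show -((i : ℂ) + 1) * (2 * p₁ + 2 * p₂ - ((i : ℂ) + j + 1) + 1)
            + (b₁ + (2 * p₂ - b₂ + 1 - ((i : ℂ) + 1)))
          = -(i : ℂ) * (2 * p₁ + 2 * p₂ - ((i : ℂ) + j + 1) + 1)
            + (-(b₂ : ℂ) + ((j : ℂ) + 1 - (2 * p₁ - b₁ + 1))) by ring]
        ring
      simp only [hH₁, hH₂, Nat.add_sub_cancel]
      have hi' : qn ((i + 1 : ℕ) : ℂ) = qn ((i : ℂ) + 1) := by push_cast; rfl
      have hj' : qn ((j + 1 : ℕ) : ℂ) = qn ((j : ℂ) + 1) := by push_cast; rfl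
      rw [hi', hj']
      set T₁ := invFactSub N s b₁ (i + 1) * thetaProd θ₁ (n + 1) b₁ (i + 1) j
      set T₂ := invFactSub N s b₂ (j + 1) * thetaProd θ₂ (n + 1) b₂ (j + 1) i
      calc _ = (qFact N s i)⁻¹ * (qn ((j : ℂ) + 1) * (qFact N s (j + 1))⁻¹) * T₁ * T₂
                * (S i * (ε (-b₂) * ε (((j + 1 : ℕ) : ℂ) - (2 * p₁ - b₁ + 1))))
              + (qn ((i : ℂ) + 1) * (qFact N s (i + 1))⁻¹) * (qFact N s j)⁻¹ * T₁ * T₂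
                * (S (i + 1) * (ε b₁ * ε (2 * p₂ - b₂ + 1 - ((i + 1 : ℕ) : ℂ)))) := by ring
        _ = (qFact N s i)⁻¹ * (qFact N s j)⁻¹ * T₁ * T₂ *
              (S i * (ε (-b₂) * ε (((j + 1 : ℕ) : ℂ) - (2 * p₁ - b₁ + 1)))
                + S (i + 1) * (ε b₁ * ε (2 * p₂ - b₂ + 1 - ((i + 1 : ℕ) : ℂ)))) := by
            rw [hi, hj]; ring
        _ = 0 := by rw [hsgn, mul_zero]
  have e1 : (if b₁ = 0 then 0 else θ₁ (b₁ - 1) * cgSum N s p₁ p₂ θ₁ θ₂ n (b₁ - 1) b₂)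
      = ∑ ij ∈ Finset.HasAntidiagonal.antidiagonal n,
        if b₁ = 0 then 0 else θ₁ (b₁ - 1) * cgTerm N s p₁ p₂ θ₁ θ₂ n (b₁ - 1) b₂ ij.1 ij.2 := by
    split_ifs
    · simp
    · rw [cgSum, Finset.mul_sum]
  have e2 : (if b₂ = 0 then 0 else θ₂ (b₂ - 1) * cgSum N s p₁ p₂ θ₁ θ₂ n b₁ (b₂ - 1))
      = ∑ ij ∈ Finset.HasAntidiagonal.antidiagonal n,
        if b₂ = 0 then 0 else θ₂ (b₂ - 1) * cgTerm N s p₁ p₂ θ₁ θ₂ n b₁ (b₂ - 1) ij.1 ij.2 := by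
    split_ifs
    · simp
    · rw [cgSum, Finset.mul_sum]
  rw [← sub_eq_zero, e1, e2, cgSum, Finset.mul_sum, Finset.mul_sum, Finset.mul_sum,
    ← Finset.sum_add_distrib, ← Finset.sum_sub_distrib]
  refine Eq.trans ?_ key
  refine Finset.sum_congr rfl fun ij hij => ?_
  obtain ⟨i, j⟩ := ij
  have hij' : i + j = n := Finset.HasAntidiagonal.mem_antidiagonal.mp hij
  -- The constants come from the two forms of the addition formula: [y] - ε^j [y-j] = ε^(j-y) [j]
  -- here, and [y] - ε^(-i) [y-i] = ε^(y-i) [i] for the other factor.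
  have l1 := lower_term hN hs hθ₁ hij' hb₁ (c := ε j) (d := ε (j - (2 * p₁ - b₁ + 1)))
    (by simp only [qNum, eps_sub, eps_neg, eps_add]
        have := eps_ne_zero (N := N) (s := s)
        field_simp; ring) (by rintro rfl; simp)
  have l2 := lower_term hN hs hθ₂ (by omega : j + i = n) hb₂ (c := ε (-i))
    (d := ε (2 * p₂ - b₂ + 1 - i))
    (by simp only [qNum, eps_sub, eps_neg, eps_add]
        have := eps_ne_zero (N := N) (s := s)
        field_simp; ring) (by rintro rfl; simp)
  have hz : qn ((b₁ : ℂ) + b₂ - n) = ε (-b₂) * (ε j * qn ((b₁ : ℂ) - i))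
      + ε b₁ * (ε (-i) * qn ((b₂ : ℂ) - j)) := by
    rw [← mul_assoc, ← mul_assoc, ← eps_add, ← eps_add, ← hij',
      show (b₁ : ℂ) + b₂ - ((i + j : ℕ) : ℂ) = (b₁ - i) + (b₂ - j) by push_cast; ring, qNum_add']
    rw [show -((b₂ : ℂ) - j) = -b₂ + j by ring, show (b₁ : ℂ) - i = b₁ + -i by ring]
    ring
  simp only [hH₁, hH₂]
  rw [← l1, ← l2, hz]
  simp only [cgTerm, hS]
  split_ifs <;> ring

end Recursion

/-! ### Highest weight vectors -/

/-- The coefficient at `e_{b₁} ⊗ e_{b₂}` of the vector of weight `b₁ + b₂` in the component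
labelled by `n`. -/
def cgVal (N : ℕ) (s : ℤ) (p₁ p₂ : ℂ) (φ θ₁ θ₂ : ℕ → ℂ) (n b₁ b₂ : ℕ) : ℂ :=
  ((∏ k ∈ Finset.range b₁, φ k) * ∏ k ∈ Finset.range b₂, φ k)
    * epsPow N s (((n : ℂ) - (n : ℂ) ^ 2) / 2 + ((n : ℂ) - b₂) * p₁ + ((n : ℂ) + b₁) * p₂)
    * cgSum N s p₁ p₂ θ₁ θ₂ n b₁ b₂

/-- The closed form of `cgVal` for the highest weight vector, `n = b₁ + b₂`. -/
def hwVal (N : ℕ) (s : ℤ) (p₁ p₂ : ℂ) (φ θ₁ θ₂ : ℕ → ℂ) (b₁ b₂ : ℕ) : ℂ :=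
  (-1) ^ b₁ * epsPow N s (((b₁ : ℂ) + b₂) * p₂ + (((b₁ : ℂ) + b₂) - ((b₁ : ℂ) + b₂) ^ 2) / 2
      - b₁ * (p₁ + p₂ - (b₁ + b₂) + 1))
    * (((∏ k ∈ Finset.range b₁, φ k) * ∏ k ∈ Finset.range b₂, φ k)
      * ((qFact N s b₁)⁻¹ * (qFact N s b₂)⁻¹))
    * ((∏ k ∈ Finset.range b₂, θ₁ (b₁ + k)) * ∏ k ∈ Finset.range b₁, θ₂ (b₂ + k))

/-- The rising product `[x] [x + 1] ⋯ [x + n - 1]`. -/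
def qRising (N : ℕ) (s : ℤ) (x : ℂ) (n : ℕ) : ℂ :=
  ∏ k ∈ Finset.range n, qNum N s (x + k)

section HighestWeight

variable {N : ℕ} {s : ℤ} {p₁ p₂ : ℂ} {φ θ₁ θ₂ : ℕ → ℂ}

local notation "ε" => epsPow N s
local notation "qn" => qNum N s

/-- For n = b₁ + b₂ the constraints i ≤ b₁ and j ≤ b₂ leave a single summand. -/
theorem cgVal_add (b₁ b₂ : ℕ) :
    cgVal N s p₁ p₂ φ θ₁ θ₂ (b₁ + b₂) b₁ b₂ = hwVal N s p₁ p₂ φ θ₁ θ₂ b₁ b₂ := by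
  have : cgSum N s p₁ p₂ θ₁ θ₂ (b₁ + b₂) b₁ b₂
      = cgTerm N s p₁ p₂ θ₁ θ₂ (b₁ + b₂) b₁ b₂ b₁ b₂ := by
    rw [cgSum, Finset.sum_eq_single (b₁, b₂)]
    · rintro ⟨i, j⟩ hij hne
      have hij := Finset.HasAntidiagonal.mem_antidiagonal.mp hij
      have : ¬ (i ≤ b₁ ∧ j ≤ b₂) := by
        rintro ⟨h1, h2⟩
        exact hne (Prod.ext (by simp only at *; omega) (by simp only at *; omega))
      rw [cgTerm, invFactSub, invFactSub]
      rcases not_and_or.mp this with h | h <;> simp [h]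
    · intro h
      exact absurd (Finset.HasAntidiagonal.mem_antidiagonal.mpr (rfl : b₁ + b₂ = b₁ + b₂)) h
  rw [cgVal, this, cgTerm, hwVal]
  simp only [invFactSub, le_refl, if_true, Nat.sub_self, qFact_zero, inv_one, mul_one, thetaProd,
    Finset.range_zero, Finset.prod_empty, one_mul]
  rw [show ∀ x y z w t v : ℂ, x * y * (z * w * t * v) = z * (y * w) * (x * t) * v by
    intros; ring, ← eps_add]
  congr 4
  push_cast
  ring

/-- Raising one tensor factor turns the closed form at level n + 1 into the one at level n = b₁ +
b₂. The roots θ₁ b₁ and φ b₁ shift the products by one step, and what is left over is θ₁ n θ₂ n.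
With its mirror image this gives both the highest weight property and the action of the affine
generator between components. -/
theorem hwVal_succ_left (hN : 2 ≤ N) (hs : IsCoprime s (N : ℤ))
    (hφ : ∀ k : ℕ, φ k ^ 2 = qn ((k : ℂ) + 1)) {b₁ b₂ : ℕ} (hb : b₁ + 1 < N) :
    θ₁ b₁ * φ b₁ * hwVal N s p₁ p₂ φ θ₁ θ₂ (b₁ + 1) b₂
      = -ε (b₁ - p₁) * (θ₁ (b₁ + b₂) * θ₂ (b₁ + b₂)) * hwVal N s p₁ p₂ φ θ₁ θ₂ b₁ b₂ := by
  have h1 : θ₁ b₁ * ∏ k ∈ Finset.range b₂, θ₁ (b₁ + 1 + k)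
      = (∏ k ∈ Finset.range b₂, θ₁ (b₁ + k)) * θ₁ (b₁ + b₂) := by
    rw [← Finset.prod_range_succ (fun k => θ₁ (b₁ + k)), Finset.prod_range_succ', mul_comm,
      Nat.add_zero]
    congr 1
    exact Finset.prod_congr rfl fun k _ => congrArg θ₁ (by omega)
  have h2 := Finset.prod_range_succ (fun k => θ₂ (b₂ + k)) b₁
  have h3 := qNum_mul_inv_qFact hN hs hb
  rw [← hφ] at h3
  have h4 : ε ((((b₁ + 1 : ℕ) : ℂ) + b₂) * p₂
        + ((((b₁ + 1 : ℕ) : ℂ) + b₂) - (((b₁ + 1 : ℕ) : ℂ) + b₂) ^ 2) / 2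
        - ((b₁ + 1 : ℕ) : ℂ) * (p₁ + p₂ - (((b₁ + 1 : ℕ) : ℂ) + b₂) + 1))
      = ε (b₁ - p₁) * ε (((b₁ : ℂ) + b₂) * p₂ + (((b₁ : ℂ) + b₂) - ((b₁ : ℂ) + b₂) ^ 2) / 2
        - b₁ * (p₁ + p₂ - (b₁ + b₂) + 1)) := by
    rw [← eps_add]; congr 1; push_cast; ring
  rw [hwVal, hwVal, h4, h2, ← h3, Finset.prod_range_succ, pow_succ, add_comm b₂ b₁]
  linear_combination (-(-1) ^ b₁ * ε (b₁ - p₁)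
    * ε (((b₁ : ℂ) + b₂) * p₂ + (((b₁ : ℂ) + b₂) - ((b₁ : ℂ) + b₂) ^ 2) / 2
        - b₁ * (p₁ + p₂ - (b₁ + b₂) + 1)) * φ b₁ ^ 2 * ((∏ k ∈ Finset.range b₁, φ k)
        * ∏ k ∈ Finset.range b₂, φ k) * (qFact N s (b₁ + 1))⁻¹ * (qFact N s b₂)⁻¹
        * (∏ k ∈ Finset.range b₁, θ₂ (b₂ + k)) * θ₂ (b₁ + b₂)) * h1

theorem hwVal_succ_right (hN : 2 ≤ N) (hs : IsCoprime s (N : ℤ))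
    (hφ : ∀ k : ℕ, φ k ^ 2 = qn ((k : ℂ) + 1)) {b₁ b₂ : ℕ} (hb : b₂ + 1 < N) :
    θ₂ b₂ * φ b₂ * hwVal N s p₁ p₂ φ θ₁ θ₂ b₁ (b₂ + 1)
      = ε (p₂ - b₂) * (θ₁ (b₁ + b₂) * θ₂ (b₁ + b₂)) * hwVal N s p₁ p₂ φ θ₁ θ₂ b₁ b₂ := by
  have h1 : θ₂ b₂ * ∏ k ∈ Finset.range b₁, θ₂ (b₂ + 1 + k)
      = (∏ k ∈ Finset.range b₁, θ₂ (b₂ + k)) * θ₂ (b₂ + b₁) := by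
    rw [← Finset.prod_range_succ (fun k => θ₂ (b₂ + k)), Finset.prod_range_succ', mul_comm,
      Nat.add_zero]
    congr 1
    exact Finset.prod_congr rfl fun k _ => congrArg θ₂ (by omega)
  have h2 := Finset.prod_range_succ (fun k => θ₁ (b₁ + k)) b₂
  have h3 := qNum_mul_inv_qFact hN hs hb
  rw [← hφ] at h3
  have h4 : ε (((b₁ : ℂ) + (b₂ + 1 : ℕ)) * p₂
        + (((b₁ : ℂ) + (b₂ + 1 : ℕ)) - ((b₁ : ℂ) + (b₂ + 1 : ℕ)) ^ 2) / 2
        - b₁ * (p₁ + p₂ - (b₁ + (b₂ + 1 : ℕ)) + 1))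
      = ε (p₂ - b₂) * ε (((b₁ : ℂ) + b₂) * p₂ + (((b₁ : ℂ) + b₂) - ((b₁ : ℂ) + b₂) ^ 2) / 2
        - b₁ * (p₁ + p₂ - (b₁ + b₂) + 1)) := by
    rw [← eps_add]; congr 1; push_cast; ring
  rw [hwVal, hwVal, h4, h2, ← h3, Finset.prod_range_succ, add_comm b₁ b₂]
  rw [add_comm b₂ b₁] at h1 ⊢
  linear_combination ((-1) ^ b₁ * ε (p₂ - b₂)
    * ε (((b₁ : ℂ) + b₂) * p₂ + (((b₁ : ℂ) + b₂) - ((b₁ : ℂ) + b₂) ^ 2) / 2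
        - b₁ * (p₁ + p₂ - (b₁ + b₂) + 1)) * φ b₂ ^ 2 * ((∏ k ∈ Finset.range b₁, φ k)
        * ∏ k ∈ Finset.range b₂, φ k) * (qFact N s b₁)⁻¹ * (qFact N s (b₂ + 1))⁻¹
        * (∏ k ∈ Finset.range b₂, θ₁ (b₁ + k)) * θ₁ (b₁ + b₂)) * h1

theorem qRising_succ (x : ℂ) (n : ℕ) : qRising N s x (n + 1) = qRising N s x n * qn (x + n) :=
  Finset.prod_range_succ _ _

/-- The `q`-analogue of the Chu-Vandermonde identity. -/
theorem qVandermonde (hN : 2 ≤ N) (hs : IsCoprime s (N : ℤ)) (x y : ℂ) {n : ℕ} (hn : n < N) :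
    ∑ ib ∈ Finset.HasAntidiagonal.antidiagonal n, ε (ib.1 * y - ib.2 * x)
        * ((qFact N s ib.1)⁻¹ * (qFact N s ib.2)⁻¹)
        * (qRising N s x ib.1 * qRising N s y ib.2)
      = (qFact N s n)⁻¹ * qRising N s (x + y) n := by
  induction n with
  | zero => simp [qRising]
  | succ n ih =>
    have ih := ih (by omega)
    have hn1 := qNum_succ_ne_zero hN hs hn
    refine mul_left_cancel₀ hn1 ?_
    rw [← mul_assoc, qNum_mul_inv_qFact hN hs hn, qRising_succ, ← mul_assoc, ← ih,
      Finset.mul_sum, Finset.sum_mul]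
    -- Write [n+1] as [i+b] by the addition formula. The part with [i] is reindexed by i + 1, the
    -- part with [b] by b + 1, and the two recombine through the addition formula for [x + y + n].
    have split : ∀ ib ∈ Finset.HasAntidiagonal.antidiagonal (n + 1), qn ((n : ℂ) + 1) *
          (ε (ib.1 * y - ib.2 * x) * ((qFact N s ib.1)⁻¹ * (qFact N s ib.2)⁻¹)
            * (qRising N s x ib.1 * qRising N s y ib.2))
        = (qn ib.1 * ε ib.2 * (ε (ib.1 * y - ib.2 * x)
            * ((qFact N s ib.1)⁻¹ * (qFact N s ib.2)⁻¹)
            * (qRising N s x ib.1 * qRising N s y ib.2)))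
          + (ε (-ib.1) * qn ib.2 * (ε (ib.1 * y - ib.2 * x)
            * ((qFact N s ib.1)⁻¹ * (qFact N s ib.2)⁻¹)
            * (qRising N s x ib.1 * qRising N s y ib.2))) := by
      rintro ⟨i, b⟩ hib
      have hib : i + b = n + 1 := Finset.HasAntidiagonal.mem_antidiagonal.mp hib
      have : (n : ℂ) + 1 = i + b := by exact_mod_cast hib.symm
      rw [this, qNum_add]
      ring
    rw [Finset.sum_congr rfl split, Finset.sum_add_distrib, Finset.Nat.sum_antidiagonal_succ,
      Finset.Nat.sum_antidiagonal_succ']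
    simp only [Nat.cast_zero, qNum_zero, zero_mul, mul_zero, zero_add]
    rw [← Finset.sum_add_distrib]
    refine Finset.sum_congr rfl ?_
    rintro ⟨i, b⟩ hib
    have hib : i + b = n := Finset.HasAntidiagonal.mem_antidiagonal.mp hib
    have hi := qNum_mul_inv_qFact hN hs (show i + 1 < N by omega)
    have hb := qNum_mul_inv_qFact hN hs (show b + 1 < N by omega)
    have hsum : qn (x + y + n) = qn (x + i) * ε (y + b) + ε (-(x + i)) * qn (y + b) := by
      rw [← qNum_add, ← hib]; congr 1; push_cast; ring
    have e1 : ε (((i + 1 : ℕ) : ℂ) * y - b * x) * ε b = ε (i * y - b * x) * ε (y + b) := by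
      rw [← eps_add, ← eps_add]; congr 1; push_cast; ring
    have e2 : ε ((i : ℂ) * y - (b + 1 : ℕ) * x) * ε (-i) = ε (i * y - b * x) * ε (-(x + i)) := by
      rw [← eps_add, ← eps_add]; congr 1; push_cast; ring
    simp only [qRising_succ, hsum]
    rw [Nat.cast_succ i, Nat.cast_succ b] at *
    linear_combination
      (qn ((i : ℂ) + 1) * (qFact N s (i + 1))⁻¹ * (qFact N s b)⁻¹ * (qRising N s x i
        * qn (x + i) * qRising N s y b)) * e1
      + (qn ((b : ℂ) + 1) * (qFact N s (b + 1))⁻¹ * (qFact N s i)⁻¹ * (qRising N s x i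
        * qn (y + b) * qRising N s y b)) * e2
      + (ε (i * y - b * x) * ε (y + b) * qn (x + i) * qRising N s x i * qRising N s y b
        * (qFact N s b)⁻¹) * hi
      + (ε (i * y - b * x) * ε (-(x + i)) * qn (y + b) * qRising N s x i * qRising N s y b
        * (qFact N s i)⁻¹) * hb

/-- Squaring removes all roots. Read backwards, the squared root products are rising products
starting at 2p₁ - n + 1 and 2p₂ - n + 1, so `qVandermonde` applies with these two arguments. -/
theorem sum_hwVal_sq (hN : 2 ≤ N) (hs : IsCoprime s (N : ℤ))
    (hφ : ∀ k : ℕ, φ k ^ 2 = qn ((k : ℂ) + 1)) (hθ₁ : ∀ k : ℕ, θ₁ k ^ 2 = qn (2 * p₁ - k))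
    (hθ₂ : ∀ k : ℕ, θ₂ k ^ 2 = qn (2 * p₂ - k)) {n : ℕ} (hn : n < N) :
    ∑ ib ∈ Finset.HasAntidiagonal.antidiagonal n, hwVal N s p₁ p₂ φ θ₁ θ₂ ib.2 ib.1 ^ 2
      = (qFact N s n)⁻¹ * qFalling N s (2 * p₁ + 2 * p₂ - n + 1) n := by
  have hr : ∀ (p : ℂ) (θ : ℕ → ℂ) (_ : ∀ k : ℕ, θ k ^ 2 = qn (2 * p - k)) (a b : ℕ), a + b = n →
      (∏ k ∈ Finset.range b, θ (a + k)) ^ 2 = qRising N s (2 * p - n + 1) b := by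
    intro p θ hθ a b hab
    rw [← Finset.prod_pow, qRising, ← Finset.prod_range_reflect]
    refine Finset.prod_congr rfl fun k hk => ?_
    have hk := Finset.mem_range.mp hk
    rw [hθ]
    have : ((a + (b - 1 - k) : ℕ) : ℂ) = n - 1 - k := by
      have : a + (b - 1 - k) + 1 + k = n := by omega
      rw [← this]; push_cast; ring
    rw [this]; congr 1; ring
  have hφ' : ∀ b : ℕ, (∏ k ∈ Finset.range b, φ k) ^ 2 = qFact N s b := by
    intro b
    rw [← Finset.prod_pow, qFact]
    exact Finset.prod_congr rfl fun k _ => hφ k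
  have hR : qRising N s ((2 * p₁ - n + 1) + (2 * p₂ - n + 1)) n
      = qFalling N s (2 * p₁ + 2 * p₂ - n + 1) n := by
    rw [qRising, qFalling, ← Finset.prod_range_reflect]
    refine Finset.prod_congr rfl fun k hk => ?_
    have hk := Finset.mem_range.mp hk
    have : ((n - 1 - k : ℕ) : ℂ) = n - 1 - k := by
      rw [Nat.cast_sub (by omega), Nat.cast_sub (by omega), Nat.cast_one]
    rw [this]; congr 1; ring
  rw [← hR, ← qVandermonde hN hs _ _ hn]
  refine Finset.sum_congr rfl ?_
  rintro ⟨i, b⟩ hib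
  have hib : i + b = n := Finset.HasAntidiagonal.mem_antidiagonal.mp hib
  have hi := qFact_ne_zero hN hs (show i < N by omega)
  have hb := qFact_ne_zero hN hs (show b < N by omega)
  simp only [hwVal, mul_pow, hφ', hr p₁ θ₁ hθ₁ b i (by omega), hr p₂ θ₂ hθ₂ i b hib]
  rw [← pow_mul, mul_comm b 2, pow_mul, neg_one_sq, one_pow, one_mul, ← eps_two_mul]
  have : 2 * (((b : ℂ) + i) * p₂ + (((b : ℂ) + i) - ((b : ℂ) + i) ^ 2) / 2
      - b * (p₁ + p₂ - (b + i) + 1)) = i * (2 * p₂ - n + 1) - b * (2 * p₁ - n + 1) := by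
    rw [← hib]; push_cast; ring
  rw [this]
  field_simp

end HighestWeight

/-! ### One-site operators -/

/-- `X⁺` with prescribed roots. -/
def raiseMat (θ φ : ℕ → ℂ) (d : ℕ) : Matrix (Fin d) (Fin d) ℂ :=
  Matrix.of fun a b => if (a : ℕ) + 1 = b then θ a * φ a else 0

/-- `ε ^ (H / 2)`. -/
def torusMat (N : ℕ) (s : ℤ) (p : ℂ) (d : ℕ) : Matrix (Fin d) (Fin d) ℂ :=
  Matrix.diagonal fun a => epsPow N s (p - (a : ℕ))

/-- `ε ^ (-H / 2)`. -/
def torusInv (N : ℕ) (s : ℤ) (p : ℂ) (d : ℕ) : Matrix (Fin d) (Fin d) ℂ :=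
  Matrix.diagonal fun a => epsPow N s (-(p - (a : ℕ)))

section OneSite

variable {N : ℕ} {s : ℤ} {p : ℂ} {φ θ : ℕ → ℂ} {d : ℕ}

local notation "ε" => epsPow N s
local notation "qn" => qNum N s

theorem torusMat_mul_torusInv : torusMat N s p d * torusInv N s p d = 1 := by
  simp [torusMat, torusInv, ← eps_add]

theorem torusInv_mul_torusMat : torusInv N s p d * torusMat N s p d = 1 := by
  simp [torusMat, torusInv, ← eps_add]

theorem torusMat_mul_raiseMat :
    torusMat N s p d * raiseMat θ φ d = ε 1 • (raiseMat θ φ d * torusMat N s p d) := by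
  ext a b
  simp only [torusMat, raiseMat, Matrix.diagonal_mul, Matrix.smul_apply, Matrix.mul_diagonal,
    Matrix.of_apply, smul_eq_mul]
  split_ifs with h
  · rw [show p - ((a : ℕ) : ℂ) = 1 + (p - ((b : ℕ) : ℂ)) by rw [← h]; push_cast; ring, eps_add]
    ring
  · simp

theorem torusInv_mul_raiseMat :
    torusInv N s p d * raiseMat θ φ d = ε (-1) • (raiseMat θ φ d * torusInv N s p d) := by
  ext a b
  simp only [torusInv, raiseMat, Matrix.diagonal_mul, Matrix.smul_apply, Matrix.mul_diagonal,
    Matrix.of_apply, smul_eq_mul]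
  split_ifs with h
  · rw [show -(p - ((a : ℕ) : ℂ)) = -1 + -(p - ((b : ℕ) : ℂ)) by rw [← h]; push_cast; ring,
      eps_add]
    ring
  · simp

theorem torusMat_transpose : (torusMat N s p d).transpose = torusMat N s p d :=
  Matrix.diagonal_transpose _

theorem torusInv_transpose : (torusInv N s p d).transpose = torusInv N s p d :=
  Matrix.diagonal_transpose _

theorem torusMat_mul_lowerMat : torusMat N s p d * (raiseMat θ φ d).transpose
    = ε (-1) • ((raiseMat θ φ d).transpose * torusMat N s p d) := by
  have h := congrArg Matrix.transpose (torusMat_mul_raiseMat (N := N) (s := s) (p := p) (θ := θ)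
    (φ := φ) (d := d))
  rw [Matrix.transpose_smul, Matrix.transpose_mul, Matrix.transpose_mul, torusMat_transpose] at h
  rw [h, smul_smul, ← eps_add, neg_add_cancel, eps_zero, one_smul]

theorem torusInv_mul_lowerMat : torusInv N s p d * (raiseMat θ φ d).transpose
    = ε 1 • ((raiseMat θ φ d).transpose * torusInv N s p d) := by
  have h := congrArg Matrix.transpose (torusInv_mul_raiseMat (N := N) (s := s) (p := p) (θ := θ)
    (φ := φ) (d := d))
  rw [Matrix.transpose_smul, Matrix.transpose_mul, Matrix.transpose_mul, torusInv_transpose] at h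
  rw [h, smul_smul, ← eps_add, add_neg_cancel, eps_zero, one_smul]

/-- Because [N] = 0, the module of dimension N closes for every p without a boundary correction. -/
theorem phi_pred_eq_zero (hN : 2 ≤ N) (hs : IsCoprime s (N : ℤ))
    (hφ : ∀ k : ℕ, φ k ^ 2 = qn ((k : ℂ) + 1)) {k : ℕ} (hk : k + 1 = N) : φ k = 0 := by
  have h : qn ((k : ℂ) + 1) = 0 := by
    rw [← qNum_natCast_self hN hs, ← hk]; push_cast; rfl
  exact pow_eq_zero_iff two_ne_zero |>.mp ((hφ k).trans h)

/-- At a = N - 1 the left side has no term and φ a = 0 on the right. Hence f may be arbitrary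
outside the range of the indices. -/
theorem sum_raiseMat (hN : 2 ≤ N) (hs : IsCoprime s (N : ℤ))
    (hφ : ∀ k : ℕ, φ k ^ 2 = qn ((k : ℂ) + 1)) (a : Fin N) (f : ℕ → ℂ) :
    ∑ b : Fin N, raiseMat θ φ N a b * f b = θ a * φ a * f (a + 1) := by
  simp only [raiseMat, Matrix.of_apply, ite_mul, zero_mul]
  by_cases h : (a : ℕ) + 1 < N
  · rw [Finset.sum_eq_single (⟨a + 1, h⟩ : Fin N)]
    · simp
    · intro b _ hb
      rw [if_neg fun h' => hb (Fin.ext h'.symm)]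
    · simp
  · rw [phi_pred_eq_zero hN hs hφ (show (a : ℕ) + 1 = N by omega)]
    simp

theorem sum_lowerMat (a : Fin N) (f : ℕ → ℂ) :
    ∑ b : Fin N, (raiseMat θ φ N).transpose a b * f b
      = if (a : ℕ) = 0 then 0 else θ (a - 1) * φ (a - 1) * f (a - 1) := by
  simp only [raiseMat, Matrix.of_apply, Matrix.transpose_apply, ite_mul, zero_mul]
  split_ifs with h
  · refine Finset.sum_eq_zero fun b _ => if_neg (by omega)
  · rw [Finset.sum_eq_single (⟨a - 1, by omega⟩ : Fin N)]
    · rw [if_pos]; simp only; omega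
    · intro b _ hb
      rw [if_neg fun h' => hb (Fin.ext (by simp only; omega))]
    · simp

theorem raiseMat_mul_lowerMat (hN : 2 ≤ N) (hs : IsCoprime s (N : ℤ))
    (hφ : ∀ k : ℕ, φ k ^ 2 = qn ((k : ℂ) + 1)) (hθ : ∀ k : ℕ, θ k ^ 2 = qn (2 * p - k)) :
    raiseMat θ φ N * (raiseMat θ φ N).transpose
      = Matrix.diagonal fun a : Fin N => qn (2 * p - (a : ℕ)) * qn (((a : ℕ) : ℂ) + 1) := by
  ext a b
  have h := sum_raiseMat (θ := θ) hN hs hφ a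
    (fun k => if (b : ℕ) + 1 = k then θ b * φ b else 0)
  rw [Matrix.mul_apply]
  simp only [Matrix.transpose_apply]
  refine Eq.trans (Finset.sum_congr rfl fun c _ => ?_) (h.trans ?_)
  · rfl
  · rw [Matrix.diagonal_apply]
    by_cases hab : a = b
    · subst hab
      rw [if_pos rfl, if_pos rfl, ← hφ, ← hθ]; ring
    · rw [if_neg hab, if_neg fun h' => hab (Fin.ext (by omega)), mul_zero]

theorem lowerMat_mul_raiseMat (hφ : ∀ k : ℕ, φ k ^ 2 = qn ((k : ℂ) + 1))
    (hθ : ∀ k : ℕ, θ k ^ 2 = qn (2 * p - k)) :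
    (raiseMat θ φ N).transpose * raiseMat θ φ N
      = Matrix.diagonal fun a : Fin N => qn (2 * p - (a : ℕ) + 1) * qn ((a : ℕ) : ℂ) := by
  ext a b
  have h := sum_lowerMat (θ := θ) (φ := φ) a (fun k => if k + 1 = (b : ℕ) then θ k * φ k else 0)
  rw [Matrix.mul_apply]
  refine Eq.trans (Finset.sum_congr rfl fun c _ => ?_) (h.trans ?_)
  · rfl
  · rw [Matrix.diagonal_apply]
    split_ifs with h1 _ h3 h3 h2
    · simp [h1]
    · rfl
    · obtain ⟨c, hc⟩ := Nat.exists_eq_succ_of_ne_zero h1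
      have e1 := hθ c
      have e2 := hφ c
      rw [hc, Nat.succ_sub_one, show 2 * p - ((c.succ : ℕ) : ℂ) + 1 = 2 * p - c by
        push_cast; ring, ← e1, Nat.cast_succ, ← e2]
      ring
    · exact absurd (Fin.ext (by omega)) h3
    · subst h2; omega
    · simp

end OneSite

/-! ### Two-site operators -/

/-- Exchange of the two tensor factors. -/
def swapMat {m n : Type*} {R : Type*} (M : Matrix (m × m) (n × n) R) : Matrix (m × m) (n × n) R :=
  M.submatrix Prod.swap Prod.swap

theorem swapMat_kronecker {m : Type*} {R : Type*} [CommRing R] (A B : Matrix m m R) :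
    swapMat (A ⊗ₖ B) = B ⊗ₖ A := by
  ext a b
  simp [swapMat, Matrix.kroneckerMap_apply, mul_comm]

theorem swapMat_mul {m : Type*} [Fintype m] {R : Type*} [CommRing R]
    (A B : Matrix (m × m) (m × m) R) : swapMat (A * B) = swapMat A * swapMat B :=
  (Matrix.submatrix_mul_equiv A B Prod.swap (Equiv.prodComm m m) Prod.swap).symm

/-- The action of `X⁺` by the comultiplication. -/
def raiseOp (N : ℕ) (s : ℤ) (p₁ p₂ : ℂ) (φ θ₁ θ₂ : ℕ → ℂ) :
    Matrix (Fin N × Fin N) (Fin N × Fin N) ℂ :=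
  raiseMat θ₁ φ N ⊗ₖ torusMat N s p₂ N + torusInv N s p₁ N ⊗ₖ raiseMat θ₂ φ N

/-- The action of `X⁻` by the comultiplication. -/
def lowerOp (N : ℕ) (s : ℤ) (p₁ p₂ : ℂ) (φ θ₁ θ₂ : ℕ → ℂ) :
    Matrix (Fin N × Fin N) (Fin N × Fin N) ℂ :=
  (raiseMat θ₁ φ N).transpose ⊗ₖ torusMat N s p₂ N
    + torusInv N s p₁ N ⊗ₖ (raiseMat θ₂ φ N).transpose

/-- The first part of the action of the affine generator `X₀⁺`. -/
def affLeft (N : ℕ) (s : ℤ) (p₂ : ℂ) (φ θ₁ : ℕ → ℂ) : Matrix (Fin N × Fin N) (Fin N × Fin N) ℂ :=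
  (raiseMat θ₁ φ N).transpose ⊗ₖ torusInv N s p₂ N

/-- The second part of the action of the affine generator `X₀⁺`. -/
def affRight (N : ℕ) (s : ℤ) (p₁ : ℂ) (φ θ₂ : ℕ → ℂ) : Matrix (Fin N × Fin N) (Fin N × Fin N) ℂ :=
  torusMat N s p₁ N ⊗ₖ (raiseMat θ₂ φ N).transpose

section TwoSite

variable {N : ℕ} {s : ℤ} {p₁ p₂ : ℂ} {φ θ₁ θ₂ : ℕ → ℂ}

local notation "ε" => epsPow N s
local notation "qn" => qNum N s

theorem raiseOp_transpose :
    (raiseOp N s p₁ p₂ φ θ₁ θ₂).transpose = lowerOp N s p₁ p₂ φ θ₁ θ₂ := by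
  rw [raiseOp, lowerOp, Matrix.transpose_add, ← Matrix.kroneckerMap_transpose,
    ← Matrix.kroneckerMap_transpose, torusMat_transpose, torusInv_transpose]

theorem lowerOp_transpose :
    (lowerOp N s p₁ p₂ φ θ₁ θ₂).transpose = raiseOp N s p₁ p₂ φ θ₁ θ₂ := by
  rw [← raiseOp_transpose, Matrix.transpose_transpose]

theorem diagonal_kronecker_one {m : Type*} [DecidableEq m] (f : m → ℂ) :
    Matrix.diagonal f ⊗ₖ (1 : Matrix m m ℂ) = Matrix.diagonal fun a : m × m => f a.1 := by
  rw [← Matrix.diagonal_one, Matrix.diagonal_kronecker_diagonal]; simp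

theorem one_kronecker_diagonal {m : Type*} [DecidableEq m] (f : m → ℂ) :
    (1 : Matrix m m ℂ) ⊗ₖ Matrix.diagonal f = Matrix.diagonal fun a : m × m => f a.2 := by
  rw [← Matrix.diagonal_one, Matrix.diagonal_kronecker_diagonal]; simp

/-- The two halves of X₀⁺ commute with X₁⁻ separately, which keeps the spectral parameter outside
the computation. In the mixed terms both orders of multiplication produce the same power of ε. -/
theorem lowerOp_mul_affLeft :
    lowerOp N s p₁ p₂ φ θ₁ θ₂ * affLeft N s p₂ φ θ₁
      = affLeft N s p₂ φ θ₁ * lowerOp N s p₁ p₂ φ θ₁ θ₂ := by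
  simp only [lowerOp, affLeft, add_mul, mul_add, ← Matrix.mul_kronecker_mul,
    torusMat_mul_torusInv, torusInv_mul_torusMat, torusInv_mul_lowerMat, Matrix.smul_kronecker,
    Matrix.kronecker_smul]

theorem lowerOp_mul_affRight :
    lowerOp N s p₁ p₂ φ θ₁ θ₂ * affRight N s p₁ φ θ₂
      = affRight N s p₁ φ θ₂ * lowerOp N s p₁ p₂ φ θ₁ θ₂ := by
  simp only [lowerOp, affRight, add_mul, mul_add, ← Matrix.mul_kronecker_mul,
    torusMat_mul_torusInv, torusInv_mul_torusMat, torusMat_mul_lowerMat, Matrix.smul_kronecker,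
    Matrix.kronecker_smul]

/-- The value of `X⁺ X⁻ - c X⁻ X⁺` on a basis vector. -/
def crossVal (N : ℕ) (s : ℤ) (p c : ℂ) (a : ℕ) : ℂ :=
  qNum N s (2 * p - a) * qNum N s ((a : ℂ) + 1) - c * (qNum N s (2 * p - a + 1) * qNum N s a)

/-- The twist ε² is the one that cancels the mixed terms. Only X⁺X⁻ and X⁻X⁺ on the first site
remain, and these are diagonal. -/
theorem raiseOp_mul_affLeft (hN : 2 ≤ N) (hs : IsCoprime s (N : ℤ))
    (hφ : ∀ k : ℕ, φ k ^ 2 = qn ((k : ℂ) + 1)) (hθ₁ : ∀ k : ℕ, θ₁ k ^ 2 = qn (2 * p₁ - k)) :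
    raiseOp N s p₁ p₂ φ θ₁ θ₂ * affLeft N s p₂ φ θ₁
      = ε 2 • (affLeft N s p₂ φ θ₁ * raiseOp N s p₁ p₂ φ θ₁ θ₂)
        + Matrix.diagonal fun a : Fin N × Fin N => crossVal N s p₁ (ε 2) a.1 := by
  have h2 : ε 2 = ε 1 * ε 1 := by rw [← eps_add]; norm_num
  have h3 : ε 2 * ε (-1) = ε 1 := by rw [← eps_add]; norm_num
  have hd : (Matrix.diagonal fun a : Fin N × Fin N => crossVal N s p₁ (ε 2) a.1)
      = (raiseMat θ₁ φ N * (raiseMat θ₁ φ N).transpose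
        - ε 2 • ((raiseMat θ₁ φ N).transpose * raiseMat θ₁ φ N)) ⊗ₖ 1 := by
    rw [raiseMat_mul_lowerMat hN hs hφ hθ₁, lowerMat_mul_raiseMat hφ hθ₁, ← Matrix.diagonal_smul,
      Matrix.diagonal_sub, diagonal_kronecker_one]
    rfl
  rw [hd]
  simp only [raiseOp, affLeft, add_mul, mul_add, ← Matrix.mul_kronecker_mul,
    torusMat_mul_torusInv, torusInv_mul_torusMat, torusInv_mul_lowerMat, torusInv_mul_raiseMat,
    Matrix.smul_kronecker, Matrix.kronecker_smul, smul_add, smul_smul, h3, sub_eq_add_neg,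
    Matrix.add_kronecker]
  rw [← neg_one_smul ℂ (ε 2 • _), Matrix.smul_kronecker, Matrix.smul_kronecker]
  module

theorem raiseOp_mul_affRight (hN : 2 ≤ N) (hs : IsCoprime s (N : ℤ))
    (hφ : ∀ k : ℕ, φ k ^ 2 = qn ((k : ℂ) + 1)) (hθ₂ : ∀ k : ℕ, θ₂ k ^ 2 = qn (2 * p₂ - k)) :
    raiseOp N s p₁ p₂ φ θ₁ θ₂ * affRight N s p₁ φ θ₂
      = ε (-2) • (affRight N s p₁ φ θ₂ * raiseOp N s p₁ p₂ φ θ₁ θ₂)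
        + Matrix.diagonal fun a : Fin N × Fin N => crossVal N s p₂ (ε (-2)) a.2 := by
  have h3 : ε (-2) * ε 1 = ε (-1) := by rw [← eps_add]; norm_num
  have hd : (Matrix.diagonal fun a : Fin N × Fin N => crossVal N s p₂ (ε (-2)) a.2)
      = 1 ⊗ₖ (raiseMat θ₂ φ N * (raiseMat θ₂ φ N).transpose
        - ε (-2) • ((raiseMat θ₂ φ N).transpose * raiseMat θ₂ φ N)) := by
    rw [raiseMat_mul_lowerMat hN hs hφ hθ₂, lowerMat_mul_raiseMat hφ hθ₂, ← Matrix.diagonal_smul,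
      Matrix.diagonal_sub, one_kronecker_diagonal]
    rfl
  rw [hd]
  simp only [raiseOp, affRight, add_mul, mul_add, ← Matrix.mul_kronecker_mul,
    torusMat_mul_torusInv, torusInv_mul_torusMat, torusMat_mul_lowerMat, torusMat_mul_raiseMat,
    Matrix.smul_kronecker, Matrix.kronecker_smul, smul_add, smul_smul, h3, sub_eq_add_neg,
    Matrix.kronecker_add]
  rw [← neg_one_smul ℂ (ε (-2) • _), Matrix.kronecker_smul, Matrix.kronecker_smul]
  module

theorem qNum_mul_succ (hN : 2 ≤ N) (hs : IsCoprime s (N : ℤ)) (x a : ℂ) :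
    qn (x - a) * qn (a + 1) = qn (x - a + 1) * qn a + qn (x - 2 * a) := by
  have h := qNum_add (N := N) (s := s) (x - a) (-a)
  have h1 := qNum_add (N := N) (s := s) (x - a) 1
  have h2 := qNum_add' (N := N) (s := s) a 1
  rw [qNum_one hN hs] at h1 h2
  rw [h1, h2, show x - 2 * a = x - a + -a by ring, h, qNum_neg]
  linear_combination -qn (x - a) * qNum_mul_den hN hs a

theorem raiseOp_mul_lowerOp (hN : 2 ≤ N) (hs : IsCoprime s (N : ℤ))
    (hφ : ∀ k : ℕ, φ k ^ 2 = qn ((k : ℂ) + 1)) (hθ₁ : ∀ k : ℕ, θ₁ k ^ 2 = qn (2 * p₁ - k))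
    (hθ₂ : ∀ k : ℕ, θ₂ k ^ 2 = qn (2 * p₂ - k)) :
    raiseOp N s p₁ p₂ φ θ₁ θ₂ * lowerOp N s p₁ p₂ φ θ₁ θ₂
      = lowerOp N s p₁ p₂ φ θ₁ θ₂ * raiseOp N s p₁ p₂ φ θ₁ θ₂
        + Matrix.diagonal fun a : Fin N × Fin N =>
          qn (2 * p₁ + 2 * p₂ - 2 * ((a.1 : ℕ) + (a.2 : ℕ))) := by
  have e1 : raiseMat θ₁ φ N * (raiseMat θ₁ φ N).transpose
      = (raiseMat θ₁ φ N).transpose * raiseMat θ₁ φ N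
        + Matrix.diagonal fun a : Fin N => qn (2 * p₁ - 2 * (a : ℕ)) := by
    rw [raiseMat_mul_lowerMat hN hs hφ hθ₁, lowerMat_mul_raiseMat hφ hθ₁, Matrix.diagonal_add]
    congr 1; ext a; exact qNum_mul_succ hN hs _ _
  have e2 : raiseMat θ₂ φ N * (raiseMat θ₂ φ N).transpose
      = (raiseMat θ₂ φ N).transpose * raiseMat θ₂ φ N
        + Matrix.diagonal fun a : Fin N => qn (2 * p₂ - 2 * (a : ℕ)) := by
    rw [raiseMat_mul_lowerMat hN hs hφ hθ₂, lowerMat_mul_raiseMat hφ hθ₂, Matrix.diagonal_add]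
    congr 1; ext a; exact qNum_mul_succ hN hs _ _
  have e3 : (Matrix.diagonal fun a : Fin N × Fin N =>
      qn (2 * p₁ + 2 * p₂ - 2 * ((a.1 : ℕ) + (a.2 : ℕ))))
      = (Matrix.diagonal fun a : Fin N => qn (2 * p₁ - 2 * (a : ℕ)))
          ⊗ₖ (torusMat N s p₂ N * torusMat N s p₂ N)
        + (torusInv N s p₁ N * torusInv N s p₁ N)
          ⊗ₖ (Matrix.diagonal fun a : Fin N => qn (2 * p₂ - 2 * (a : ℕ))) := by
    simp only [torusMat, torusInv, Matrix.diagonal_mul_diagonal,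
      Matrix.diagonal_kronecker_diagonal, Matrix.diagonal_add, ← eps_add]
    congr 1; ext a
    rw [show 2 * p₁ + 2 * p₂ - 2 * (((a.1 : ℕ) : ℂ) + (a.2 : ℕ))
      = (2 * p₁ - 2 * (a.1 : ℕ)) + (2 * p₂ - 2 * (a.2 : ℕ)) by ring, qNum_add]
    congr 3 <;> ring
  rw [e3]
  simp only [raiseOp, lowerOp, add_mul, mul_add, ← Matrix.mul_kronecker_mul, e1, e2,
    torusInv_mul_lowerMat, torusInv_mul_raiseMat, torusMat_mul_lowerMat, torusMat_mul_raiseMat,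
    Matrix.smul_kronecker, Matrix.kronecker_smul, Matrix.add_kronecker, Matrix.kronecker_add]
  abel

end TwoSite

/-! ### The Clebsch-Gordan basis -/

/-- The vector of weight `n + z` in the component labelled by `n`. -/
def cgVec (N : ℕ) (s : ℤ) (p₁ p₂ : ℂ) (φ θ₁ θ₂ : ℕ → ℂ) (n z : ℕ) : Fin N × Fin N → ℂ :=
  fun b => if (b.1 : ℕ) + b.2 = n + z then cgVal N s p₁ p₂ φ θ₁ θ₂ n b.1 b.2 else 0

/-- The inverse of the square norm of `cgVec`. -/
def cgNorm (N : ℕ) (s : ℤ) (P : ℂ) (n z : ℕ) : ℂ :=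
  qNum N s (2 * P - 2 * n + 1) * qFact N s n * qFact N s z
    / qFalling N s (2 * P - n + 1) (n + z + 1)

section Basis

variable {N : ℕ} {s : ℤ} {p₁ p₂ : ℂ} {φ θ₁ θ₂ : ℕ → ℂ}

local notation "ε" => epsPow N s
local notation "qn" => qNum N s

theorem kronecker_diagonal_mulVec {m : Type*} [Fintype m] [DecidableEq m] (A : Matrix m m ℂ)
    (t : m → ℂ) (v : m × m → ℂ) (a : m × m) :
    (A ⊗ₖ Matrix.diagonal t).mulVec v a = t a.2 * ∑ b, A a.1 b * v (b, a.2) := by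
  simp only [Matrix.mulVec, dotProduct, Fintype.sum_prod_type, Matrix.kroneckerMap_apply,
    Matrix.diagonal_apply, mul_ite, mul_zero, ite_mul, zero_mul, Finset.sum_ite_eq,
    Finset.mem_univ, if_true, Finset.mul_sum]
  exact Finset.sum_congr rfl fun b _ => by ring

theorem diagonal_kronecker_mulVec {m : Type*} [Fintype m] [DecidableEq m] (A : Matrix m m ℂ)
    (t : m → ℂ) (v : m × m → ℂ) (a : m × m) :
    (Matrix.diagonal t ⊗ₖ A).mulVec v a = t a.1 * ∑ b, A a.2 b * v (a.1, b) := by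
  simp only [Matrix.mulVec, dotProduct, Fintype.sum_prod_type_right, Matrix.kroneckerMap_apply,
    Matrix.diagonal_apply, ite_mul, zero_mul, Finset.sum_ite_eq,
    Finset.mem_univ, if_true, Finset.mul_sum]
  exact Finset.sum_congr rfl fun b _ => by ring

theorem raiseOp_mulVec (hN : 2 ≤ N) (hs : IsCoprime s (N : ℤ))
    (hφ : ∀ k : ℕ, φ k ^ 2 = qn ((k : ℂ) + 1)) (V : ℕ → ℕ → ℂ) (a : Fin N × Fin N) :
    (raiseOp N s p₁ p₂ φ θ₁ θ₂).mulVec (fun b => V b.1 b.2) a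
      = ε (p₂ - (a.2 : ℕ)) * (θ₁ a.1 * φ a.1 * V (a.1 + 1) a.2)
        + ε (-(p₁ - (a.1 : ℕ))) * (θ₂ a.2 * φ a.2 * V a.1 (a.2 + 1)) := by
  rw [raiseOp, Matrix.add_mulVec, Pi.add_apply, torusMat, torusInv, kronecker_diagonal_mulVec,
    diagonal_kronecker_mulVec, sum_raiseMat hN hs hφ a.1 (fun k => V k a.2),
    sum_raiseMat hN hs hφ a.2 (fun k => V a.1 k)]

theorem lowerOp_mulVec (V : ℕ → ℕ → ℂ) (a : Fin N × Fin N) :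
    (lowerOp N s p₁ p₂ φ θ₁ θ₂).mulVec (fun b => V b.1 b.2) a
      = ε (p₂ - (a.2 : ℕ)) * (if (a.1 : ℕ) = 0 then 0
          else θ₁ (a.1 - 1) * φ (a.1 - 1) * V (a.1 - 1) a.2)
        + ε (-(p₁ - (a.1 : ℕ))) * (if (a.2 : ℕ) = 0 then 0
          else θ₂ (a.2 - 1) * φ (a.2 - 1) * V a.1 (a.2 - 1)) := by
  rw [lowerOp, Matrix.add_mulVec, Pi.add_apply, torusMat, torusInv, kronecker_diagonal_mulVec,
    diagonal_kronecker_mulVec, sum_lowerMat a.1 (fun k => V k a.2),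
    sum_lowerMat a.2 (fun k => V a.1 k)]

/-- In this normalisation X⁻ acts without square roots. The omitted prefactors of the Clebsch-Gordan
coefficients reappear in `cgNorm`. -/
theorem lowerOp_mulVec_cgVec (hN : 2 ≤ N) (hs : IsCoprime s (N : ℤ))
    (hθ₁ : ∀ k : ℕ, θ₁ k ^ 2 = qn (2 * p₁ - k)) (hθ₂ : ∀ k : ℕ, θ₂ k ^ 2 = qn (2 * p₂ - k))
    {n : ℕ} (hn : n < N) (z : ℕ) :
    (lowerOp N s p₁ p₂ φ θ₁ θ₂).mulVec (cgVec N s p₁ p₂ φ θ₁ θ₂ n z)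
      = qn ((z : ℂ) + 1) • cgVec N s p₁ p₂ φ θ₁ θ₂ n (z + 1) := by
  ext ⟨a, b⟩
  have h := lowerOp_mulVec (N := N) (s := s) (p₁ := p₁) (p₂ := p₂) (φ := φ) (θ₁ := θ₁) (θ₂ := θ₂)
    (fun b₁ b₂ => if b₁ + b₂ = n + z then cgVal N s p₁ p₂ φ θ₁ θ₂ n b₁ b₂ else 0) (a, b)
  refine h.trans ?_
  simp only [cgVec, Pi.smul_apply, smul_eq_mul]
  by_cases hw : (a : ℕ) + b = n + (z + 1)
  · have key := cg_lower_aux hN hs hθ₁ hθ₂ hn a.2 b.2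
    have hz : (z : ℂ) + 1 = (a : ℕ) + (b : ℕ) - n := by
      rw [eq_sub_iff_add_eq]; norm_cast; omega
    have hφ1 : ∀ c : ℕ, c ≠ 0 → φ (c - 1) * ∏ k ∈ Finset.range (c - 1), φ k
        = ∏ k ∈ Finset.range c, φ k := by
      intro c hc
      obtain ⟨c, rfl⟩ := Nat.exists_eq_succ_of_ne_zero hc
      rw [Nat.succ_sub_one, Finset.prod_range_succ, mul_comm]
    rw [if_pos hw, hz]
    set Φ := (∏ k ∈ Finset.range (a : ℕ), φ k) * ∏ k ∈ Finset.range (b : ℕ), φ k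
    set C := epsPow N s (((n : ℂ) - (n : ℂ) ^ 2) / 2 + ((n : ℂ) - (b : ℕ)) * p₁
      + ((n : ℂ) + (a : ℕ)) * p₂) with hC
    rw [show cgVal N s p₁ p₂ φ θ₁ θ₂ n a b = Φ * C * cgSum N s p₁ p₂ θ₁ θ₂ n a b from rfl,
      mul_left_comm, ← key, mul_add]
    congr 1
    · by_cases ha : (a : ℕ) = 0
      · simp [ha]
      · rw [if_neg ha, if_neg ha, if_pos (by omega), cgVal]
        have hexp : ε (p₂ - (b : ℕ)) * ε (((n : ℂ) - (n : ℂ) ^ 2) / 2 + ((n : ℂ) - (b : ℕ)) * p₁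
            + ((n : ℂ) + ((a - 1 : ℕ) : ℂ)) * p₂) = C * ε (-(b : ℕ)) := by
          rw [hC, ← eps_add, ← eps_add, Nat.cast_sub (by omega)]; congr 1; push_cast; ring
        rw [show Φ = (φ (a - 1) * ∏ k ∈ Finset.range (a - 1 : ℕ), φ k)
          * ∏ k ∈ Finset.range (b : ℕ), φ k by rw [hφ1 _ ha]]
        linear_combination (θ₁ (a - 1) * φ (a - 1) * ((∏ k ∈ Finset.range (a - 1 : ℕ), φ k)
          * ∏ k ∈ Finset.range (b : ℕ), φ k) * cgSum N s p₁ p₂ θ₁ θ₂ n (a - 1) b) * hexp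
    · by_cases hb : (b : ℕ) = 0
      · simp [hb]
      · rw [if_neg hb, if_neg hb, if_pos (by omega), cgVal]
        have hexp : ε (-(p₁ - (a : ℕ))) * ε (((n : ℂ) - (n : ℂ) ^ 2) / 2
            + ((n : ℂ) - ((b - 1 : ℕ) : ℂ)) * p₁ + ((n : ℂ) + (a : ℕ)) * p₂) = C * ε (a : ℕ) := by
          rw [hC, ← eps_add, ← eps_add, Nat.cast_sub (by omega)]; congr 1; push_cast; ring
        rw [show Φ = (∏ k ∈ Finset.range (a : ℕ), φ k)
          * (φ (b - 1) * ∏ k ∈ Finset.range (b - 1 : ℕ), φ k) by rw [hφ1 _ hb]]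
        linear_combination (θ₂ (b - 1) * φ (b - 1) * ((∏ k ∈ Finset.range (a : ℕ), φ k)
          * ∏ k ∈ Finset.range (b - 1 : ℕ), φ k) * cgSum N s p₁ p₂ θ₁ θ₂ n a (b - 1)) * hexp
  · rw [if_neg hw]
    have e1 : (a : ℕ) ≠ 0 → ¬ ((a : ℕ) - 1 + b = n + z) := by omega
    have e2 : (b : ℕ) ≠ 0 → ¬ ((a : ℕ) + (b - 1) = n + z) := by omega
    by_cases ha : (a : ℕ) = 0 <;> by_cases hb : (b : ℕ) = 0 <;> simp [ha, hb, e1, e2]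
    all_goals simp_all

/-- The function on `ℕ × ℕ` extending the highest weight vector. -/
theorem cgVec_zero (n : ℕ) : cgVec N s p₁ p₂ φ θ₁ θ₂ n 0 = fun b => if (b.1 : ℕ) + b.2 = n
    then hwVal N s p₁ p₂ φ θ₁ θ₂ b.1 b.2 else 0 := by
  ext b
  simp only [cgVec, Nat.add_zero]
  split_ifs with h
  · rw [← cgVal_add, h]
  · rfl

theorem mul_hwVal_left (hN : 2 ≤ N) (hs : IsCoprime s (N : ℤ))
    (hφ : ∀ k : ℕ, φ k ^ 2 = qn ((k : ℂ) + 1)) {n : ℕ} (hn : n + 1 < N) (b₁ b₂ : ℕ) :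
    θ₁ b₁ * φ b₁ * (if b₁ + 1 + b₂ = n + 1 then hwVal N s p₁ p₂ φ θ₁ θ₂ (b₁ + 1) b₂ else 0)
      = -ε (b₁ - p₁) * (θ₁ n * θ₂ n)
        * (if b₁ + b₂ = n then hwVal N s p₁ p₂ φ θ₁ θ₂ b₁ b₂ else 0) := by
  by_cases h : b₁ + b₂ = n
  · rw [if_pos h, if_pos (by omega), hwVal_succ_left hN hs hφ (by omega), h]
  · rw [if_neg h, if_neg (by omega), mul_zero, mul_zero]

theorem mul_hwVal_right (hN : 2 ≤ N) (hs : IsCoprime s (N : ℤ))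
    (hφ : ∀ k : ℕ, φ k ^ 2 = qn ((k : ℂ) + 1)) {n : ℕ} (hn : n + 1 < N) (b₁ b₂ : ℕ) :
    θ₂ b₂ * φ b₂ * (if b₁ + (b₂ + 1) = n + 1 then hwVal N s p₁ p₂ φ θ₁ θ₂ b₁ (b₂ + 1) else 0)
      = ε (p₂ - b₂) * (θ₁ n * θ₂ n)
        * (if b₁ + b₂ = n then hwVal N s p₁ p₂ φ θ₁ θ₂ b₁ b₂ else 0) := by
  by_cases h : b₁ + b₂ = n
  · rw [if_pos h, if_pos (by omega), hwVal_succ_right hN hs hφ (by omega), h]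
  · rw [if_neg h, if_neg (by omega), mul_zero, mul_zero]

/-- The two summands of the coproduct of X⁺ give opposite multiples of the closed form at the
preceding level. -/
theorem raiseOp_mulVec_cgVec_zero (hN : 2 ≤ N) (hs : IsCoprime s (N : ℤ))
    (hφ : ∀ k : ℕ, φ k ^ 2 = qn ((k : ℂ) + 1)) {n : ℕ} (hn : n < N) :
    (raiseOp N s p₁ p₂ φ θ₁ θ₂).mulVec (cgVec N s p₁ p₂ φ θ₁ θ₂ n 0) = 0 := by
  ext a
  rw [cgVec_zero]
  refine (raiseOp_mulVec hN hs hφ (fun b₁ b₂ => if b₁ + b₂ = n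
    then hwVal N s p₁ p₂ φ θ₁ θ₂ b₁ b₂ else 0) a).trans ?_
  rcases n with _ | n
  · rw [if_neg (by omega), if_neg (by omega)]; simp
  · rw [mul_hwVal_left hN hs hφ hn, mul_hwVal_right hN hs hφ hn]
    have h : ε (p₂ - (a.2 : ℕ)) * ε ((a.1 : ℕ) - p₁)
        = ε (-(p₁ - (a.1 : ℕ))) * ε (p₂ - (a.2 : ℕ)) := by
      rw [← eps_add, ← eps_add]; congr 1; ring
    simp only [Pi.zero_apply]
    linear_combination (-(θ₁ n * θ₂ n)
        * (if (a.1 : ℕ) + a.2 = n then hwVal N s p₁ p₂ φ θ₁ θ₂ a.1 a.2 else 0)) * h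

/-- The transposed halves of X₀⁺ raise a single site and so move a highest weight vector down one
component label. The coefficients -ε^(n-P) and ε^(P-n) of the two halves are the ones that enter the
recursion for G. -/
theorem affLeft_transpose_mulVec_cgVec (hN : 2 ≤ N) (hs : IsCoprime s (N : ℤ))
    (hφ : ∀ k : ℕ, φ k ^ 2 = qn ((k : ℂ) + 1)) {n : ℕ} (hn : n + 1 < N) :
    (affLeft N s p₂ φ θ₁).transpose.mulVec (cgVec N s p₁ p₂ φ θ₁ θ₂ (n + 1) 0)
      = (-ε (n - (p₁ + p₂)) * (θ₁ n * θ₂ n)) • cgVec N s p₁ p₂ φ θ₁ θ₂ n 0 := by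
  ext a
  rw [cgVec_zero, cgVec_zero, affLeft, ← Matrix.kroneckerMap_transpose, Matrix.transpose_transpose,
    torusInv_transpose, torusInv, kronecker_diagonal_mulVec]
  rw [sum_raiseMat hN hs hφ a.1 (fun b₁ => if b₁ + (a.2 : ℕ) = n + 1
    then hwVal N s p₁ p₂ φ θ₁ θ₂ b₁ a.2 else 0), mul_hwVal_left hN hs hφ hn, Pi.smul_apply,
    smul_eq_mul]
  split_ifs with h
  · rw [show (n : ℂ) - (p₁ + p₂) = -(p₂ - (a.2 : ℕ)) + ((a.1 : ℕ) - p₁) by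
      rw [← h]; push_cast; ring, eps_add]
    ring
  · simp

theorem affRight_transpose_mulVec_cgVec (hN : 2 ≤ N) (hs : IsCoprime s (N : ℤ))
    (hφ : ∀ k : ℕ, φ k ^ 2 = qn ((k : ℂ) + 1)) {n : ℕ} (hn : n + 1 < N) :
    (affRight N s p₁ φ θ₂).transpose.mulVec (cgVec N s p₁ p₂ φ θ₁ θ₂ (n + 1) 0)
      = (ε (p₁ + p₂ - n) * (θ₁ n * θ₂ n)) • cgVec N s p₁ p₂ φ θ₁ θ₂ n 0 := by
  ext a
  rw [cgVec_zero, cgVec_zero, affRight, ← Matrix.kroneckerMap_transpose, Matrix.transpose_transpose,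
    torusMat_transpose, torusMat, diagonal_kronecker_mulVec]
  rw [sum_raiseMat hN hs hφ a.2 (fun b₂ => if (a.1 : ℕ) + b₂ = n + 1
    then hwVal N s p₁ p₂ φ θ₁ θ₂ a.1 b₂ else 0), mul_hwVal_right hN hs hφ hn, Pi.smul_apply,
    smul_eq_mul]
  split_ifs with h
  · rw [show p₁ + p₂ - (n : ℂ) = (p₁ - (a.1 : ℕ)) + (p₂ - (a.2 : ℕ)) by
      rw [← h]; push_cast; ring, eps_add]
    ring
  · simp

theorem aff_transpose_mulVec_cgVec_zero (hN : 2 ≤ N) (hs : IsCoprime s (N : ℤ))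
    (hφ : ∀ k : ℕ, φ k ^ 2 = qn ((k : ℂ) + 1)) :
    (affLeft N s p₂ φ θ₁).transpose.mulVec (cgVec N s p₁ p₂ φ θ₁ θ₂ 0 0) = 0 ∧
      (affRight N s p₁ φ θ₂).transpose.mulVec (cgVec N s p₁ p₂ φ θ₁ θ₂ 0 0) = 0 := by
  constructor <;> ext a
  · rw [cgVec_zero, affLeft, ← Matrix.kroneckerMap_transpose, Matrix.transpose_transpose,
      torusInv_transpose, torusInv, kronecker_diagonal_mulVec,
      sum_raiseMat hN hs hφ a.1 (fun b₁ => if b₁ + (a.2 : ℕ) = 0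
        then hwVal N s p₁ p₂ φ θ₁ θ₂ b₁ a.2 else 0), if_neg (by omega)]
    simp
  · rw [cgVec_zero, affRight, ← Matrix.kroneckerMap_transpose, Matrix.transpose_transpose,
      torusMat_transpose, torusMat, diagonal_kronecker_mulVec,
      sum_raiseMat hN hs hφ a.2 (fun b₂ => if (a.1 : ℕ) + b₂ = 0
        then hwVal N s p₁ p₂ φ θ₁ θ₂ a.1 b₂ else 0), if_neg (by omega)]
    simp

/-- `θ₁ n θ₂ n` times the image of a highest weight vector under `X⁻`. -/
theorem lowerOp_mulVec_hwVal (hN : 2 ≤ N) (hs : IsCoprime s (N : ℤ))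
    (hφ : ∀ k : ℕ, φ k ^ 2 = qn ((k : ℂ) + 1)) (hθ₁ : ∀ k : ℕ, θ₁ k ^ 2 = qn (2 * p₁ - k))
    (hθ₂ : ∀ k : ℕ, θ₂ k ^ 2 = qn (2 * p₂ - k)) {n : ℕ} (hn : n + 1 < N) (a : Fin N × Fin N) :
    θ₁ n * θ₂ n * (lowerOp N s p₁ p₂ φ θ₁ θ₂).mulVec (cgVec N s p₁ p₂ φ θ₁ θ₂ n 0) a
      = (ε (-(p₁ + p₂ - n)) * (qn (2 * p₂ - (a.2 : ℕ) + 1) * qn (a.2 : ℕ))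
          - ε (p₁ + p₂ - n) * (qn (2 * p₁ - (a.1 : ℕ) + 1) * qn (a.1 : ℕ)))
        * cgVec N s p₁ p₂ φ θ₁ θ₂ (n + 1) 0 a := by
  rw [cgVec_zero, cgVec_zero, lowerOp_mulVec (fun b₁ b₂ => if b₁ + b₂ = n
    then hwVal N s p₁ p₂ φ θ₁ θ₂ b₁ b₂ else 0) a]
  obtain ⟨⟨a, ha⟩, ⟨b, hb⟩⟩ := a
  simp only
  by_cases hw : a + b = n + 1
  · have e1 : θ₁ n * θ₂ n * (ε (p₂ - b) * (if a = 0 then 0 else θ₁ (a - 1) * φ (a - 1)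
          * (if a - 1 + b = n then hwVal N s p₁ p₂ φ θ₁ θ₂ (a - 1) b else 0)))
        = -(ε (p₁ + p₂ - n) * (qn (2 * p₁ - a + 1) * qn a)) * hwVal N s p₁ p₂ φ θ₁ θ₂ a b := by
      rcases a with _ | a
      · simp
      · have h := mul_hwVal_left (p₁ := p₁) (p₂ := p₂) (θ₁ := θ₁) (θ₂ := θ₂) hN hs hφ hn a b
        rw [if_neg (Nat.succ_ne_zero _), Nat.add_sub_cancel]
        rw [if_pos hw] at h
        have h1 : qn (2 * p₁ - ((a + 1 : ℕ) : ℂ) + 1) = θ₁ a ^ 2 := by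
          rw [hθ₁]; congr 1; push_cast; ring
        have h2 : qn ((a + 1 : ℕ) : ℂ) = φ a ^ 2 := by rw [hφ]; push_cast; rfl
        have h3 : ε (p₁ + p₂ - n) * ε (a - p₁) = ε (p₂ - b) := by
          rw [← eps_add]; congr 1
          have : (n : ℂ) = a + b := by
            have : a + b = n := by omega
            exact_mod_cast this.symm
          rw [this]; ring
        rw [h1, h2, ← h3]
        linear_combination (ε (p₁ + p₂ - n) * θ₁ a * φ a) * h
    have e2 : θ₁ n * θ₂ n * (ε (-(p₁ - a)) * (if b = 0 then 0 else θ₂ (b - 1) * φ (b - 1)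
          * (if a + (b - 1) = n then hwVal N s p₁ p₂ φ θ₁ θ₂ a (b - 1) else 0)))
        = ε (-(p₁ + p₂ - n)) * (qn (2 * p₂ - b + 1) * qn b) * hwVal N s p₁ p₂ φ θ₁ θ₂ a b := by
      rcases b with _ | b
      · simp
      · have h := mul_hwVal_right (p₁ := p₁) (p₂ := p₂) (θ₁ := θ₁) (θ₂ := θ₂) hN hs hφ hn a b
        rw [if_neg (Nat.succ_ne_zero _), Nat.add_sub_cancel]
        rw [if_pos hw] at h
        have h1 : qn (2 * p₂ - ((b + 1 : ℕ) : ℂ) + 1) = θ₂ b ^ 2 := by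
          rw [hθ₂]; congr 1; push_cast; ring
        have h2 : qn ((b + 1 : ℕ) : ℂ) = φ b ^ 2 := by rw [hφ]; push_cast; rfl
        have h3 : ε (-(p₁ + p₂ - n)) * ε (p₂ - b) = ε (-(p₁ - a)) := by
          rw [← eps_add]; congr 1
          have : (n : ℂ) = a + b := by
            have : a + b = n := by omega
            exact_mod_cast this.symm
          rw [this]; ring
        rw [h1, h2, ← h3]
        linear_combination (-(ε (-(p₁ + p₂ - n)) * θ₂ b * φ b)) * h
    rw [if_pos hw, mul_add, e1, e2]
    ring
  · rw [if_neg hw, mul_zero]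
    have e1 : a ≠ 0 → ¬ (a - 1 + b = n) := by omega
    have e2 : b ≠ 0 → ¬ (a + (b - 1) = n) := by omega
    by_cases ha0 : a = 0
    · by_cases hb0 : b = 0
      · simp [ha0, hb0]
      · rw [if_pos ha0, if_neg hb0, if_neg (e2 hb0)]; simp
    · by_cases hb0 : b = 0
      · rw [if_neg ha0, if_pos hb0, if_neg (e1 ha0)]; simp
      · rw [if_neg ha0, if_neg hb0, if_neg (e1 ha0), if_neg (e2 hb0)]; simp

theorem eps_one_sq_sub_one_ne_zero (hN : 2 ≤ N) (hs : IsCoprime s (N : ℤ)) :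
    ε 1 ^ 2 - 1 ≠ 0 := by
  intro h
  refine eps_one_sub_ne_zero hN hs ?_
  rw [eps_neg]
  have := eps_ne_zero (N := N) (s := s) 1
  field_simp
  linear_combination h

theorem qNum_eq (hN : 2 ≤ N) (hs : IsCoprime s (N : ℤ)) (x : ℂ) :
    qn x = (ε x - (ε x)⁻¹) * ε 1 / (ε 1 ^ 2 - 1) := by
  have h0 := eps_ne_zero (N := N) (s := s) 1
  have h1 := eps_one_sub_ne_zero hN hs
  have h2 := eps_one_sq_sub_one_ne_zero hN hs
  rw [qNum, div_eq_div_iff h1 h2, eps_neg, eps_neg]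
  field_simp

/-- The diagonal part of the action of `X⁺ X⁻` on a highest weight vector. -/
def hwExpect (N : ℕ) (s : ℤ) (p₁ p₂ : ℂ) (n : ℕ) : ℂ :=
  qNum N s (2 * p₁) - qNum N s 2 * (qNum N s (2 * p₂ - n + 1) * qNum N s n)
    / qNum N s (2 * (p₁ + p₂ - n + 1))

/-- On the weight space a + b = n the diagonal remainder is a scalar plus a multiple, depending only
on n, of the diagonal operator of `lowerOp_mulVec_hwVal` at the preceding level. Applied to a
highest weight vector, the second part therefore falls into the preceding component. -/
theorem crossVal_two (hN : 2 ≤ N) (hs : IsCoprime s (N : ℤ)) {n a b : ℕ} (hab : a + b = n)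
    (hP : qn (2 * (p₁ + p₂ - n + 1)) ≠ 0) :
    crossVal N s p₁ (ε 2) a = hwExpect N s p₁ p₂ n
      + qn 2 * ε (p₁ + p₂ - n + 1) / qn (2 * (p₁ + p₂ - n + 1))
        * (ε (-(p₁ + p₂ - n + 1)) * (qn (2 * p₂ - b + 1) * qn b)
          - ε (p₁ + p₂ - n + 1) * (qn (2 * p₁ - a + 1) * qn a)) := by
  have hn : (n : ℂ) = a + b := by exact_mod_cast hab.symm
  have hE : ε 1 ^ 2 - 1 ≠ 0 := eps_one_sq_sub_one_ne_zero hN hs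
  have h0 := eps_ne_zero (N := N) (s := s)
  rw [crossVal, hwExpect]
  generalize hQ : qn (2 * (p₁ + p₂ - n + 1)) = Q at *
  field_simp
  rw [← hQ, hn, qNum_two hN hs, show (2 : ℂ) = 1 + 1 by norm_num]
  simp only [qNum_eq hN hs, add_mul, one_mul, mul_add, mul_sub, eps_add, eps_sub, eps_neg]
  field_simp
  ring

theorem crossVal_neg_two (hN : 2 ≤ N) (hs : IsCoprime s (N : ℤ)) {n a b : ℕ} (hab : a + b = n)
    (hP : qn (2 * (p₁ + p₂ - n + 1)) ≠ 0) :
    crossVal N s p₂ (ε (-2)) b = hwExpect N s p₂ p₁ n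
      - qn 2 * ε (-(p₁ + p₂ - n + 1)) / qn (2 * (p₁ + p₂ - n + 1))
        * (ε (-(p₁ + p₂ - n + 1)) * (qn (2 * p₂ - b + 1) * qn b)
          - ε (p₁ + p₂ - n + 1) * (qn (2 * p₁ - a + 1) * qn a)) := by
  have hn : (n : ℂ) = a + b := by exact_mod_cast hab.symm
  have hE : ε 1 ^ 2 - 1 ≠ 0 := eps_one_sq_sub_one_ne_zero hN hs
  have h0 := eps_ne_zero (N := N) (s := s)
  rw [crossVal, hwExpect, add_comm p₂ p₁]
  generalize hQ : qn (2 * (p₁ + p₂ - n + 1)) = Q at *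
  field_simp
  rw [← hQ, hn, qNum_two hN hs, show (2 : ℂ) = 1 + 1 by norm_num]
  simp only [qNum_eq hN hs, add_mul, one_mul, mul_add, mul_sub, eps_add, eps_sub, eps_neg]
  field_simp
  ring

end Basis

/-! ### Orthogonality and completeness of the Clebsch-Gordan basis -/

section Completeness

variable {N : ℕ} {s : ℤ} {p₁ p₂ : ℂ} {φ θ₁ θ₂ : ℕ → ℂ}

local notation "ε" => epsPow N s
local notation "qn" => qNum N s

theorem diagonal_mulVec_cgVec (f : ℕ → ℂ) (n z : ℕ) :
    (Matrix.diagonal fun a : Fin N × Fin N => f (a.1 + a.2)).mulVec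
        (cgVec N s p₁ p₂ φ θ₁ θ₂ n z) = f (n + z) • cgVec N s p₁ p₂ φ θ₁ θ₂ n z := by
  ext a
  rw [Matrix.mulVec_diagonal, Pi.smul_apply, smul_eq_mul, cgVec]
  split_ifs with h
  · rw [h]
  · simp

/-- This is the usual sl₂ induction: replace the vector of depth z + 1 by X⁻ of the previous one,
commute X⁺ past X⁻, and cancel [z+1], which is nonzero below N. -/
theorem raiseOp_mulVec_cgVec_succ (hN : 2 ≤ N) (hs : IsCoprime s (N : ℤ))
    (hφ : ∀ k : ℕ, φ k ^ 2 = qn ((k : ℂ) + 1)) (hθ₁ : ∀ k : ℕ, θ₁ k ^ 2 = qn (2 * p₁ - k))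
    (hθ₂ : ∀ k : ℕ, θ₂ k ^ 2 = qn (2 * p₂ - k)) {n : ℕ} (hn : n < N) {z : ℕ} (hz : z + 1 < N) :
    (raiseOp N s p₁ p₂ φ θ₁ θ₂).mulVec (cgVec N s p₁ p₂ φ θ₁ θ₂ n (z + 1))
      = qn (2 * (p₁ + p₂) - 2 * n - z) • cgVec N s p₁ p₂ φ θ₁ θ₂ n z := by
  have hE : ∀ z : ℕ, qn ((z : ℂ) + 1) • (raiseOp N s p₁ p₂ φ θ₁ θ₂).mulVec
        (cgVec N s p₁ p₂ φ θ₁ θ₂ n (z + 1))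
      = (lowerOp N s p₁ p₂ φ θ₁ θ₂).mulVec ((raiseOp N s p₁ p₂ φ θ₁ θ₂).mulVec
          (cgVec N s p₁ p₂ φ θ₁ θ₂ n z))
        + qn (2 * (p₁ + p₂) - 2 * n - 2 * z) • cgVec N s p₁ p₂ φ θ₁ θ₂ n z := by
    intro z
    rw [← Matrix.mulVec_smul, ← lowerOp_mulVec_cgVec hN hs hθ₁ hθ₂ hn, Matrix.mulVec_mulVec,
      raiseOp_mul_lowerOp hN hs hφ hθ₁ hθ₂, Matrix.add_mulVec, ← Matrix.mulVec_mulVec]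
    congr 1
    have h := diagonal_mulVec_cgVec (N := N) (s := s) (p₁ := p₁) (p₂ := p₂) (φ := φ) (θ₁ := θ₁)
      (θ₂ := θ₂) (fun w => qn (2 * p₁ + 2 * p₂ - 2 * (w : ℂ))) n z
    push_cast at h
    rw [h]
    congr 2; ring
  induction z with
  | zero =>
    have h := hE 0
    rw [raiseOp_mulVec_cgVec_zero hN hs hφ hn, Matrix.mulVec_zero, zero_add, Nat.cast_zero,
      zero_add, qNum_one hN hs, one_smul, mul_zero] at h
    rw [h, zero_add, Nat.cast_zero]
  | succ z ih =>
    have h := hE (z + 1)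
    have hz0 : qn (((z + 1 : ℕ) : ℂ) + 1) ≠ 0 := qNum_succ_ne_zero hN hs hz
    rw [ih (by omega), Matrix.mulVec_smul, lowerOp_mulVec_cgVec hN hs hθ₁ hθ₂ hn, smul_smul,
      ← add_smul] at h
    have hq := qNum_mul_succ hN hs (2 * (p₁ + p₂) - 2 * n) ((z + 1 : ℕ) : ℂ)
    have e : 2 * (p₁ + p₂) - 2 * n - ((z + 1 : ℕ) : ℂ) + 1 = 2 * (p₁ + p₂) - 2 * n - z := by
      push_cast; ring
    rw [e, Nat.cast_succ z, ← Nat.cast_succ z] at hq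
    rw [← Nat.cast_succ z, Nat.succ_eq_add_one, ← hq, mul_comm, ← smul_smul] at h
    exact smul_right_injective _ hz0 h

theorem cgVec_dotProduct_of_ne (n n' z z' : ℕ) (h : n + z ≠ n' + z') :
    cgVec N s p₁ p₂ φ θ₁ θ₂ n z ⬝ᵥ cgVec N s p₁ p₂ φ θ₁ θ₂ n' z' = 0 := by
  refine Finset.sum_eq_zero fun b _ => ?_
  simp only [cgVec]
  split_ifs with h1 h2
  · exact absurd (h1.symm.trans h2) h
  all_goals simp

theorem cgVec_zero_dotProduct_self (hN : 2 ≤ N) (hs : IsCoprime s (N : ℤ))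
    (hφ : ∀ k : ℕ, φ k ^ 2 = qn ((k : ℂ) + 1)) (hθ₁ : ∀ k : ℕ, θ₁ k ^ 2 = qn (2 * p₁ - k))
    (hθ₂ : ∀ k : ℕ, θ₂ k ^ 2 = qn (2 * p₂ - k)) {n : ℕ} (hn : n < N) :
    cgVec N s p₁ p₂ φ θ₁ θ₂ n 0 ⬝ᵥ cgVec N s p₁ p₂ φ θ₁ θ₂ n 0
      = (qFact N s n)⁻¹ * qFalling N s (2 * p₁ + 2 * p₂ - n + 1) n := by
  rw [← sum_hwVal_sq hN hs hφ hθ₁ hθ₂ hn, cgVec_zero]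
  simp only [dotProduct, ite_mul, zero_mul, mul_ite, mul_zero]
  rw [← Finset.sum_filter, ← Finset.sum_filter]
  refine Finset.sum_bij (fun b _ => ((b.2 : ℕ), (b.1 : ℕ))) ?_ ?_ ?_ ?_
  · intro b hb
    simp only [Finset.mem_filter, Finset.mem_univ, true_and] at hb
    refine Finset.HasAntidiagonal.mem_antidiagonal.mpr ?_
    simp only; omega
  · intro b _ b' _ h
    simp only [Prod.mk.injEq] at h
    exact Prod.ext (Fin.ext h.2) (Fin.ext h.1)
  · rintro ⟨i, j⟩ h
    have h : i + j = n := Finset.HasAntidiagonal.mem_antidiagonal.mp h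
    refine ⟨(⟨j, by omega⟩, ⟨i, by omega⟩), ?_, rfl⟩
    simp only [Finset.mem_filter, Finset.mem_univ, true_and]
    omega
  · intro b _
    simp only [sq]

theorem qFalling_ne_zero {x : ℂ} (hP : ∀ k : ℤ, qn (x + k) ≠ 0) (j : ℤ) (n : ℕ) :
    qFalling N s (x + j) n ≠ 0 := by
  refine Finset.prod_ne_zero_iff.mpr fun k _ => ?_
  have := hP (j - k)
  push_cast at this
  rwa [add_sub_assoc]

theorem qNum_ne_zero_of_eq {x y : ℂ} (hP : ∀ k : ℤ, qn (x + k) ≠ 0) (k : ℤ) (h : y = x + k) :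
    qn y ≠ 0 := h ▸ hP k

theorem cgNorm_ne_zero (hN : 2 ≤ N) (hs : IsCoprime s (N : ℤ)) {P : ℂ}
    (hP : ∀ k : ℤ, qn (2 * P + k) ≠ 0) {n z : ℕ} (hn : n < N) (hz : z < N) :
    cgNorm N s P n z ≠ 0 := by
  refine div_ne_zero (mul_ne_zero (mul_ne_zero ?_ (qFact_ne_zero hN hs hn))
    (qFact_ne_zero hN hs hz)) ?_
  · exact qNum_ne_zero_of_eq hP (-2 * n + 1) (by push_cast; ring)
  · have := qFalling_ne_zero hP (-n + 1) (n + z + 1)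
    push_cast at this
    rwa [show 2 * P - n + 1 = 2 * P + (-n + 1) by ring]

/-- The ratio of the coefficients of X⁻ and X⁺ between the depths z and z + 1 is the ratio of
consecutive norms, as the adjunction of X⁺ and X⁻ demands. -/
theorem cgNorm_succ {P : ℂ} (hP : ∀ k : ℤ, qn (2 * P + k) ≠ 0) (n z : ℕ) :
    cgNorm N s P n (z + 1) * qn (2 * P - 2 * n - z) = cgNorm N s P n z * qn ((z : ℂ) + 1) := by
  have h1 : qn (2 * P - 2 * n - z) ≠ 0 :=
    qNum_ne_zero_of_eq hP (-2 * n - z) (by push_cast; ring)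
  have h2 : qFalling N s (2 * P - n + 1) (n + z + 1) ≠ 0 := by
    have := qFalling_ne_zero hP (-n + 1) (n + z + 1)
    push_cast at this
    rwa [show 2 * P - n + 1 = 2 * P + (-n + 1) by ring]
  rw [cgNorm, cgNorm, show n + (z + 1) + 1 = (n + z + 1) + 1 by ring, qFalling_succ, qFact_succ,
    show 2 * P - n + 1 - ((n + z + 1 : ℕ) : ℂ) = 2 * P - 2 * n - z by push_cast; ring]
  generalize qn (2 * P - 2 * n - z) = Q at *
  generalize qn (2 * P - 2 * n + 1) = Q' at *
  generalize qFalling N s (2 * P - n + 1) (n + z + 1) = Q'' at *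
  field_simp

/-- For the bilinear (not Hermitian) dot product X⁺ is the transpose of X⁻. Moving one X⁻ across
lowers both depths by one, so everything reduces to highest weight vectors, which are separated by
weight and have the norm computed by `sum_hwVal_sq`. -/
theorem cgVec_dotProduct (hN : 2 ≤ N) (hs : IsCoprime s (N : ℤ))
    (hφ : ∀ k : ℕ, φ k ^ 2 = qn ((k : ℂ) + 1)) (hθ₁ : ∀ k : ℕ, θ₁ k ^ 2 = qn (2 * p₁ - k))
    (hθ₂ : ∀ k : ℕ, θ₂ k ^ 2 = qn (2 * p₂ - k)) (hP : ∀ k : ℤ, qn (2 * (p₁ + p₂) + k) ≠ 0)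
    {n n' z z' : ℕ} (hn : n < N) (hn' : n' < N) (hz : z < N) (hz' : z' < N) :
    cgNorm N s (p₁ + p₂) n z
        * (cgVec N s p₁ p₂ φ θ₁ θ₂ n z ⬝ᵥ cgVec N s p₁ p₂ φ θ₁ θ₂ n' z')
      = if n = n' ∧ z = z' then 1 else 0 := by
  have adj : ∀ v w : Fin N × Fin N → ℂ, (lowerOp N s p₁ p₂ φ θ₁ θ₂).mulVec v ⬝ᵥ w
      = v ⬝ᵥ (raiseOp N s p₁ p₂ φ θ₁ θ₂).mulVec w := by
    intro v w
    rw [← lowerOp_transpose, Matrix.mulVec_transpose, dotProduct_comm v,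
      ← Matrix.dotProduct_mulVec, dotProduct_comm]
  have hE0 : ∀ {n : ℕ}, n < N → (raiseOp N s p₁ p₂ φ θ₁ θ₂).mulVec
      (cgVec N s p₁ p₂ φ θ₁ θ₂ n 0) = 0 := fun hn => raiseOp_mulVec_cgVec_zero hN hs hφ hn
  have hzero : ∀ {n n' z' : ℕ}, n < N → n' < N → z' + 1 < N →
      cgVec N s p₁ p₂ φ θ₁ θ₂ n' (z' + 1) ⬝ᵥ cgVec N s p₁ p₂ φ θ₁ θ₂ n 0 = 0 := by
    intro n n' z' hn hn' hz'
    have h := adj (cgVec N s p₁ p₂ φ θ₁ θ₂ n' z') (cgVec N s p₁ p₂ φ θ₁ θ₂ n 0)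
    rw [hE0 hn, dotProduct_zero, lowerOp_mulVec_cgVec hN hs hθ₁ hθ₂ hn', smul_dotProduct,
      smul_eq_mul] at h
    exact (mul_eq_zero.mp h).resolve_left (qNum_succ_ne_zero hN hs hz')
  induction z generalizing z' with
  | zero =>
    rcases z' with _ | z'
    · by_cases h : n = n'
      · subst h
        have h1 : qn (2 * (p₁ + p₂) - 2 * n + 1) ≠ 0 :=
          qNum_ne_zero_of_eq hP (-2 * n + 1) (by push_cast; ring)
        have h2 : qFalling N s (2 * (p₁ + p₂) - n + 1) n ≠ 0 := by
          have := qFalling_ne_zero hP (-n + 1) n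
          push_cast at this
          rwa [show 2 * (p₁ + p₂) - n + 1 = 2 * (p₁ + p₂) + (-n + 1) by ring]
        have h3 := qFact_ne_zero hN hs hn
        rw [if_pos ⟨rfl, rfl⟩, cgVec_zero_dotProduct_self hN hs hφ hθ₁ hθ₂ hn, cgNorm, add_zero,
          qFalling_succ, qFact_zero, ← mul_add,
          show 2 * (p₁ + p₂) - (n : ℂ) + 1 - n = 2 * (p₁ + p₂) - 2 * n + 1 by ring]
        generalize qn (2 * (p₁ + p₂) - 2 * n + 1) = Q at *
        generalize qFalling N s (2 * (p₁ + p₂) - n + 1) n = Q' at *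
        field_simp
      · rw [if_neg (fun h' => h h'.1), cgVec_dotProduct_of_ne _ _ _ _ (by omega), mul_zero]
    · rw [if_neg (by omega), dotProduct_comm, hzero hn hn' hz', mul_zero]
  | succ z ih =>
    have hz1 : qn ((z : ℂ) + 1) ≠ 0 := qNum_succ_ne_zero hN hs hz
    rcases z' with _ | z'
    · rw [if_neg (by omega), hzero hn' hn hz, mul_zero]
    · have h := adj (cgVec N s p₁ p₂ φ θ₁ θ₂ n z) (cgVec N s p₁ p₂ φ θ₁ θ₂ n' (z' + 1))
      rw [raiseOp_mulVec_cgVec_succ hN hs hφ hθ₁ hθ₂ hn' hz',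
        lowerOp_mulVec_cgVec hN hs hθ₁ hθ₂ hn, smul_dotProduct, dotProduct_smul, smul_eq_mul,
        smul_eq_mul] at h
      have ih' := ih (z' := z') (by omega) (by omega)
      refine mul_left_cancel₀ hz1 ?_
      by_cases hc : n = n' ∧ z = z'
      · obtain ⟨rfl, rfl⟩ := hc
        rw [if_pos ⟨rfl, rfl⟩] at ih' ⊢
        linear_combination cgNorm N s (p₁ + p₂) n (z + 1) * h + qn ((z : ℂ) + 1) * ih'
          + (cgVec N s p₁ p₂ φ θ₁ θ₂ n z ⬝ᵥ cgVec N s p₁ p₂ φ θ₁ θ₂ n z) * cgNorm_succ hP n z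
      · rw [if_neg hc] at ih'
        have h0 := (mul_eq_zero.mp ih').resolve_left (cgNorm_ne_zero hN hs hP hn (by omega))
        rw [h0, mul_zero] at h
        rw [if_neg (by omega)]
        linear_combination cgNorm N s (p₁ + p₂) n (z + 1) * h

/-- There are N² vectors in a space of dimension N², so orthonormality is a one-sided inverse of a
square matrix and hence two-sided. -/
theorem sum_cgNorm_mul_cgVec_mul_cgVec (hN : 2 ≤ N) (hs : IsCoprime s (N : ℤ))
    (hφ : ∀ k : ℕ, φ k ^ 2 = qn ((k : ℂ) + 1)) (hθ₁ : ∀ k : ℕ, θ₁ k ^ 2 = qn (2 * p₁ - k))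
    (hθ₂ : ∀ k : ℕ, θ₂ k ^ 2 = qn (2 * p₂ - k)) (hP : ∀ k : ℤ, qn (2 * (p₁ + p₂) + k) ≠ 0)
    (a b : Fin N × Fin N) :
    ∑ m : Fin N × Fin N, cgNorm N s (p₁ + p₂) m.1 m.2 * cgVec N s p₁ p₂ φ θ₁ θ₂ m.1 m.2 a
      * cgVec N s p₁ p₂ φ θ₁ θ₂ m.1 m.2 b = if a = b then 1 else 0 := by
  have h : (Matrix.of fun m b : Fin N × Fin N => cgNorm N s (p₁ + p₂) m.1 m.2
        * cgVec N s p₁ p₂ φ θ₁ θ₂ m.1 m.2 b)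
      * (Matrix.of fun b m : Fin N × Fin N => cgVec N s p₁ p₂ φ θ₁ θ₂ m.1 m.2 b) = 1 := by
    ext m m'
    rw [Matrix.mul_apply, Matrix.one_apply]
    simp only [Matrix.of_apply, mul_assoc]
    rw [← Finset.mul_sum]
    refine (cgVec_dotProduct hN hs hφ hθ₁ hθ₂ hP m.1.2 m'.1.2 m.2.2 m'.2.2).trans ?_
    congr 1
    rw [Prod.ext_iff, Fin.ext_iff, Fin.ext_iff]
  rw [mul_eq_one_comm] at h
  rw [← Matrix.one_apply, ← h, Matrix.mul_apply]
  exact Finset.sum_congr rfl fun m _ => by simp only [Matrix.of_apply]; ring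

theorem eq_of_mulVec_cgVec_eq (hN : 2 ≤ N) (hs : IsCoprime s (N : ℤ))
    (hφ : ∀ k : ℕ, φ k ^ 2 = qn ((k : ℂ) + 1)) (hθ₁ : ∀ k : ℕ, θ₁ k ^ 2 = qn (2 * p₁ - k))
    (hθ₂ : ∀ k : ℕ, θ₂ k ^ 2 = qn (2 * p₂ - k)) (hP : ∀ k : ℤ, qn (2 * (p₁ + p₂) + k) ≠ 0)
    {A B : Matrix (Fin N × Fin N) (Fin N × Fin N) ℂ}
    (h : ∀ n < N, ∀ z < N, A.mulVec (cgVec N s p₁ p₂ φ θ₁ θ₂ n z)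
      = B.mulVec (cgVec N s p₁ p₂ φ θ₁ θ₂ n z)) : A = B := by
  have key : ∀ (M : Matrix (Fin N × Fin N) (Fin N × Fin N) ℂ) a b, M a b
      = ∑ m : Fin N × Fin N, cgNorm N s (p₁ + p₂) m.1 m.2
        * M.mulVec (cgVec N s p₁ p₂ φ θ₁ θ₂ m.1 m.2) a
        * cgVec N s p₁ p₂ φ θ₁ θ₂ m.1 m.2 b := by
    intro M a b
    simp only [Matrix.mulVec, dotProduct, Finset.mul_sum, Finset.sum_mul]
    rw [Finset.sum_comm]
    have : ∀ c : Fin N × Fin N, ∑ m : Fin N × Fin N, cgNorm N s (p₁ + p₂) m.1 m.2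
        * (M a c * cgVec N s p₁ p₂ φ θ₁ θ₂ m.1 m.2 c) * cgVec N s p₁ p₂ φ θ₁ θ₂ m.1 m.2 b
        = M a c * if c = b then 1 else 0 := by
      intro c
      rw [← sum_cgNorm_mul_cgVec_mul_cgVec hN hs hφ hθ₁ hθ₂ hP, Finset.mul_sum]
      exact Finset.sum_congr rfl fun m _ => by ring
    simp [this]
  ext a b
  rw [key A, key B]
  exact Finset.sum_congr rfl fun m _ => by rw [h _ m.1.2 _ m.2.2]

theorem eq_zero_of_dotProduct_cgVec_eq_zero (hN : 2 ≤ N) (hs : IsCoprime s (N : ℤ))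
    (hφ : ∀ k : ℕ, φ k ^ 2 = qn ((k : ℂ) + 1)) (hθ₁ : ∀ k : ℕ, θ₁ k ^ 2 = qn (2 * p₁ - k))
    (hθ₂ : ∀ k : ℕ, θ₂ k ^ 2 = qn (2 * p₂ - k)) (hP : ∀ k : ℤ, qn (2 * (p₁ + p₂) + k) ≠ 0)
    {v : Fin N × Fin N → ℂ} (h : ∀ n < N, ∀ z < N, cgVec N s p₁ p₂ φ θ₁ θ₂ n z ⬝ᵥ v = 0) :
    v = 0 := by
  ext a
  have e : v a = ∑ c, (if a = c then 1 else 0) * v c := by simp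
  rw [e, Pi.zero_apply]
  simp only [← sum_cgNorm_mul_cgVec_mul_cgVec hN hs hφ hθ₁ hθ₂ hP, Finset.sum_mul]
  rw [Finset.sum_comm]
  refine Finset.sum_eq_zero fun m _ => ?_
  simp only [mul_assoc]
  rw [← Finset.mul_sum, ← Finset.mul_sum]
  have := h _ m.1.2 _ m.2.2
  rw [dotProduct] at this
  rw [this, mul_zero, mul_zero]

end Completeness

/-! ### Operators acting by scalars on the Clebsch-Gordan components -/

/-- Square roots of the numbers in the matrix elements of the generators, the Clebsch-Gordan
decomposition being multiplicity free. -/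
structure RootData (N : ℕ) (s : ℤ) (p₁ p₂ : ℂ) (φ θ₁ θ₂ : ℕ → ℂ) : Prop where
  two_le : 2 ≤ N
  coprime : IsCoprime s (N : ℤ)
  sq_phi : ∀ k : ℕ, φ k ^ 2 = qNum N s ((k : ℂ) + 1)
  sq_left : ∀ k : ℕ, θ₁ k ^ 2 = qNum N s (2 * p₁ - k)
  sq_right : ∀ k : ℕ, θ₂ k ^ 2 = qNum N s (2 * p₂ - k)
  generic : ∀ k : ℤ, qNum N s (2 * (p₁ + p₂) + k) ≠ 0

theorem RootData.symm {N : ℕ} {s : ℤ} {p₁ p₂ : ℂ} {φ θ₁ θ₂ : ℕ → ℂ}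
    (h : RootData N s p₁ p₂ φ θ₁ θ₂) : RootData N s p₂ p₁ φ θ₂ θ₁ :=
  ⟨h.two_le, h.coprime, h.sq_phi, h.sq_right, h.sq_left, by rw [add_comm p₂ p₁]; exact h.generic⟩

/-- The matrix that acts by `G n` on the components of type `n`. -/
def rGen (N : ℕ) (s : ℤ) (p₁ p₂ : ℂ) (φ θ₁ θ₂ : ℕ → ℂ) (G : ℕ → ℂ) :
    Matrix (Fin N × Fin N) (Fin N × Fin N) ℂ :=
  Matrix.of fun a b => ∑ m : Fin N × Fin N, G m.1 * cgNorm N s (p₁ + p₂) m.1 m.2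
    * cgVec N s p₂ p₁ φ θ₂ θ₁ m.1 m.2 a.swap * cgVec N s p₁ p₂ φ θ₁ θ₂ m.1 m.2 b

section SwapMulVec

variable {m R : Type*} [Fintype m] [CommRing R]

theorem swapMat_mulVec_comp_swap (M : Matrix (m × m) (m × m) R) (v : m × m → R) :
    (swapMat M).mulVec (v ∘ Prod.swap) = M.mulVec v ∘ Prod.swap := by
  ext a
  simp only [Matrix.mulVec, dotProduct, swapMat, Matrix.submatrix_apply, Function.comp]
  exact Fintype.sum_equiv (Equiv.prodComm m m) _ _ fun _ => rfl

theorem comp_swap_dotProduct_comp_swap (v w : m × m → R) :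
    (v ∘ Prod.swap) ⬝ᵥ (w ∘ Prod.swap) = v ⬝ᵥ w :=
  Fintype.sum_equiv (Equiv.prodComm m m) _ _ fun _ => rfl

omit [Fintype m] [CommRing R] in
theorem swapMat_swapMat (M : Matrix (m × m) (m × m) R) : swapMat (swapMat M) = M := rfl

omit [Fintype m] [CommRing R] in
theorem swapMat_transpose (M : Matrix (m × m) (m × m) R) :
    (swapMat M).transpose = swapMat M.transpose := rfl

theorem dotProduct_mulVec_eq (M : Matrix (m × m) (m × m) R) (v w : m × m → R) :
    v ⬝ᵥ M.mulVec w = M.transpose.mulVec v ⬝ᵥ w := by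
  rw [Matrix.mulVec_transpose, Matrix.dotProduct_mulVec]

end SwapMulVec

section RGen

variable {N : ℕ} {s : ℤ} {p₁ p₂ : ℂ} {φ θ₁ θ₂ : ℕ → ℂ} {G : ℕ → ℂ}

local notation "ε" => epsPow N s
local notation "qn" => qNum N s

/-- This symmetry halves the work: the relation for X⁺ is the transpose of that for X⁻ with the
factors exchanged, and likewise X₀⁻ comes from X₀⁺. -/
theorem rGen_transpose : (rGen N s p₁ p₂ φ θ₁ θ₂ G).transpose
    = swapMat (rGen N s p₂ p₁ φ θ₂ θ₁ G) := by
  ext a b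
  simp only [rGen, swapMat, Matrix.transpose_apply, Matrix.of_apply, Matrix.submatrix_apply,
    Prod.swap_swap, add_comm p₂ p₁]
  exact Finset.sum_congr rfl fun m _ => by ring

variable (h : RootData N s p₁ p₂ φ θ₁ θ₂)

include h

theorem rGen_mulVec_cgVec {n z : ℕ} (hn : n < N) (hz : z < N) :
    (rGen N s p₁ p₂ φ θ₁ θ₂ G).mulVec (cgVec N s p₁ p₂ φ θ₁ θ₂ n z)
      = G n • (cgVec N s p₂ p₁ φ θ₂ θ₁ n z ∘ Prod.swap) := by
  ext a
  simp only [Matrix.mulVec, dotProduct, rGen, Matrix.of_apply, Finset.sum_mul, Pi.smul_apply,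
    Function.comp, smul_eq_mul]
  rw [Finset.sum_comm]
  have : ∀ m : Fin N × Fin N, ∑ b, G m.1 * cgNorm N s (p₁ + p₂) m.1 m.2
        * cgVec N s p₂ p₁ φ θ₂ θ₁ m.1 m.2 a.swap * cgVec N s p₁ p₂ φ θ₁ θ₂ m.1 m.2 b
          * cgVec N s p₁ p₂ φ θ₁ θ₂ n z b
      = G m.1 * cgVec N s p₂ p₁ φ θ₂ θ₁ m.1 m.2 a.swap
        * if (m.1 : ℕ) = n ∧ (m.2 : ℕ) = z then 1 else 0 := by
    intro m
    rw [← cgVec_dotProduct h.two_le h.coprime h.sq_phi h.sq_left h.sq_right h.generic m.1.2 hn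
      m.2.2 hz, dotProduct, Finset.mul_sum, Finset.mul_sum]
    exact Finset.sum_congr rfl fun b _ => by ring
  simp only [this]
  rw [Finset.sum_eq_single ((⟨n, hn⟩, ⟨z, hz⟩) : Fin N × Fin N)]
  · simp
  · intro m _ hm
    rw [if_neg, mul_zero]
    rintro ⟨h1, h2⟩
    exact hm (Prod.ext (Fin.ext h1) (Fin.ext h2))
  · simp

theorem lowerOp_mulVec_swap {n : ℕ} (hn : n < N) (z : ℕ) :
    (swapMat (lowerOp N s p₂ p₁ φ θ₂ θ₁)).mulVec (cgVec N s p₂ p₁ φ θ₂ θ₁ n z ∘ Prod.swap)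
      = qn ((z : ℂ) + 1) • (cgVec N s p₂ p₁ φ θ₂ θ₁ n (z + 1) ∘ Prod.swap) := by
  rw [swapMat_mulVec_comp_swap,
    lowerOp_mulVec_cgVec h.two_le h.coprime h.sq_right h.sq_left hn]
  rfl

theorem rGen_mul_lowerOp :
    rGen N s p₁ p₂ φ θ₁ θ₂ G * lowerOp N s p₁ p₂ φ θ₁ θ₂
      = swapMat (lowerOp N s p₂ p₁ φ θ₂ θ₁) * rGen N s p₁ p₂ φ θ₁ θ₂ G := by
  refine eq_of_mulVec_cgVec_eq h.two_le h.coprime h.sq_phi h.sq_left h.sq_right h.generic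
    fun n hn z hz => ?_
  rw [← Matrix.mulVec_mulVec, ← Matrix.mulVec_mulVec, rGen_mulVec_cgVec h hn hz,
    lowerOp_mulVec_cgVec h.two_le h.coprime h.sq_left h.sq_right hn, Matrix.mulVec_smul,
    Matrix.mulVec_smul, lowerOp_mulVec_swap h hn]
  by_cases hz' : z + 1 < N
  · rw [rGen_mulVec_cgVec h hn hz', smul_comm]
  -- At the bottom z = N - 1 of a component the vector of depth N is multiplied by [N] = 0.
  · have : qn ((z : ℂ) + 1) = 0 := by
      rw [← qNum_natCast_self h.two_le h.coprime, show N = z + 1 by omega]; push_cast; rfl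
    rw [this, zero_smul, zero_smul, smul_zero]

theorem rGen_mul_raiseOp :
    rGen N s p₁ p₂ φ θ₁ θ₂ G * raiseOp N s p₁ p₂ φ θ₁ θ₂
      = swapMat (raiseOp N s p₂ p₁ φ θ₂ θ₁) * rGen N s p₁ p₂ φ θ₁ θ₂ G := by
  have h1 := congrArg Matrix.transpose (rGen_mul_lowerOp (G := G) h.symm)
  rw [Matrix.transpose_mul, Matrix.transpose_mul, lowerOp_transpose, rGen_transpose,
    swapMat_transpose, lowerOp_transpose] at h1
  have h2 := congrArg swapMat h1
  rw [swapMat_mul, swapMat_mul] at h2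
  exact h2.symm

/-- The part of `X⁺ X₀⁺` on a highest weight vector that is not a multiple of this vector. -/
def hwDev (N : ℕ) (s : ℤ) (p₁ p₂ : ℂ) (φ θ₁ θ₂ : ℕ → ℂ) (n : ℕ) : Fin N × Fin N → ℂ :=
  fun a => (epsPow N s (-(p₁ + p₂ - n + 1))
        * (qNum N s (2 * p₂ - (a.2 : ℕ) + 1) * qNum N s (a.2 : ℕ))
      - epsPow N s (p₁ + p₂ - n + 1)
        * (qNum N s (2 * p₁ - (a.1 : ℕ) + 1) * qNum N s (a.1 : ℕ)))
    * cgVec N s p₁ p₂ φ θ₁ θ₂ n 0 a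

omit h in
theorem hwDev_zero : hwDev N s p₁ p₂ φ θ₁ θ₂ 0 = 0 := by
  ext a
  simp only [hwDev, cgVec, Pi.zero_apply]
  split_ifs with ha
  · have h1 : (a.1 : ℕ) = 0 := by omega
    have h2 : (a.2 : ℕ) = 0 := by omega
    simp [h1, h2, qNum_zero]
  · simp

/-- The deviation attached to the component n + 1 thus lies in the component n, where `rGen` acts by
G n instead of G (n+1). Comparing the two scalars is what produces the recursion. -/
theorem hwDev_succ {n : ℕ} (hn : n + 1 < N) : hwDev N s p₁ p₂ φ θ₁ θ₂ (n + 1)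
    = (θ₁ n * θ₂ n) • (lowerOp N s p₁ p₂ φ θ₁ θ₂).mulVec (cgVec N s p₁ p₂ φ θ₁ θ₂ n 0) := by
  ext a
  rw [Pi.smul_apply, smul_eq_mul,
    lowerOp_mulVec_hwVal h.two_le h.coprime h.sq_phi h.sq_left h.sq_right hn, hwDev,
    show p₁ + p₂ - ((n + 1 : ℕ) : ℂ) + 1 = p₁ + p₂ - n by push_cast; ring]

theorem qNum_two_mul_ne_zero (n : ℕ) : qn (2 * (p₁ + p₂ - n + 1)) ≠ 0 :=
  qNum_ne_zero_of_eq h.generic (-2 * n + 2) (by push_cast; ring)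

/-- X⁺ kills the highest weight vector, so only the diagonal remainder of the twisted commutator
acts, and `crossVal_two` splits it. -/
theorem raiseOp_affLeft_mulVec {n : ℕ} (hn : n < N) :
    (raiseOp N s p₁ p₂ φ θ₁ θ₂).mulVec ((affLeft N s p₂ φ θ₁).mulVec
        (cgVec N s p₁ p₂ φ θ₁ θ₂ n 0))
      = hwExpect N s p₁ p₂ n • cgVec N s p₁ p₂ φ θ₁ θ₂ n 0
        + (qn 2 * ε (p₁ + p₂ - n + 1) / qn (2 * (p₁ + p₂ - n + 1)))
          • hwDev N s p₁ p₂ φ θ₁ θ₂ n := by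
  rw [Matrix.mulVec_mulVec, raiseOp_mul_affLeft h.two_le h.coprime h.sq_phi h.sq_left,
    Matrix.add_mulVec, Matrix.smul_mulVec, ← Matrix.mulVec_mulVec,
    raiseOp_mulVec_cgVec_zero h.two_le h.coprime h.sq_phi hn, Matrix.mulVec_zero, smul_zero,
    zero_add]
  ext a
  rw [Matrix.mulVec_diagonal]
  simp only [Pi.add_apply, Pi.smul_apply, smul_eq_mul, hwDev]
  by_cases ha : (a.1 : ℕ) + a.2 = n
  · rw [crossVal_two h.two_le h.coprime ha (qNum_two_mul_ne_zero h n)]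
    ring
  · have : cgVec N s p₁ p₂ φ θ₁ θ₂ n 0 a = 0 := if_neg ha
    rw [this]; ring

theorem raiseOp_affRight_mulVec {n : ℕ} (hn : n < N) :
    (raiseOp N s p₁ p₂ φ θ₁ θ₂).mulVec ((affRight N s p₁ φ θ₂).mulVec
        (cgVec N s p₁ p₂ φ θ₁ θ₂ n 0))
      = hwExpect N s p₂ p₁ n • cgVec N s p₁ p₂ φ θ₁ θ₂ n 0
        - (qn 2 * ε (-(p₁ + p₂ - n + 1)) / qn (2 * (p₁ + p₂ - n + 1)))
          • hwDev N s p₁ p₂ φ θ₁ θ₂ n := by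
  rw [Matrix.mulVec_mulVec, raiseOp_mul_affRight h.two_le h.coprime h.sq_phi h.sq_right,
    Matrix.add_mulVec, Matrix.smul_mulVec, ← Matrix.mulVec_mulVec,
    raiseOp_mulVec_cgVec_zero h.two_le h.coprime h.sq_phi hn, Matrix.mulVec_zero, smul_zero,
    zero_add]
  ext a
  rw [Matrix.mulVec_diagonal]
  simp only [Pi.sub_apply, Pi.smul_apply, smul_eq_mul, hwDev]
  by_cases ha : (a.1 : ℕ) + a.2 = n
  · rw [crossVal_neg_two h.two_le h.coprime ha (qNum_two_mul_ne_zero h n)]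
    ring
  · have : cgVec N s p₁ p₂ φ θ₁ θ₂ n 0 a = 0 := if_neg ha
    rw [this]; ring

/-- At level n this uses the recursion at n - 1, since the deviation sits in the component n - 1; at
n = 0 there is no deviation. -/
theorem rGen_mulVec_hwDev {x : ℂ}
    (hG : ∀ n : ℕ, n + 1 < N → θ₁ n * θ₂ n
      * (G (n + 1) * (ε (p₁ + p₂ - n) - x * ε (-(p₁ + p₂ - n)))
        - G n * (x * ε (p₁ + p₂ - n) - ε (-(p₁ + p₂ - n)))) = 0) {n : ℕ} (hn : n < N) :
    (x * ε (p₁ + p₂ - n + 1) - ε (-(p₁ + p₂ - n + 1)))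
        • (rGen N s p₁ p₂ φ θ₁ θ₂ G).mulVec (hwDev N s p₁ p₂ φ θ₁ θ₂ n)
      = (G n * (ε (p₁ + p₂ - n + 1) - x * ε (-(p₁ + p₂ - n + 1))))
        • (hwDev N s p₂ p₁ φ θ₂ θ₁ n ∘ Prod.swap) := by
  rcases n with _ | n
  · rw [hwDev_zero, hwDev_zero, Matrix.mulVec_zero, smul_zero]
    exact (smul_zero _).symm
  · have hR := congrArg (fun M => Matrix.mulVec M (cgVec N s p₁ p₂ φ θ₁ θ₂ n 0))
      (rGen_mul_lowerOp (G := G) h)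
    simp only [← Matrix.mulVec_mulVec] at hR
    rw [rGen_mulVec_cgVec h (by omega) (by omega), Matrix.mulVec_smul,
      swapMat_mulVec_comp_swap] at hR
    rw [hwDev_succ h hn, hwDev_succ h.symm hn, Matrix.mulVec_smul, hR,
      show p₁ + p₂ - ((n + 1 : ℕ) : ℂ) + 1 = p₁ + p₂ - n by push_cast; ring]
    ext a
    simp only [Pi.smul_apply, Function.comp, smul_eq_mul]
    linear_combination -((lowerOp N s p₂ p₁ φ θ₂ θ₁).mulVec
      (cgVec N s p₂ p₁ φ θ₂ θ₁ n 0) a.swap) * hG n hn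

/-- The recursion on the coefficients is the intertwining property for the affine generator. -/
theorem rGen_mul_aff {x : ℂ}
    (hG : ∀ n : ℕ, n + 1 < N → θ₁ n * θ₂ n
      * (G (n + 1) * (ε (p₁ + p₂ - n) - x * ε (-(p₁ + p₂ - n)))
        - G n * (x * ε (p₁ + p₂ - n) - ε (-(p₁ + p₂ - n)))) = 0) :
    rGen N s p₁ p₂ φ θ₁ θ₂ G * (x • affLeft N s p₂ φ θ₁ + affRight N s p₁ φ θ₂)
      = (x • swapMat (affRight N s p₂ φ θ₁) + swapMat (affLeft N s p₁ φ θ₂))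
        * rGen N s p₁ p₂ φ θ₁ θ₂ G := by
  rw [← sub_eq_zero]
  set R := rGen N s p₁ p₂ φ θ₁ θ₂ G with hRdef
  set B := x • affLeft N s p₂ φ θ₁ + affRight N s p₁ φ θ₂ with hB
  set B' := x • swapMat (affRight N s p₂ φ θ₁) + swapMat (affLeft N s p₁ φ θ₂) with hB'
  -- The defect intertwines X⁻, so it vanishes once it vanishes on highest weight vectors.
  have hQF : (R * B - B' * R) * lowerOp N s p₁ p₂ φ θ₁ θ₂
      = swapMat (lowerOp N s p₂ p₁ φ θ₂ θ₁) * (R * B - B' * R) := by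
    have h1 : B * lowerOp N s p₁ p₂ φ θ₁ θ₂ = lowerOp N s p₁ p₂ φ θ₁ θ₂ * B := by
      rw [hB, add_mul, mul_add, smul_mul_assoc, mul_smul_comm, lowerOp_mul_affLeft,
        lowerOp_mul_affRight]
    have h2 : B' * swapMat (lowerOp N s p₂ p₁ φ θ₂ θ₁)
        = swapMat (lowerOp N s p₂ p₁ φ θ₂ θ₁) * B' := by
      rw [hB', add_mul, mul_add, smul_mul_assoc, mul_smul_comm, ← swapMat_mul, ← swapMat_mul,
        ← swapMat_mul, ← swapMat_mul, lowerOp_mul_affLeft, lowerOp_mul_affRight]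
    rw [sub_mul, mul_sub, mul_assoc, h1, ← mul_assoc, rGen_mul_lowerOp h, mul_assoc, mul_assoc B',
      rGen_mul_lowerOp h, ← mul_assoc B', h2, mul_assoc]
  -- The image of a highest weight vector under the defect is shown to be orthogonal to the whole
  -- basis. Vectors of positive depth are images of X⁻, whose transpose X⁺ kills it; highest weight
  -- vectors are treated directly.
  have hQ0 : ∀ n < N, (R * B - B' * R).mulVec (cgVec N s p₁ p₂ φ θ₁ θ₂ n 0) = 0 := by
    intro n hn
    have hraise : (swapMat (raiseOp N s p₂ p₁ φ θ₂ θ₁)).mulVec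
        ((R * B - B' * R).mulVec (cgVec N s p₁ p₂ φ θ₁ θ₂ n 0)) = 0 := by
      have hE : swapMat (raiseOp N s p₂ p₁ φ θ₂ θ₁) * R * B = R * (raiseOp N s p₁ p₂ φ θ₁ θ₂ * B) := by
        rw [← rGen_mul_raiseOp h, mul_assoc]
      rw [Matrix.mulVec_mulVec, mul_sub, ← mul_assoc, hE, Matrix.sub_mulVec,
        ← Matrix.mulVec_mulVec, ← mul_assoc, ← Matrix.mulVec_mulVec _ _ R,
        rGen_mulVec_cgVec h hn (by omega), ← Matrix.mulVec_mulVec _ _ B, hB, hB']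
      have e1 := raiseOp_affLeft_mulVec h hn
      have e2 := raiseOp_affRight_mulVec h hn
      have e3 := raiseOp_affLeft_mulVec h.symm hn
      have e4 := raiseOp_affRight_mulVec h.symm hn
      have key := rGen_mulVec_hwDev h hG hn
      rw [Matrix.add_mulVec, Matrix.mulVec_add, Matrix.smul_mulVec, Matrix.mulVec_smul, e1, e2,
        ← Matrix.mulVec_mulVec, Matrix.add_mulVec, Matrix.smul_mulVec, Matrix.mulVec_smul,
        Matrix.mulVec_smul, swapMat_mulVec_comp_swap, swapMat_mulVec_comp_swap]
      simp only [Matrix.mulVec_add, Matrix.mulVec_smul, swapMat_mulVec_comp_swap]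
      rw [e3, e4]
      simp only [Matrix.mulVec_sub, Matrix.mulVec_smul]
      rw [rGen_mulVec_cgVec h hn (by omega), add_comm p₂ p₁]
      ext a
      have k := congrFun key a
      simp only [Pi.add_apply, Pi.sub_apply, Pi.smul_apply, Function.comp, smul_eq_mul,
        Pi.zero_apply] at k ⊢
      rw [← hRdef] at k
      -- The scalar parts cancel: both sides carry x `hwExpect` for (p₁, p₂) plus `hwExpect` for
      -- (p₂, p₁). Only the deviations remain.
      linear_combination (qn 2 / qn (2 * (p₁ + p₂ - n + 1))) * k
    have hpair : ∀ n' < N, ∀ z < N, cgVec N s p₂ p₁ φ θ₂ θ₁ n' z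
        ⬝ᵥ ((R * B - B' * R).mulVec (cgVec N s p₁ p₂ φ θ₁ θ₂ n 0) ∘ Prod.swap) = 0 := by
      intro n' hn' z hz
      rw [← comp_swap_dotProduct_comp_swap]
      set v := (R * B - B' * R).mulVec (cgVec N s p₁ p₂ φ θ₁ θ₂ n 0) with hv
      change (cgVec N s p₂ p₁ φ θ₂ θ₁ n' z ∘ Prod.swap) ⬝ᵥ v = 0
      rcases z with _ | z
      · have hRT : R.transpose.mulVec (cgVec N s p₂ p₁ φ θ₂ θ₁ n' 0 ∘ Prod.swap)
            = G n' • cgVec N s p₁ p₂ φ θ₁ θ₂ n' 0 := by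
          rw [hRdef, rGen_transpose, swapMat_mulVec_comp_swap,
            rGen_mulVec_cgVec h.symm hn' (by omega)]
          rfl
        rw [hv, Matrix.sub_mulVec, dotProduct_sub, ← Matrix.mulVec_mulVec, dotProduct_mulVec_eq,
          hRT, dotProduct_mulVec_eq, ← Matrix.mulVec_mulVec, hRdef,
          rGen_mulVec_cgVec h hn (by omega), dotProduct_mulVec_eq, hB, hB']
        simp only [Matrix.transpose_add, Matrix.transpose_smul, Matrix.add_mulVec,
          Matrix.smul_mulVec, Matrix.mulVec_smul, swapMat_transpose, swapMat_mulVec_comp_swap]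
        rcases n' with _ | l
        · rw [(aff_transpose_mulVec_cgVec_zero h.two_le h.coprime h.sq_phi).1,
            (aff_transpose_mulVec_cgVec_zero h.two_le h.coprime h.sq_phi).2,
            (aff_transpose_mulVec_cgVec_zero h.two_le h.coprime h.sq_phi).1,
            (aff_transpose_mulVec_cgVec_zero h.two_le h.coprime h.sq_phi).2]
          simp
        · rw [affLeft_transpose_mulVec_cgVec h.two_le h.coprime h.sq_phi hn',
            affRight_transpose_mulVec_cgVec h.two_le h.coprime h.sq_phi hn',
            affLeft_transpose_mulVec_cgVec h.two_le h.coprime h.sq_phi hn',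
            affRight_transpose_mulVec_cgVec h.two_le h.coprime h.sq_phi hn', add_comm p₂ p₁]
          have c : ∀ (c : ℂ) (w : Fin N × Fin N → ℂ),
            (c • w) ∘ Prod.swap = c • (w ∘ Prod.swap) := fun _ _ => rfl
          simp only [c, dotProduct_smul, smul_dotProduct, add_dotProduct, smul_eq_mul]
          rw [comp_swap_dotProduct_comp_swap]
          -- By weight only the highest weight vector of the component n + 1 can pair with the image
          -- of v_n. The norms for the two orders of the factors agree, which leaves the recursion.
          by_cases hl : l = n
          · subst hl
            have d1 := cgVec_dotProduct h.two_le h.coprime h.sq_phi h.sq_left h.sq_right h.generic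
              hn hn (show 0 < N by omega) (show 0 < N by omega)
            have d2 := cgVec_dotProduct h.two_le h.coprime h.sq_phi h.sq_right h.sq_left
              h.symm.generic hn hn (show 0 < N by omega) (show 0 < N by omega)
            rw [add_comm p₂ p₁, ← d1] at d2
            have d3 := mul_left_cancel₀
              (cgNorm_ne_zero h.two_le h.coprime h.generic hn (show 0 < N by omega)) d2
            rw [d3, show (l : ℂ) - (p₁ + p₂) = -(p₁ + p₂ - l) by ring]
            linear_combination (cgVec N s p₁ p₂ φ θ₁ θ₂ l 0 ⬝ᵥ cgVec N s p₁ p₂ φ θ₁ θ₂ l 0)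
              * hG l hn'
          · rw [cgVec_dotProduct_of_ne _ _ _ _ (by omega),
              cgVec_dotProduct_of_ne _ _ _ _ (by omega)]
            ring
      · have hl := lowerOp_mulVec_swap h hn' z
        have h1 : qn ((z : ℂ) + 1) ≠ 0 := qNum_succ_ne_zero h.two_le h.coprime hz
        have h2 : qn ((z : ℂ) + 1) * ((cgVec N s p₂ p₁ φ θ₂ θ₁ n' (z + 1) ∘ Prod.swap) ⬝ᵥ v) = 0 := by
          rw [← smul_eq_mul, ← smul_dotProduct, ← hl, ← raiseOp_transpose, ← swapMat_transpose,
            ← dotProduct_mulVec_eq, hraise, dotProduct_zero]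
        exact (mul_eq_zero.mp h2).resolve_left h1
    have h0 := eq_zero_of_dotProduct_cgVec_eq_zero h.two_le h.coprime h.sq_phi h.sq_right h.sq_left
      h.symm.generic hpair
    ext a
    exact congrFun h0 a.swap
  refine eq_of_mulVec_cgVec_eq h.two_le h.coprime h.sq_phi h.sq_left h.sq_right h.generic
    fun n hn z hz => ?_
  rw [Matrix.zero_mulVec]
  induction z with
  | zero => exact hQ0 n hn
  | succ z ih =>
    have h1 : qn ((z : ℂ) + 1) ≠ 0 := qNum_succ_ne_zero h.two_le h.coprime hz
    have h2 := congrArg (fun M => Matrix.mulVec M (cgVec N s p₁ p₂ φ θ₁ θ₂ n z)) hQF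
    simp only [← Matrix.mulVec_mulVec] at h2
    rw [ih (by omega), Matrix.mulVec_zero,
      lowerOp_mulVec_cgVec h.two_le h.coprime h.sq_left h.sq_right hn, Matrix.mulVec_smul] at h2
    exact (smul_eq_zero.mp h2).resolve_left h1

theorem rGen_mul_aff_transpose {x : ℂ}
    (hG : ∀ n : ℕ, n + 1 < N → θ₁ n * θ₂ n
      * (G (n + 1) * (ε (p₁ + p₂ - n) - x * ε (-(p₁ + p₂ - n)))
        - G n * (x * ε (p₁ + p₂ - n) - ε (-(p₁ + p₂ - n)))) = 0) :
    rGen N s p₁ p₂ φ θ₁ θ₂ G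
        * ((affLeft N s p₂ φ θ₁).transpose + x • (affRight N s p₁ φ θ₂).transpose)
      = ((swapMat (affRight N s p₂ φ θ₁)).transpose
          + x • (swapMat (affLeft N s p₁ φ θ₂)).transpose) * rGen N s p₁ p₂ φ θ₁ θ₂ G := by
  have h1 := congrArg Matrix.transpose (rGen_mul_aff (G := G) (x := x) h.symm (by
    intro n hn; rw [add_comm p₂ p₁, mul_comm (θ₂ n)]; exact hG n hn))
  rw [Matrix.transpose_mul, Matrix.transpose_mul, rGen_transpose] at h1
  have h2 := congrArg swapMat h1
  rw [swapMat_mul, swapMat_mul, swapMat_swapMat] at h2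
  simp only [Matrix.transpose_add, Matrix.transpose_smul, swapMat_transpose] at h2 ⊢
  have c : ∀ A B : Matrix (Fin N × Fin N) (Fin N × Fin N) ℂ,
    swapMat (A + B) = swapMat A + swapMat B := fun _ _ => rfl
  have c' : ∀ (c : ℂ) (B : Matrix (Fin N × Fin N) (Fin N × Fin N) ℂ),
    swapMat (c • B) = c • swapMat B := fun _ _ => rfl
  simp only [c, c', swapMat_swapMat] at h2
  rw [add_comm, ← h2, add_comm]

omit h in
/-- Conservation of the weight. -/
theorem rGen_apply_of_ne {a b : Fin N × Fin N} (hab : (a.1 : ℕ) + a.2 ≠ b.1 + b.2) :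
    rGen N s p₁ p₂ φ θ₁ θ₂ G a b = 0 := by
  refine Finset.sum_eq_zero fun m _ => ?_
  simp only [cgVec, Prod.fst_swap, Prod.snd_swap]
  split_ifs with h1 h2
  · omega
  all_goals simp

end RGen

/-! ### From the explicit matrices to the operators on components -/

section Link

variable {N : ℕ} {s : ℤ} {r : ℂ → ℂ}

local notation "ε" => epsPow N s
local notation "qn" => qNum N s

/-- The set S may be smaller than the color range as long as every omitted summand contains a
vanishing root product. This treats the color and the spin ranges together. -/
theorem cgExpr_eq {S : Finset ℕ} {μ₁ μ₂ : ℂ} {n : ℕ} {b : Fin N × Fin N}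
    (hS : S ⊆ Finset.Icc (n - (b.2 : ℕ)) (min n b.1))
    (hS' : ∀ ν ∈ Finset.Icc (n - (b.2 : ℕ)) (min n b.1), ν ∉ S →
      rootFalling r (2 * μ₁ - (b.1 : ℕ)) (n - ν) * rootFalling r (2 * μ₂ - (b.2 : ℕ)) ν = 0)
    (z : ℕ) :
    cgExpr N s r S μ₁ μ₂ n b.1 b.2 z
      = r (2 * μ₁ + 2 * μ₂ - 2 * n + 1) * rootFact r n * rootFact r z
          / rootFalling r (2 * μ₁ + 2 * μ₂ - n + 1) (n + z + 1)
        * cgVec N s μ₁ μ₂ (fun k => r (k + 1)) (fun k => r (2 * μ₁ - k))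
          (fun k => r (2 * μ₂ - k)) n z b := by
  obtain ⟨⟨b₁, hb₁⟩, ⟨b₂, hb₂⟩⟩ := b
  simp only at hS hS' ⊢
  rw [cgExpr, cgVec]
  simp only
  by_cases hw : b₁ + b₂ = n + z
  · rw [if_pos hw, if_pos (by omega), cgVal, cgSum, hw]
    have hsum : ∑ ν ∈ S,
          ((-1) ^ ν * ε (-(ν : ℂ) * (2 * μ₁ + 2 * μ₂ - n + 1))
              / (qFact N s ν * qFact N s (n - ν) * qFact N s (b₁ - ν) * qFact N s (b₂ + ν - n)))
            * (rootFalling r (2 * μ₁ - n) (b₁ - ν) * rootFalling r (2 * μ₁ - b₁) (n - ν)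
                * rootFalling r (2 * μ₂ - n) (b₂ + ν - n) * rootFalling r (2 * μ₂ - b₂) ν
              / rootFalling r (2 * μ₁ + 2 * μ₂ - n + 1) (n + z + 1))
        = (∑ ij ∈ Finset.HasAntidiagonal.antidiagonal n, cgTerm N s μ₁ μ₂ (fun k => r (2 * μ₁ - k))
            (fun k => r (2 * μ₂ - k)) n b₁ b₂ ij.1 ij.2)
          / rootFalling r (2 * μ₁ + 2 * μ₂ - n + 1) (n + z + 1) := by
      rw [Finset.sum_subset hS (fun ν hν hνS => by
        have := hS' ν hν hνS
        rw [show rootFalling r (2 * μ₁ - n) (b₁ - ν) * rootFalling r (2 * μ₁ - b₁) (n - ν)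
                * rootFalling r (2 * μ₂ - n) (b₂ + ν - n) * rootFalling r (2 * μ₂ - b₂) ν
              = rootFalling r (2 * μ₁ - n) (b₁ - ν) * rootFalling r (2 * μ₂ - n) (b₂ + ν - n)
                * (rootFalling r (2 * μ₁ - b₁) (n - ν) * rootFalling r (2 * μ₂ - b₂) ν) by ring,
          this]
        simp),
        Finset.Nat.sum_antidiagonal_eq_sum_range_succ (fun i j => cgTerm N s μ₁ μ₂
          (fun k => r (2 * μ₁ - k)) (fun k => r (2 * μ₂ - k)) n b₁ b₂ i j), Finset.sum_div]
      refine Finset.sum_subset_zero_on_sdiff (fun ν hν => ?_) (fun ν hν => ?_) (fun ν hν => ?_)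
      · simp only [Finset.mem_Icc, Finset.mem_range] at hν ⊢; omega
      · simp only [Finset.mem_sdiff, Finset.mem_Icc, Finset.mem_range] at hν
        rw [cgTerm, invFactSub, invFactSub]
        by_cases h : ν ≤ b₁
        · rw [if_neg (show ¬ (n - ν ≤ b₂) by omega)]; simp
        · rw [if_neg h]; simp
      · simp only [Finset.mem_Icc] at hν
        rw [cgTerm, invFactSub, invFactSub, if_pos (by omega), if_pos (by omega), thetaProd,
          thetaProd, show b₂ - (n - ν) = b₂ + ν - n by omega]
        simp only [rootFalling, Nat.cast_add, sub_sub]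
        ring
    rw [hsum]
    simp only [rootFact]
    ring
  · rw [if_neg hw, if_neg (by omega), mul_zero]

theorem gCoeff_succ (p₁ p₂ : ℂ) (n : ℕ) (u : ℂ) : gCoeff N s p₁ p₂ (n + 1) u
    = -gCoeff N s p₁ p₂ n u * (qn (u - p₁ - p₂ + n) / qn (u + p₁ + p₂ - n)) := by
  rw [gCoeff, gCoeff, Finset.prod_range_succ, pow_succ]; ring

/-- After extracting ε^(-u), the two brackets are multiples of [u + P - n] and [u - P + n], the
denominator and the numerator of the new factor of g. -/
theorem gCoeff_recursion (hN : 2 ≤ N) (hs : IsCoprime s (N : ℤ)) {p₁ p₂ u : ℂ} {n : ℕ}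
    (hu : qn (u + p₁ + p₂ - n) ≠ 0) :
    gCoeff N s p₁ p₂ (n + 1) u * (ε (p₁ + p₂ - n) - ε (-2 * u) * ε (-(p₁ + p₂ - n)))
      - gCoeff N s p₁ p₂ n u * (ε (-2 * u) * ε (p₁ + p₂ - n) - ε (-(p₁ + p₂ - n))) = 0 := by
  have h1 := qNum_mul_den hN hs (u + p₁ + p₂ - n)
  have h2 := qNum_mul_den hN hs (u - p₁ - p₂ + n)
  have h3 : gCoeff N s p₁ p₂ (n + 1) u * qn (u + p₁ + p₂ - n)
      = -gCoeff N s p₁ p₂ n u * qn (u - p₁ - p₂ + n) := by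
    rw [gCoeff_succ, mul_assoc, div_mul_cancel₀ _ hu]
  have e1 : ε (p₁ + p₂ - n) = ε (-u) * ε (u + p₁ + p₂ - n) := by rw [← eps_add]; congr 1; ring
  have e2 : ε (-2 * u) * ε (-(p₁ + p₂ - n)) = ε (-u) * ε (-(u + p₁ + p₂ - n)) := by
    rw [← eps_add, ← eps_add]; congr 1; ring
  have e3 : ε (-2 * u) * ε (p₁ + p₂ - n) = ε (-u) * ε (-(u - p₁ - p₂ + n)) := by
    rw [← eps_add, ← eps_add]; congr 1; ring
  have e4 : ε (-(p₁ + p₂ - n)) = ε (-u) * ε (u - p₁ - p₂ + n) := by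
    rw [← eps_add]; congr 1; ring
  rw [e2, e3, e4, e1]
  linear_combination (-ε (-u) * gCoeff N s p₁ p₂ (n + 1) u) * h1
    - (ε (-u) * gCoeff N s p₁ p₂ n u) * h2 + ε (-u) * (ε 1 - ε (-1)) * h3

theorem rootData (hN : 2 ≤ N) (hs : IsCoprime s (N : ℤ)) (hr : IsRootChoice N s r) {p₁ p₂ : ℂ}
    (hP : ∀ k : ℤ, qn (2 * p₁ + 2 * p₂ + k) ≠ 0) :
    RootData N s p₁ p₂ (fun k => r (k + 1)) (fun k => r (2 * p₁ - k)) (fun k => r (2 * p₂ - k)) :=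
  ⟨hN, hs, fun _ => hr _, fun _ => hr _, fun _ => hr _, fun k => by rw [mul_add]; exact hP k⟩

/-- The prefactors of the two Clebsch-Gordan coefficients depend on p₁ + p₂ only, hence are equal,
and their product is free of roots. -/
theorem cgNorm_eq_roots (hr : IsRootChoice N s r) (p₁ p₂ : ℂ) (n z : ℕ) :
    (r (2 * p₁ + 2 * p₂ - 2 * n + 1) * rootFact r n * rootFact r z
          / rootFalling r (2 * p₁ + 2 * p₂ - n + 1) (n + z + 1))
      * (r (2 * p₂ + 2 * p₁ - 2 * n + 1) * rootFact r n * rootFact r z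
          / rootFalling r (2 * p₂ + 2 * p₁ - n + 1) (n + z + 1))
      = cgNorm N s (p₁ + p₂) n z := by
  rw [add_comm (2 * p₂), ← sq, div_pow, mul_pow, mul_pow, hr, rootFact_sq hr, rootFact_sq hr,
    rootFalling_sq hr, cgNorm, mul_add]

theorem rColor_eq (hr : IsRootChoice N s r) (p₁ p₂ u : ℂ) :
    rColor N s r p₁ p₂ u = rGen N s p₁ p₂ (fun k => r (k + 1)) (fun k => r (2 * p₁ - k))
      (fun k => r (2 * p₂ - k)) (fun n => gCoeff N s p₁ p₂ n u) := by
  ext a b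
  simp only [rColor, rGen, Matrix.of_apply, ← cgNorm_eq_roots hr, cgColorColor]
  rw [Finset.sum_range, Fintype.sum_prod_type]
  refine Finset.sum_congr rfl fun n _ => ?_
  rw [Finset.sum_range]
  refine Finset.sum_congr rfl fun z _ => ?_
  have h2 := cgExpr_eq (s := s) (r := r) (μ₁ := p₂) (μ₂ := p₁) (n := n) (b := a.swap) subset_rfl
    (fun ν h h' => absurd h h') z
  simp only [Prod.fst_swap, Prod.snd_swap] at h2
  rw [cgExpr_eq subset_rfl (fun ν h h' => absurd h h') _, h2]
  ring

/-- Restriction to the first `m + 1` basis vectors of the second factor. -/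
def truncIdx {N m : ℕ} (hm : m + 1 ≤ N) (a : Fin N × Fin (m + 1)) : Fin N × Fin N :=
  (a.1, Fin.castLE hm a.2)

theorem rootFalling_eq_zero (hr : IsRootChoice N s r) {m b ν : ℕ} (hb : b ≤ m) (hν : m - b < ν) :
    rootFalling r (2 * ((m : ℂ) / 2) - b) ν = 0 := by
  refine Finset.prod_eq_zero (Finset.mem_range.mpr hν) ?_
  rw [Nat.cast_sub hb, show 2 * ((m : ℂ) / 2) - b - (m - b) = 0 by ring]
  exact pow_eq_zero_iff two_ne_zero |>.mp ((hr 0).trans qNum_zero)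

/-- The spin module is the span of the first m + 1 basis vectors in the module of dimension N with
parameter m/2. The extra bounds on ν only drop summands containing a root of [0], and the sum over n
≤ m is a cutoff of the scalars. -/
theorem rMixed_eq (hr : IsRootChoice N s r) (p₁ : ℂ) {m : ℕ} (hm : m + 1 ≤ N) (u : ℂ) :
    rMixed N s r p₁ m u = (rGen N s p₁ ((m : ℂ) / 2) (fun k => r (k + 1)) (fun k => r (2 * p₁ - k))
      (fun k => r (2 * ((m : ℂ) / 2) - k))
      (fun n => if n ≤ m then gCoeff N s p₁ ((m : ℂ) / 2) n u else 0)).submatrix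
        (truncIdx hm) (truncIdx hm) := by
  ext a b
  simp only [rMixed, rGen, Matrix.of_apply, ← cgNorm_eq_roots hr, cgColorSpin, cgSpinColor,
    Matrix.submatrix_apply]
  rw [Fintype.sum_prod_type]
  have e : ∀ f : ℕ → ℂ, ∑ n ∈ Finset.range (m + 1), f n
      = ∑ n : Fin N, if (n : ℕ) ≤ m then f n else 0 := by
    intro f
    rw [Fin.sum_univ_eq_sum_range (fun n => if n ≤ m then f n else 0) N,
      ← Finset.sum_filter]
    refine Finset.sum_congr (Finset.ext fun n => ?_) fun _ _ => rfl
    simp only [Finset.mem_filter, Finset.mem_range]; omega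
  rw [e]
  refine Finset.sum_congr rfl fun n _ => ?_
  split_ifs with hn
  · rw [Finset.sum_range]
    refine Finset.sum_congr rfl fun z _ => ?_
    have h1 := cgExpr_eq (s := s) (r := r) (b := truncIdx hm b)
      (S := Finset.Icc ((n : ℕ) - b.2) (min (min (n : ℕ) b.1) (m - b.2))) (μ₁ := p₁)
      (μ₂ := (m : ℂ) / 2) (n := n) (fun ν hν => by
        simp only [Finset.mem_Icc, truncIdx, Fin.val_castLE] at hν ⊢; omega) (fun ν h h' => by
        rw [show ((truncIdx hm b).2 : ℕ) = b.2 from rfl,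
          rootFalling_eq_zero hr (by omega) (by
            simp only [Finset.mem_Icc, truncIdx, Fin.val_castLE] at h h'; omega), mul_zero]) z
    have h2 := cgExpr_eq (s := s) (r := r) (b := (truncIdx hm a).swap)
      (S := Finset.Icc (max ((n : ℕ) - a.1) ((n : ℕ) + a.2 - m)) (min (n : ℕ) a.2))
      (μ₁ := (m : ℂ) / 2)
      (μ₂ := p₁) (n := n) (fun ν hν => by
        simp only [Finset.mem_Icc, truncIdx, Fin.val_castLE, Prod.swap] at hν ⊢; omega)
        (fun ν h h' => by
        rw [show ((truncIdx hm a).swap.1 : ℕ) = a.2 from rfl,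
          rootFalling_eq_zero hr (by omega) (by
            simp only [Finset.mem_Icc, truncIdx, Fin.val_castLE, Prod.swap] at h h'; omega),
          zero_mul]) z
    simp only [truncIdx, Fin.val_castLE, Prod.swap] at h1 h2 ⊢
    rw [h1, h2]
    ring
  · simp

theorem rGen_zero_zero (hN : 2 ≤ N) {p₁ p₂ : ℂ} {φ θ₁ θ₂ : ℕ → ℂ}
    (hP : ∀ k : ℤ, qn (2 * (p₁ + p₂) + k) ≠ 0) (G : ℕ → ℂ) :
    rGen N s p₁ p₂ φ θ₁ θ₂ G (⟨0, two_pos.trans_le hN⟩, ⟨0, two_pos.trans_le hN⟩)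
      (⟨0, two_pos.trans_le hN⟩, ⟨0, two_pos.trans_le hN⟩) = G 0 := by
  rw [rGen, Matrix.of_apply, Finset.sum_eq_single
    (⟨0, two_pos.trans_le hN⟩, ⟨0, two_pos.trans_le hN⟩)]
  · have h1 : qn (2 * (p₁ + p₂) + 1) ≠ 0 := qNum_ne_zero_of_eq hP 1 (by push_cast; ring)
    have h2 : cgNorm N s (p₁ + p₂) 0 0 = 1 := by
      simp [cgNorm, qFalling, h1]
    have h3 : ∀ (p₁ p₂ : ℂ) (θ₁ θ₂ : ℕ → ℂ), cgVal N s p₁ p₂ φ θ₁ θ₂ 0 0 0 = 1 := by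
      intro p₁ p₂ θ₁ θ₂
      simp [cgVal, cgSum, cgTerm, invFactSub, thetaProd]
    simp [cgVec, h2, h3]
  · rintro ⟨⟨n, hn⟩, ⟨z, hz⟩⟩ _ hne
    have : ¬ (0 + 0 = n + z) := by
      intro h
      exact hne (Prod.ext (Fin.ext (by simp only; omega)) (Fin.ext (by simp only; omega)))
    simp only [cgVec, if_neg this, mul_zero]
  · simp

/-! ### The defining relations -/

theorem repXp_eq (μ : ℂ) (d : ℕ) :
    repXp r μ d = raiseMat (fun k => r (2 * μ - k)) (fun k => r (k + 1)) d := rfl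

theorem repXm_eq (μ : ℂ) (d : ℕ) : repXm r μ d
    = (raiseMat (fun k => r (2 * μ - k)) (fun k => r (k + 1)) d).transpose := by
  ext a b
  simp only [repXm, raiseMat, Matrix.of_apply, Matrix.transpose_apply]
  by_cases h : (a : ℕ) = b + 1
  · rw [if_pos h, if_pos h.symm, h]; push_cast; congr 2; ring
  · rw [if_neg h, if_neg fun h' => h h'.symm]

theorem repQH_half (μ : ℂ) (d : ℕ) : repQH N s (1 / 2) μ d = torusMat N s μ d := by
  rw [repQH, torusMat]; congr 1; ext a; congr 1; ring

theorem repQH_neg_half (μ : ℂ) (d : ℕ) : repQH N s (-1 / 2) μ d = torusInv N s μ d := by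
  rw [repQH, torusInv]; congr 1; ext a; congr 1; ring

/-- The relations for an `R`-matrix of the affine algebra in terms of the matrices `X`, `K`, `L` of
`X⁺`, `ε ^ (H / 2)` and `ε ^ (-H / 2)`. -/
def AffineRel {m n : Type*} [Fintype m] [Fintype n] (X₁ K₁ L₁ : Matrix m m ℂ)
    (X₂ K₂ L₂ : Matrix n n ℂ) (x : ℂ) (T : Matrix (m × n) (m × n) ℂ) : Prop :=
  T * (K₁ ⊗ₖ K₂) = K₁ ⊗ₖ K₂ * T ∧ T * (L₁ ⊗ₖ L₂) = L₁ ⊗ₖ L₂ * T ∧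
    T * (X₁ ⊗ₖ K₂ + L₁ ⊗ₖ X₂) = (X₁ ⊗ₖ L₂ + K₁ ⊗ₖ X₂) * T ∧
    T * (X₁.transpose ⊗ₖ K₂ + L₁ ⊗ₖ X₂.transpose)
      = (X₁.transpose ⊗ₖ L₂ + K₁ ⊗ₖ X₂.transpose) * T ∧
    T * (x • X₁.transpose ⊗ₖ L₂ + K₁ ⊗ₖ X₂.transpose)
      = (x • X₁.transpose ⊗ₖ K₂ + L₁ ⊗ₖ X₂.transpose) * T ∧
    T * (X₁ ⊗ₖ L₂ + x • K₁ ⊗ₖ X₂) = (X₁ ⊗ₖ K₂ + x • L₁ ⊗ₖ X₂) * T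

/-- The defining relations of an `R`-matrix, with the inverse spectral parameter removed. -/
theorem isRMatrix_iff {μ₁ μ₂ x : ℂ} {d₁ d₂ : ℕ} (hx : x ≠ 0)
    (T : Matrix (Fin d₁ × Fin d₂) (Fin d₁ × Fin d₂) ℂ) :
    IsRMatrix N s r μ₁ d₁ μ₂ d₂ x T ↔
      AffineRel (raiseMat (fun k => r (2 * μ₁ - k)) (fun k => r (k + 1)) d₁) (torusMat N s μ₁ d₁)
        (torusInv N s μ₁ d₁) (raiseMat (fun k => r (2 * μ₂ - k)) (fun k => r (k + 1)) d₂)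
        (torusMat N s μ₂ d₂) (torusInv N s μ₂ d₂) x T := by
  unfold AffineRel
  set X₁ := raiseMat (fun k => r (2 * μ₁ - k)) (fun k => r (k + 1)) d₁ with hX₁
  set X₂ := raiseMat (fun k => r (2 * μ₂ - k)) (fun k => r (k + 1)) d₂ with hX₂
  set K₁ := torusMat N s μ₁ d₁ with hK₁
  set K₂ := torusMat N s μ₂ d₂ with hK₂
  set L₁ := torusInv N s μ₁ d₁ with hL₁
  set L₂ := torusInv N s μ₂ d₂ with hL₂
  -- Multiplying the X₀⁻ relation by x makes it polynomial in x, which the scaling argument for the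
  -- Yang-Baxter equation needs.
  have key : T * (x⁻¹ • X₁ ⊗ₖ L₂ + K₁ ⊗ₖ X₂) = (x⁻¹ • X₁ ⊗ₖ K₂ + L₁ ⊗ₖ X₂) * T ↔
      T * (X₁ ⊗ₖ L₂ + x • K₁ ⊗ₖ X₂) = (X₁ ⊗ₖ K₂ + x • L₁ ⊗ₖ X₂) * T := by
    have e : ∀ A B : Matrix (Fin d₁ × Fin d₂) (Fin d₁ × Fin d₂) ℂ,
        A + x • B = x • (x⁻¹ • A + B) := by
      intro A B
      rw [smul_add, smul_smul, mul_inv_cancel₀ hx, one_smul]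
    rw [e, e, mul_smul_comm, smul_mul_assoc]
    exact (smul_right_injective _ hx).eq_iff.symm
  rw [← key]
  have n1 : -(1 / 2 : ℂ) = -1 / 2 := by ring
  have n2 : -(-1 / 2 : ℂ) = 1 / 2 := by ring
  constructor
  · rintro ⟨h1, h2, h3⟩
    have c0 := h1 0
    have c1 := h1 1
    have r0 := h2 0
    have r1 := h2 1
    have l0 := h3 0
    have l1 := h3 1
    simp only [hatXp, hatXm, hatQH, Fin.isValue, if_true, one_ne_zero, if_false, repXp_eq, repXm_eq,
      n1, n2, repQH_half, repQH_neg_half, one_smul,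
      ← hX₁, ← hX₂, ← hK₁, ← hK₂, ← hL₁, ← hL₂] at c0 c1 r0 r1 l0 l1
    exact ⟨c1, c0, r1, l1, r0, l0⟩
  · rintro ⟨c1, c0, r1, l1, r0, l0⟩
    refine ⟨fun i => ?_, fun i => ?_, fun i => ?_⟩ <;> fin_cases i <;>
    simpa only [hatXp, hatXm, hatQH, Fin.isValue, Fin.mk_zero, Fin.mk_one, Fin.zero_eta, if_true,
      one_ne_zero, if_false, repXp_eq, repXm_eq, n1, n2, repQH_half, repQH_neg_half,
      one_smul, ← hX₁, ← hX₂, ← hK₁, ← hK₂, ← hL₁, ← hL₂]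

theorem mul_kronecker_torus_of_weight {μ₁ μ₂ : ℂ} {d₁ d₂ : ℕ}
    {T : Matrix (Fin d₁ × Fin d₂) (Fin d₁ × Fin d₂) ℂ}
    (hT : ∀ a b : Fin d₁ × Fin d₂, (a.1 : ℕ) + a.2 ≠ b.1 + b.2 → T a b = 0) :
    T * (torusMat N s μ₁ d₁ ⊗ₖ torusMat N s μ₂ d₂) = torusMat N s μ₁ d₁ ⊗ₖ torusMat N s μ₂ d₂ * T ∧
      T * (torusInv N s μ₁ d₁ ⊗ₖ torusInv N s μ₂ d₂)
        = torusInv N s μ₁ d₁ ⊗ₖ torusInv N s μ₂ d₂ * T := by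
  constructor
  all_goals
    ext a b
    simp only [torusMat, torusInv, Matrix.diagonal_kronecker_diagonal, Matrix.mul_diagonal,
      Matrix.diagonal_mul, ← eps_add]
    by_cases h : (a.1 : ℕ) + a.2 = b.1 + b.2
    · rw [mul_comm]
      congr 2
      have : ((a.1 : ℕ) : ℂ) + (a.2 : ℕ) = (b.1 : ℕ) + (b.2 : ℕ) := by exact_mod_cast h
      first | linear_combination this | linear_combination -this
    · rw [hT a b h, mul_zero, zero_mul]

theorem affineRel_rGen {p₁ p₂ x : ℂ} {φ θ₁ θ₂ : ℕ → ℂ} (h : RootData N s p₁ p₂ φ θ₁ θ₂)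
    {G : ℕ → ℂ} (hG : ∀ n : ℕ, n + 1 < N → θ₁ n * θ₂ n
      * (G (n + 1) * (ε (p₁ + p₂ - n) - x * ε (-(p₁ + p₂ - n)))
        - G n * (x * ε (p₁ + p₂ - n) - ε (-(p₁ + p₂ - n)))) = 0) :
    AffineRel (raiseMat θ₁ φ N) (torusMat N s p₁ N) (torusInv N s p₁ N) (raiseMat θ₂ φ N)
      (torusMat N s p₂ N) (torusInv N s p₂ N) x (rGen N s p₁ p₂ φ θ₁ θ₂ G) := by
  have w := mul_kronecker_torus_of_weight (N := N) (s := s) (μ₁ := p₁) (μ₂ := p₂)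
    (T := rGen N s p₁ p₂ φ θ₁ θ₂ G) (fun _ _ => rGen_apply_of_ne)
  refine ⟨w.1, w.2, ?_, ?_, ?_, ?_⟩
  · have e := rGen_mul_raiseOp (G := G) h
    simp only [raiseOp] at e
    refine e.trans ?_
    rw [show ∀ A B : Matrix (Fin N × Fin N) (Fin N × Fin N) ℂ,
      swapMat (A + B) = swapMat A + swapMat B from fun _ _ => rfl, swapMat_kronecker,
      swapMat_kronecker, add_comm]
  · have e := rGen_mul_lowerOp (G := G) h
    simp only [lowerOp] at e
    refine e.trans ?_
    rw [show ∀ A B : Matrix (Fin N × Fin N) (Fin N × Fin N) ℂ,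
      swapMat (A + B) = swapMat A + swapMat B from fun _ _ => rfl, swapMat_kronecker,
      swapMat_kronecker, add_comm]
  · have e := rGen_mul_aff (G := G) h hG
    simp only [affLeft, affRight, swapMat_kronecker] at e
    exact e
  · have e := rGen_mul_aff_transpose (G := G) h hG
    simp only [affLeft, affRight, swapMat_kronecker, ← Matrix.kroneckerMap_transpose,
      Matrix.transpose_transpose, torusMat_transpose, torusInv_transpose] at e
    exact e

theorem isRMatrix_rGen (hN : 2 ≤ N) (hs : IsCoprime s (N : ℤ)) (hr : IsRootChoice N s r)
    {p₁ p₂ x : ℂ} (hx : x ≠ 0) (hP : ∀ k : ℤ, qn (2 * p₁ + 2 * p₂ + k) ≠ 0) {G : ℕ → ℂ}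
    (hG : ∀ n : ℕ, n + 1 < N → r (2 * p₁ - n) * r (2 * p₂ - n)
      * (G (n + 1) * (ε (p₁ + p₂ - n) - x * ε (-(p₁ + p₂ - n)))
        - G n * (x * ε (p₁ + p₂ - n) - ε (-(p₁ + p₂ - n)))) = 0) :
    IsRMatrix N s r p₁ N p₂ N x (rGen N s p₁ p₂ (fun k => r (k + 1)) (fun k => r (2 * p₁ - k))
      (fun k => r (2 * p₂ - k)) G) := by
  rw [isRMatrix_iff hx]
  exact affineRel_rGen (rootData hN hs hr hP) hG

theorem isRMatrix_rColor (hN : 2 ≤ N) (hs : IsCoprime s (N : ℤ)) (hr : IsRootChoice N s r)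
    {p₁ p₂ u : ℂ} (hg : Generic N s p₁ p₂ u) :
    IsRMatrix N s r p₁ N p₂ N (ε (-2 * u)) (rColor N s r p₁ p₂ u) := by
  rw [rColor_eq hr]
  exact isRMatrix_rGen hN hs hr (eps_ne_zero _) hg.1 fun n hn =>
    mul_eq_zero_of_right _ (gCoeff_recursion hN hs (hg.2 n hn))

/-! ### Restriction of the second factor to a spin module -/

/-- The matrix `M` preserves the decomposition of the indices into those `≤ m` and those `> m`. -/
def RespectsCut {N : ℕ} (m : ℕ) (M : Matrix (Fin N × Fin N) (Fin N × Fin N) ℂ) : Prop :=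
  ∀ a b : Fin N × Fin N, ((a.2 : ℕ) ≤ m ↔ ¬ (b.2 : ℕ) ≤ m) → M a b = 0

theorem RespectsCut.add {m : ℕ} {A B : Matrix (Fin N × Fin N) (Fin N × Fin N) ℂ}
    (hA : RespectsCut m A) (hB : RespectsCut m B) : RespectsCut m (A + B) := fun a b h => by
  rw [Matrix.add_apply, hA a b h, hB a b h, add_zero]

theorem RespectsCut.smul {m : ℕ} {A : Matrix (Fin N × Fin N) (Fin N × Fin N) ℂ}
    (hA : RespectsCut m A) (c : ℂ) : RespectsCut m (c • A) := fun a b h => by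
  rw [Matrix.smul_apply, hA a b h, smul_zero]

theorem respectsCut_kronecker_diagonal (m : ℕ) (A : Matrix (Fin N) (Fin N) ℂ) (f : Fin N → ℂ) :
    RespectsCut m (A ⊗ₖ Matrix.diagonal f) := fun a b h => by
  rw [Matrix.kroneckerMap_apply, Matrix.diagonal_apply_ne, mul_zero]
  intro h'
  rw [h'] at h
  exact (iff_not_self h)

theorem respectsCut_kronecker_raiseMat {m : ℕ} (A : Matrix (Fin N) (Fin N) ℂ) {φ θ : ℕ → ℂ}
    (hθ : θ m = 0) : RespectsCut m (A ⊗ₖ raiseMat θ φ N) := fun a b h => by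
  rw [Matrix.kroneckerMap_apply, raiseMat, Matrix.of_apply]
  split_ifs with h'
  · rw [show (a.2 : ℕ) = m by omega, hθ, zero_mul, mul_zero]
  · rw [mul_zero]

theorem respectsCut_kronecker_lowerMat {m : ℕ} (A : Matrix (Fin N) (Fin N) ℂ) {φ θ : ℕ → ℂ}
    (hθ : θ m = 0) : RespectsCut m (A ⊗ₖ (raiseMat θ φ N).transpose) := fun a b h => by
  rw [Matrix.kroneckerMap_apply, Matrix.transpose_apply, raiseMat, Matrix.of_apply]
  split_ifs with h'
  · rw [show (b.2 : ℕ) = m by omega, hθ, zero_mul, mul_zero]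
  · rw [mul_zero]

/-- Since A and A' are block diagonal, the intermediate index never leaves the block, whatever M
does. -/
theorem RespectsCut.submatrix_mul {m : ℕ} (hm : m + 1 ≤ N)
    {A M A' : Matrix (Fin N × Fin N) (Fin N × Fin N) ℂ}
    (hA : RespectsCut m A) (hA' : RespectsCut m A') (h : M * A = A' * M) :
    M.submatrix (truncIdx hm) (truncIdx hm) * A.submatrix (truncIdx hm) (truncIdx hm)
      = A'.submatrix (truncIdx hm) (truncIdx hm) * M.submatrix (truncIdx hm) (truncIdx hm) := by
  have inj : Function.Injective (truncIdx hm) := fun a b hab => by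
    simp only [truncIdx, Prod.mk.injEq] at hab
    exact Prod.ext hab.1 (Fin.castLE_injective hm hab.2)
  have key : ∀ f : Fin N × Fin N → ℂ, (∀ c, ¬ (c.2 : ℕ) ≤ m → f c = 0) →
      ∑ c, f (truncIdx hm c) = ∑ c, f c := by
    intro f hf
    rw [← Finset.sum_image (f := f) (s := Finset.univ) (g := truncIdx hm) (fun a _ b _ hab => inj hab)]
    refine Finset.sum_subset (Finset.subset_univ _) fun c _ hc => hf c fun hc' => hc ?_
    exact Finset.mem_image.mpr ⟨(c.1, ⟨c.2, by omega⟩), Finset.mem_univ _, rfl⟩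
  ext a b
  have h' := congrFun (congrFun h (truncIdx hm a)) (truncIdx hm b)
  simp only [Matrix.mul_apply, Matrix.submatrix_apply] at h' ⊢
  have ha : ((truncIdx hm a).2 : ℕ) ≤ m := by simp only [truncIdx, Fin.val_castLE]; omega
  have hb : ((truncIdx hm b).2 : ℕ) ≤ m := by simp only [truncIdx, Fin.val_castLE]; omega
  rw [key (fun c => M (truncIdx hm a) c * A c (truncIdx hm b)) fun c hc => by
      rw [hA c _ (by tauto), mul_zero],
    key (fun c => A' (truncIdx hm a) c * M c (truncIdx hm b)) fun c hc => by
      rw [hA' _ c (by tauto), zero_mul], h']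

theorem isRMatrix_rMixed (hN : 2 ≤ N) (hs : IsCoprime s (N : ℤ)) (hr : IsRootChoice N s r)
    {p₁ u : ℂ} {m : ℕ} (hm : m + 2 ≤ N) (hg : GenericMixed N s p₁ m u) :
    IsRMatrix N s r p₁ N ((m : ℂ) / 2) (m + 1) (ε (-2 * u)) (rMixed N s r p₁ m u) := by
  have hr0 : r (2 * ((m : ℂ) / 2) - m) = 0 := by
    rw [show 2 * ((m : ℂ) / 2) - m = 0 by ring]
    exact pow_eq_zero_iff two_ne_zero |>.mp ((hr 0).trans qNum_zero)
  have hP : ∀ k : ℤ, qn (2 * p₁ + 2 * ((m : ℂ) / 2) + k) ≠ 0 := fun k => by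
    have := hg.1 (m + k)
    push_cast at this
    rwa [show 2 * p₁ + 2 * ((m : ℂ) / 2) + k = 2 * p₁ + (m + k) by ring]
  have hR := isRMatrix_rGen hN hs hr (eps_ne_zero (-2 * u)) hP
    (G := fun n => if n ≤ m then gCoeff N s p₁ ((m : ℂ) / 2) n u else 0) (fun n hn => by
      -- Below m this is the recursion of g. At n = m, where G jumps to 0, the factor r (2 (m/2) -
      -- m) is a root of [0]. Above m both scalars are 0. So the condition on u is needed only for k
      -- < m.
      rcases lt_trichotomy n m with h | h | h
      · rw [if_pos (by omega), if_pos (by omega), gCoeff_recursion hN hs (hg.2 n h), mul_zero]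
      · rw [h, hr0, mul_zero, zero_mul]
      · rw [if_neg (by omega), if_neg (by omega)]; ring)
  rw [rMixed_eq hr p₁ (by omega : m + 1 ≤ N) u]
  rw [isRMatrix_iff (eps_ne_zero _)] at hR ⊢
  obtain ⟨h1, h2, h3, h4, h5, h6⟩ := hR
  have cut : ∀ A : Matrix (Fin N) (Fin N) ℂ,
      RespectsCut m (A ⊗ₖ torusMat N s ((m : ℂ) / 2) N) ∧
      RespectsCut m (A ⊗ₖ torusInv N s ((m : ℂ) / 2) N) ∧
      RespectsCut m (A ⊗ₖ raiseMat (fun k => r (2 * ((m : ℂ) / 2) - k)) (fun k => r (k + 1)) N) ∧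
      RespectsCut m (A ⊗ₖ
        (raiseMat (fun k => r (2 * ((m : ℂ) / 2) - k)) (fun k => r (k + 1)) N).transpose) :=
    fun A => ⟨respectsCut_kronecker_diagonal _ _ _, respectsCut_kronecker_diagonal _ _ _,
      respectsCut_kronecker_raiseMat _ hr0, respectsCut_kronecker_lowerMat _ hr0⟩
  have sub : ∀ (A : Matrix (Fin N) (Fin N) ℂ) (f : Fin N → ℂ), (A ⊗ₖ Matrix.diagonal f).submatrix
      (truncIdx (m := m) (by omega)) (truncIdx (by omega))
      = A ⊗ₖ (Matrix.diagonal fun a : Fin (m + 1) => f (Fin.castLE (by omega) a)) := by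
    intro A f
    ext a b
    simp only [Matrix.submatrix_apply, Matrix.kroneckerMap_apply, truncIdx, Matrix.diagonal_apply,
      (Fin.castLE_injective _).eq_iff]
  have sK : ∀ A : Matrix (Fin N) (Fin N) ℂ, (A ⊗ₖ torusMat N s ((m : ℂ) / 2) N).submatrix
      (truncIdx (m := m) (by omega)) (truncIdx (by omega))
      = A ⊗ₖ torusMat N s ((m : ℂ) / 2) (m + 1) := fun A => sub A _
  have sL : ∀ A : Matrix (Fin N) (Fin N) ℂ, (A ⊗ₖ torusInv N s ((m : ℂ) / 2) N).submatrix
      (truncIdx (m := m) (by omega)) (truncIdx (by omega))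
      = A ⊗ₖ torusInv N s ((m : ℂ) / 2) (m + 1) := fun A => sub A _
  refine ⟨?_, ?_, ?_, ?_, ?_, ?_⟩
  · have := RespectsCut.submatrix_mul (by omega) (cut _).1 (cut _).1 h1
    rwa [sK] at this
  · have := RespectsCut.submatrix_mul (by omega) (cut _).2.1 (cut _).2.1 h2
    rwa [sL] at this
  · have := RespectsCut.submatrix_mul (by omega) ((cut _).1.add (cut _).2.2.1)
      ((cut _).2.1.add (cut _).2.2.1) h3
    simp only [Matrix.submatrix_add, Pi.add_apply, sK, sL] at this
    exact this
  · have := RespectsCut.submatrix_mul (by omega) ((cut _).1.add (cut _).2.2.2)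
      ((cut _).2.1.add (cut _).2.2.2) h4
    simp only [Matrix.submatrix_add, Pi.add_apply, sK, sL] at this
    exact this
  · have := RespectsCut.submatrix_mul (by omega) (((cut _).2.1.smul _).add (cut _).2.2.2)
      (((cut _).1.smul _).add (cut _).2.2.2) h5
    simp only [Matrix.submatrix_add, Matrix.submatrix_smul, Pi.add_apply, Pi.smul_apply, sK, sL]
      at this
    exact this
  · have := RespectsCut.submatrix_mul (by omega) ((cut _).2.1.add ((cut _).2.2.1.smul _))
      ((cut _).1.add ((cut _).2.2.1.smul _)) h6
    simp only [Matrix.submatrix_add, Matrix.submatrix_smul, Pi.add_apply, Pi.smul_apply, sK, sL]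
      at this
    exact this

end Link

/-! ### Uniqueness -/

section Uniqueness

/-- A function on the basis vectors that vanishes at the highest weight vector and whose vanishing
is propagated by two independent raising operators vanishes. -/
theorem eq_zero_of_raising {V : Type*} [AddCommGroup V] [Module ℂ V] {d₁ d₂ : ℕ} 
    (hd : d₂ ≤ d₁) {F : ℕ → ℕ → V} {c₁ c₂ : ℕ → ℂ} {α β γ δ : ℕ → ℕ → ℂ}
    (hc₁ : ∀ a, a + 1 < d₁ → c₁ a ≠ 0) (hc₂ : ∀ a, a + 1 < d₂ → c₂ a ≠ 0)
    (hα : ∀ a b, α a b ≠ 0)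
    (hdet : ∀ a b, a + b + 2 ≤ d₂ → α a b * δ a b - β a b * γ a b ≠ 0)
    (h1 : ∀ a < d₁, ∀ b < d₂, F a b = 0 →
      ((if a + 1 < d₁ then c₁ a else 0) * α a b) • F (a + 1) b
        + ((if b + 1 < d₂ then c₂ b else 0) * β a b) • F a (b + 1) = 0)
    (h2 : ∀ a < d₁, ∀ b < d₂, F a b = 0 →
      ((if a + 1 < d₁ then c₁ a else 0) * γ a b) • F (a + 1) b
        + ((if b + 1 < d₂ then c₂ b else 0) * δ a b) • F a (b + 1) = 0)
    (h0 : F 0 0 = 0) : ∀ a < d₁, ∀ b < d₂, F a b = 0 := by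
  have key : ∀ w a b, a + b = w → a < d₁ → b < d₂ → F a b = 0 := by
    intro w
    induction w with
    | zero =>
      intro a b hab _ _
      rw [show a = 0 by omega, show b = 0 by omega, h0]
    | succ w ih =>
      -- In low weights both neighbours of (a, b) exist, because d₂ ≤ d₁, and the two equations form
      -- an invertible system.
      by_cases hw : w + 2 ≤ d₂
      · have both : ∀ a b, a + b = w → F (a + 1) b = 0 ∧ F a (b + 1) = 0 := by
          intro a b hab
          have e1 := h1 a (by omega) b (by omega) (ih a b hab (by omega) (by omega))
          have e2 := h2 a (by omega) b (by omega) (ih a b hab (by omega) (by omega))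
          rw [if_pos (by omega), if_pos (by omega)] at e1 e2
          have hD := hdet a b (by omega)
          have f1 : (c₁ a * (α a b * δ a b - β a b * γ a b)) • F (a + 1) b = 0 := by
            have : (c₂ b * (c₁ a * (α a b * δ a b - β a b * γ a b))) • F (a + 1) b
              = (c₂ b * δ a b) • ((c₁ a * α a b) • F (a + 1) b + (c₂ b * β a b) • F a (b + 1))
                - (c₂ b * β a b) • ((c₁ a * γ a b) • F (a + 1) b
                  + (c₂ b * δ a b) • F a (b + 1)) := by module
            rw [e1, e2, smul_zero, smul_zero, sub_zero, mul_smul] at this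
            exact (smul_eq_zero.mp this).resolve_left (hc₂ b (by omega))
          have f2 : (c₂ b * (α a b * δ a b - β a b * γ a b)) • F a (b + 1) = 0 := by
            have : (c₁ a * (c₂ b * (α a b * δ a b - β a b * γ a b))) • F a (b + 1)
              = (c₁ a * α a b) • ((c₁ a * γ a b) • F (a + 1) b + (c₂ b * δ a b) • F a (b + 1))
                - (c₁ a * γ a b) • ((c₁ a * α a b) • F (a + 1) b
                  + (c₂ b * β a b) • F a (b + 1)) := by module
            rw [e1, e2, smul_zero, smul_zero, sub_zero, mul_smul] at this
            exact (smul_eq_zero.mp this).resolve_left (hc₁ a (by omega))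
          exact ⟨(smul_eq_zero.mp f1).resolve_left (mul_ne_zero (hc₁ a (by omega)) hD),
            (smul_eq_zero.mp f2).resolve_left (mul_ne_zero (hc₂ b (by omega)) hD)⟩
        intro a b hab _ _
        rcases a with _ | a
        · obtain ⟨b, rfl⟩ : ∃ b', b = b' + 1 := ⟨b - 1, by omega⟩
          exact (both 0 b (by omega)).2
        · exact (both a b (by omega)).1
      -- In high weights the determinant is not controlled, but one equation suffices: at b = d₂ - 1
      -- its second term is absent, and from there b descends. Here a ≥ 1 because w + 1 ≥ d₂ > b.
      · have desc : ∀ k a b, a + b = w + 1 → a < d₁ → b < d₂ → d₂ = b + 1 + k → F a b = 0 := by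
          intro k
          induction k with
          | zero =>
            intro a b hab ha hb hk
            obtain ⟨a, rfl⟩ : ∃ a', a = a' + 1 := ⟨a - 1, by omega⟩
            have e1 := h1 a (by omega) b hb (ih a b (by omega) (by omega) hb)
            rw [if_pos ha, if_neg (by omega), zero_mul, zero_smul, add_zero] at e1
            exact (smul_eq_zero.mp e1).resolve_left (mul_ne_zero (hc₁ a ha) (hα a b))
          | succ k ihk =>
            intro a b hab ha hb hk
            obtain ⟨a, rfl⟩ : ∃ a', a = a' + 1 := ⟨a - 1, by omega⟩
            have e1 := h1 a (by omega) b hb (ih a b (by omega) (by omega) hb)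
            rw [ihk a (b + 1) (by omega) (by omega) (by omega) (by omega), smul_zero, add_zero,
              if_pos ha] at e1
            exact (smul_eq_zero.mp e1).resolve_left (mul_ne_zero (hc₁ a ha) (hα a b))
        intro a b hab ha hb
        exact desc (d₂ - (b + 1)) a b hab ha hb (by omega)
  exact fun a ha b hb => key (a + b) a b rfl ha hb

/-- The entries of a matrix, extended by zero. -/
def extRow {d₁ d₂ : ℕ} {ι : Type*} (M : Matrix (Fin d₁ × Fin d₂) ι ℂ) (a b : ℕ) : ι → ℂ :=
  if h : a < d₁ ∧ b < d₂ then M (⟨a, h.1⟩, ⟨b, h.2⟩) else 0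

variable {d₁ d₂ : ℕ} {ι : Type*} {φ θ : ℕ → ℂ}

theorem raiseMat_kronecker_diagonal_mul (g : Fin d₂ → ℂ) (M : Matrix (Fin d₁ × Fin d₂) ι ℂ)
    (a : Fin d₁) (b : Fin d₂) :
    (fun i => (raiseMat θ φ d₁ ⊗ₖ Matrix.diagonal g * M) (a, b) i)
      = ((if (a : ℕ) + 1 < d₁ then θ a * φ a else 0) * g b) • extRow M (a + 1) b := by
  ext i
  rw [Matrix.mul_apply, Fintype.sum_prod_type]
  have : ∀ c : Fin d₁, ∑ e : Fin d₂, (raiseMat θ φ d₁ ⊗ₖ Matrix.diagonal g) (a, b) (c, e) * M (c, e) i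
      = raiseMat θ φ d₁ a c * g b * M (c, b) i := by
    intro c
    rw [Finset.sum_eq_single b]
    · simp
    · intro e _ he
      simp [Matrix.diagonal_apply_ne _ he.symm]
    · simp
  simp only [this]
  simp only [raiseMat, Matrix.of_apply, Pi.smul_apply, smul_eq_mul]
  by_cases h : (a : ℕ) + 1 < d₁
  · rw [Finset.sum_eq_single (⟨a + 1, h⟩ : Fin d₁)]
    · simp [h, extRow]
    · intro c _ hc
      rw [if_neg fun h' => hc (Fin.ext h'.symm)]; simp
    · simp
  · rw [if_neg h, zero_mul, zero_mul]
    refine Finset.sum_eq_zero fun c _ => ?_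
    rw [if_neg (by omega)]; simp

theorem diagonal_kronecker_raiseMat_mul (g : Fin d₁ → ℂ) (M : Matrix (Fin d₁ × Fin d₂) ι ℂ)
    (a : Fin d₁) (b : Fin d₂) :
    (fun i => (Matrix.diagonal g ⊗ₖ raiseMat θ φ d₂ * M) (a, b) i)
      = ((if (b : ℕ) + 1 < d₂ then θ b * φ b else 0) * g a) • extRow M a (b + 1) := by
  ext i
  rw [Matrix.mul_apply, Fintype.sum_prod_type, Finset.sum_comm]
  have : ∀ e : Fin d₂, ∑ c : Fin d₁, (Matrix.diagonal g ⊗ₖ raiseMat θ φ d₂) (a, b) (c, e) * M (c, e) i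
      = raiseMat θ φ d₂ b e * g a * M (a, e) i := by
    intro e
    rw [Finset.sum_eq_single a]
    · simp [mul_comm (g a)]
    · intro c _ hc
      simp [Matrix.diagonal_apply_ne _ hc.symm]
    · simp
  simp only [this]
  simp only [raiseMat, Matrix.of_apply, Pi.smul_apply, smul_eq_mul]
  by_cases h : (b : ℕ) + 1 < d₂
  · rw [Finset.sum_eq_single (⟨b + 1, h⟩ : Fin d₂)]
    · simp [h, extRow]
    · intro c _ hc
      rw [if_neg fun h' => hc (Fin.ext h'.symm)]; simp
    · simp
  · rw [if_neg h, zero_mul, zero_mul]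
    refine Finset.sum_eq_zero fun c _ => ?_
    rw [if_neg (by omega)]; simp

variable {N : ℕ} {s : ℤ} {p₁ p₂ x : ℂ} {θ₁ θ₂ : ℕ → ℂ} {d : ℕ}

local notation "ε" => epsPow N s
local notation "qn" => qNum N s

theorem raiseMat_apply_zero (a : Fin d) (hd : 0 < d) : raiseMat θ φ d a ⟨0, hd⟩ = 0 := by
  simp [raiseMat]

/-- Zeros spread from the (00,00) entry in two rounds, along the row of the highest weight vector
and then over all rows. Each round uses one relation without x and one with x, which gives the
determinant in `hdet`. -/
theorem eq_zero_of_affineRel (hN : 2 ≤ N) (hd : d ≤ N) (hd0 : 0 < d)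
    (hc₁ : ∀ a, a + 1 < N → θ₁ a * φ a ≠ 0) (hc₂ : ∀ a, a + 1 < d → θ₂ a * φ a ≠ 0)
    (hdet : ∀ k : ℕ, k + 2 ≤ d → ε (p₁ + p₂ - k) - x * ε (-(p₁ + p₂ - k)) ≠ 0)
    {D : Matrix (Fin N × Fin d) (Fin N × Fin d) ℂ}
    (hD : AffineRel (raiseMat θ₁ φ N) (torusMat N s p₁ N) (torusInv N s p₁ N)
      (raiseMat θ₂ φ d) (torusMat N s p₂ d) (torusInv N s p₂ d) x D)
    (h0 : D (⟨0, two_pos.trans_le hN⟩, ⟨0, hd0⟩) (⟨0, two_pos.trans_le hN⟩, ⟨0, hd0⟩) = 0) : D = 0 := by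
  obtain ⟨-, -, hE, hF, hE0, hF0⟩ := hD
  have ext_eq : ∀ (M : Matrix (Fin N × Fin d) (Fin N × Fin d) ℂ) (a : Fin N) (b : Fin d),
      extRow M a b = M (a, b) := fun M a b => dif_pos ⟨a.2, b.2⟩
  have e1 : ∀ a b : ℕ, ε (p₁ - a) * ε (p₂ - b) = ε (p₁ + p₂ - (a + b : ℕ)) := by
    intro a b; rw [← eps_add]; congr 1; push_cast; ring
  have e2 : ∀ a b : ℕ, ε (-(p₁ - a)) * ε (-(p₂ - b)) = ε (-(p₁ + p₂ - (a + b : ℕ))) := by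
    intro a b; rw [← eps_add]; congr 1; push_cast; ring
  set o : Fin N × Fin d := (⟨0, two_pos.trans_le hN⟩, ⟨0, hd0⟩) with ho
  have mulo : ∀ (M : Matrix (Fin N × Fin d) (Fin N × Fin d) ℂ) (g : Fin d → ℂ) (g' : Fin N → ℂ) a,
      (M * raiseMat θ₁ φ N ⊗ₖ Matrix.diagonal g) a o = 0 ∧
      (M * Matrix.diagonal g' ⊗ₖ raiseMat θ₂ φ d) a o = 0 := by
    intro M g g' a
    rw [Matrix.mul_apply, Matrix.mul_apply]
    constructor <;> refine Finset.sum_eq_zero fun c _ => ?_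
    · rw [Matrix.kroneckerMap_apply, ho, raiseMat_apply_zero, zero_mul, mul_zero]
    · rw [Matrix.kroneckerMap_apply, ho, raiseMat_apply_zero, mul_zero, mul_zero]
  -- The transposed relations are read in the column of e₀ ⊗ e₀. Their right sides vanish there
  -- because X⁺ kills e₀.
  have row : ∀ b, D o b = 0 := by
    have hF' := congrArg Matrix.transpose hF
    have hE0' := congrArg Matrix.transpose hE0
    simp only [Matrix.transpose_mul, Matrix.transpose_add, Matrix.transpose_smul,
      ← Matrix.kroneckerMap_transpose, Matrix.transpose_transpose, torusMat_transpose,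
      torusInv_transpose] at hF' hE0'
    have z := eq_zero_of_raising (V := ℂ) (d₁ := N) (d₂ := d)
      (F := fun a b => extRow D.transpose a b o)
      (c₁ := fun a => θ₁ a * φ a) (c₂ := fun a => θ₂ a * φ a) (α := fun _ b => ε (p₂ - b))
      (β := fun a _ => ε (-(p₁ - a))) (γ := fun _ b => x * ε (-(p₂ - b)))
      (δ := fun a _ => ε (p₁ - a)) hd hc₁ hc₂
      (fun _ _ => eps_ne_zero _) (fun a b hab => by
        have := hdet (a + b) hab
        rw [← e1, ← e2] at this
        intro h; apply this; linear_combination h) (fun a ha b hb _ => by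
        have k := congrFun (congrFun hF' (⟨a, ha⟩, ⟨b, hb⟩)) o
        rw [add_mul, mul_add, Matrix.add_apply, Matrix.add_apply] at k
        simp only [torusMat, torusInv] at k
        rw [(mulo D.transpose _ 0 _).1, (mulo D.transpose 0 _ _).2, add_zero] at k
        have k1 := congrFun (raiseMat_kronecker_diagonal_mul (θ := θ₁) (φ := φ)
          (fun b : Fin d => ε (p₂ - (b : ℕ))) D.transpose ⟨a, ha⟩ ⟨b, hb⟩) o
        have k2 := congrFun (diagonal_kronecker_raiseMat_mul (θ := θ₂) (φ := φ)
          (fun b : Fin N => ε (-(p₁ - (b : ℕ)))) D.transpose ⟨a, ha⟩ ⟨b, hb⟩) o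
        simp only [Pi.smul_apply] at k1 k2
        rw [k1, k2] at k
        exact k) (fun a ha b hb _ => by
        have k := congrFun (congrFun hE0' (⟨a, ha⟩, ⟨b, hb⟩)) o
        rw [add_mul, mul_add, Matrix.add_apply, Matrix.add_apply, smul_mul_assoc, mul_smul_comm,
          Matrix.smul_apply, Matrix.smul_apply] at k
        simp only [torusMat, torusInv] at k
        rw [(mulo D.transpose _ 0 _).1, (mulo D.transpose 0 _ _).2, add_zero, smul_zero] at k
        have k1 := congrFun (raiseMat_kronecker_diagonal_mul (θ := θ₁) (φ := φ)
          (fun b : Fin d => ε (-(p₂ - (b : ℕ)))) D.transpose ⟨a, ha⟩ ⟨b, hb⟩) o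
        have k2 := congrFun (diagonal_kronecker_raiseMat_mul (θ := θ₂) (φ := φ)
          (fun b : Fin N => ε (p₁ - (b : ℕ))) D.transpose ⟨a, ha⟩ ⟨b, hb⟩) o
        simp only [Pi.smul_apply] at k1 k2
        rw [k1, k2] at k
        refine Eq.trans ?_ k
        simp only [smul_eq_mul]
        ring) (by
        have := congrFun (ext_eq D.transpose ⟨0, two_pos.trans_le hN⟩ ⟨0, hd0⟩) o
        exact this.trans h0)
    intro b
    have := z b.1 b.1.2 b.2 b.2.2
    rw [ext_eq] at this
    exact this
  -- If the row (a, b) of D is zero, the relations become two linear equations between the rows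
  -- (a+1, b) and (a, b+1).
  have z := eq_zero_of_raising (d₁ := N) (d₂ := d) (F := extRow D)
    (c₁ := fun a => θ₁ a * φ a) (c₂ := fun a => θ₂ a * φ a) (α := fun _ b => ε (-(p₂ - b)))
    (β := fun a _ => ε (p₁ - a)) (γ := fun _ b => ε (p₂ - b))
    (δ := fun a _ => x * ε (-(p₁ - a))) hd hc₁ hc₂
    (fun _ _ => eps_ne_zero _) (fun a b hab => by
      have := hdet (a + b) hab
      rw [← e1, ← e2] at this
      intro h; apply this; linear_combination -h) (fun a ha b hb hab => by
      have k : ∀ i, _ := fun i => congrFun (congrFun hE (⟨a, ha⟩, ⟨b, hb⟩)) i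
      have hab' : D (⟨a, ha⟩, ⟨b, hb⟩) = 0 := (ext_eq D ⟨a, ha⟩ ⟨b, hb⟩).symm.trans hab
      ext i
      have k := k i
      rw [Matrix.mul_apply, hab'] at k
      simp only [Pi.zero_apply, zero_mul, Finset.sum_const_zero] at k
      rw [add_mul, Matrix.add_apply] at k
      simp only [torusMat, torusInv] at k
      have k1 := congrFun (raiseMat_kronecker_diagonal_mul (θ := θ₁) (φ := φ)
        (fun b : Fin d => ε (-(p₂ - (b : ℕ)))) D ⟨a, ha⟩ ⟨b, hb⟩) i
      have k2 := congrFun (diagonal_kronecker_raiseMat_mul (θ := θ₂) (φ := φ)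
        (fun b : Fin N => ε (p₁ - (b : ℕ))) D ⟨a, ha⟩ ⟨b, hb⟩) i
      simp only at k1 k2
      rw [k1, k2] at k
      exact k.symm) (fun a ha b hb hab => by
      have k : ∀ i, _ := fun i => congrFun (congrFun hF0 (⟨a, ha⟩, ⟨b, hb⟩)) i
      have hab' : D (⟨a, ha⟩, ⟨b, hb⟩) = 0 := (ext_eq D ⟨a, ha⟩ ⟨b, hb⟩).symm.trans hab
      ext i
      have k := k i
      rw [Matrix.mul_apply, hab'] at k
      simp only [Pi.zero_apply, zero_mul, Finset.sum_const_zero] at k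
      rw [add_mul, Matrix.add_apply, smul_mul_assoc, Matrix.smul_apply] at k
      simp only [torusMat, torusInv] at k
      have k1 := congrFun (raiseMat_kronecker_diagonal_mul (θ := θ₁) (φ := φ)
        (fun b : Fin d => ε (p₂ - (b : ℕ))) D ⟨a, ha⟩ ⟨b, hb⟩) i
      have k2 := congrFun (diagonal_kronecker_raiseMat_mul (θ := θ₂) (φ := φ)
        (fun b : Fin N => ε (-(p₁ - (b : ℕ)))) D ⟨a, ha⟩ ⟨b, hb⟩) i
      simp only at k1 k2
      rw [k1, k2] at k
      refine Eq.trans ?_ k.symm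
      simp only [Pi.add_apply, Pi.smul_apply, smul_eq_mul]
      ring) ((ext_eq D ⟨0, two_pos.trans_le hN⟩ ⟨0, hd0⟩).trans (funext row))
  ext a b
  have := z a.1 a.1.2 a.2 a.2.2
  rw [ext_eq] at this
  exact congrFun this b

theorem AffineRel.sub_smul {m n : Type*} [Fintype m] [Fintype n] {X₁ K₁ L₁ : Matrix m m ℂ}
    {X₂ K₂ L₂ : Matrix n n ℂ} {x : ℂ} {T R : Matrix (m × n) (m × n) ℂ}
    (hT : AffineRel X₁ K₁ L₁ X₂ K₂ L₂ x T) (hR : AffineRel X₁ K₁ L₁ X₂ K₂ L₂ x R) (c : ℂ) :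
    AffineRel X₁ K₁ L₁ X₂ K₂ L₂ x (T - c • R) := by
  have key : ∀ A B : Matrix (m × n) (m × n) ℂ, T * A = B * T → R * A = B * R →
      (T - c • R) * A = B * (T - c • R) := by
    intro A B h1 h2
    rw [sub_mul, mul_sub, h1, smul_mul_assoc, mul_smul_comm, h2]
  obtain ⟨t1, t2, t3, t4, t5, t6⟩ := hT
  obtain ⟨r1, r2, r3, r4, r5, r6⟩ := hR
  exact ⟨key _ _ t1 r1, key _ _ t2 r2, key _ _ t3 r3, key _ _ t4 r4, key _ _ t5 r5, key _ _ t6 r6⟩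

theorem eps_sub_ne_zero_of_qNum (hN : 2 ≤ N) (hs : IsCoprime s (N : ℤ)) {u P : ℂ}
    (h : qn (u + P) ≠ 0) : ε P - ε (-2 * u) * ε (-P) ≠ 0 := by
  have e1 : ε P = ε (-u) * ε (u + P) := by rw [← eps_add]; congr 1; ring
  have e2 : ε (-2 * u) * ε (-P) = ε (-u) * ε (-(u + P)) := by
    rw [← eps_add, ← eps_add]; congr 1; ring
  rw [e2, e1, ← mul_sub, ← qNum_mul_den hN hs]
  exact mul_ne_zero (eps_ne_zero _) (mul_ne_zero h (eps_one_sub_ne_zero hN hs))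

theorem rMatrix_unique (hN : 2 ≤ N) (hs : IsCoprime s (N : ℤ)) {r : ℂ → ℂ}
    (hr : IsRootChoice N s r) {u : ℂ} (hd : d ≤ N) (hd0 : 0 < d)
    (h1 : ∀ a : ℕ, a + 1 < N → qn (2 * p₁ - a) ≠ 0) (h2 : ∀ a : ℕ, a + 1 < d → qn (2 * p₂ - a) ≠ 0)
    (hu : ∀ k : ℕ, k + 2 ≤ d → qn (u + p₁ + p₂ - k) ≠ 0)
    {T R : Matrix (Fin N × Fin d) (Fin N × Fin d) ℂ}
    (hT : IsRMatrix N s r p₁ N p₂ d (ε (-2 * u)) T)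
    (hR : IsRMatrix N s r p₁ N p₂ d (ε (-2 * u)) R)
    (hR0 : R (⟨0, two_pos.trans_le hN⟩, ⟨0, hd0⟩) (⟨0, two_pos.trans_le hN⟩, ⟨0, hd0⟩) = 1) :
    ∃ c : ℂ, T = c • R := by
  have hr0 : ∀ y : ℂ, qn y ≠ 0 → r y ≠ 0 := fun y hy h => hy (by rw [← hr y, h]; simp)
  rw [isRMatrix_iff (eps_ne_zero _)] at hT hR
  refine ⟨T (⟨0, two_pos.trans_le hN⟩, ⟨0, hd0⟩) (⟨0, two_pos.trans_le hN⟩, ⟨0, hd0⟩), sub_eq_zero.mp ?_⟩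
  refine eq_zero_of_affineRel hN hd hd0
    (fun a ha => mul_ne_zero (hr0 _ (h1 a ha)) (hr0 _ (qNum_succ_ne_zero hN hs ha)))
    (fun a ha => mul_ne_zero (hr0 _ (h2 a ha)) (hr0 _ (qNum_succ_ne_zero hN hs (by omega))))
    (fun k hk => eps_sub_ne_zero_of_qNum hN hs (by
      rw [show u + (p₁ + p₂ - k) = u + p₁ + p₂ - k by ring]; exact hu k hk))
    (hT.sub_smul hR _) ?_
  rw [Matrix.sub_apply, Matrix.smul_apply, hR0, smul_eq_mul, mul_one, sub_self]

theorem rColor_unique (hN : 2 ≤ N) (hs : IsCoprime s (N : ℤ)) {r : ℂ → ℂ}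
    (hr : IsRootChoice N s r) {u : ℂ} (hg : Generic N s p₁ p₂ u) (h1 : IrreducibleColor N s p₁)
    (h2 : IrreducibleColor N s p₂) {T : Matrix (Fin N × Fin N) (Fin N × Fin N) ℂ}
    (hT : IsRMatrix N s r p₁ N p₂ N (ε (-2 * u)) T) :
    ∃ c : ℂ, T = c • rColor N s r p₁ p₂ u := by
  refine rMatrix_unique hN hs hr le_rfl (by omega) h1 h2 (fun k hk => hg.2 k (by omega)) hT
    (isRMatrix_rColor hN hs hr hg) ?_
  rw [rColor_eq hr, rGen_zero_zero hN (rootData hN hs hr hg.1).generic]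
  simp [gCoeff]

theorem rMixed_zero_zero (hN : 2 ≤ N) {r : ℂ → ℂ}
    (hr : IsRootChoice N s r) {m : ℕ} {u : ℂ} (hm : m + 2 ≤ N) (hg : GenericMixed N s p₁ m u) :
    rMixed N s r p₁ m u (⟨0, two_pos.trans_le hN⟩, ⟨0, m.succ_pos⟩)
      (⟨0, two_pos.trans_le hN⟩, ⟨0, m.succ_pos⟩) = 1 := by
  rw [rMixed_eq hr p₁ (by omega : m + 1 ≤ N) u, Matrix.submatrix_apply]
  refine (rGen_zero_zero hN (fun k => ?_) _).trans ?_
  · have := hg.1 (m + k)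
    push_cast at this
    rwa [show 2 * (p₁ + (m : ℂ) / 2) + k = 2 * p₁ + (m + k) by ring]
  · simp [gCoeff]

theorem rMixed_unique (hN : 2 ≤ N) (hs : IsCoprime s (N : ℤ)) {r : ℂ → ℂ}
    (hr : IsRootChoice N s r) {m : ℕ} {u : ℂ} (hm : m + 2 ≤ N) (hg : GenericMixed N s p₁ m u)
    {T : Matrix (Fin N × Fin (m + 1)) (Fin N × Fin (m + 1)) ℂ}
    (hT : IsRMatrix N s r p₁ N ((m : ℂ) / 2) (m + 1) (ε (-2 * u)) T) :
    ∃ c : ℂ, T = c • rMixed N s r p₁ m u := by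
  refine rMatrix_unique hN hs hr (by omega) (by omega) (fun a _ => ?_) (fun a ha => ?_)
    (fun k hk => hg.2 k (by omega)) hT (isRMatrix_rMixed hN hs hr hm hg)
    (rMixed_zero_zero hN hr hm hg)
  · have := hg.1 (-a)
    push_cast at this
    rwa [sub_eq_add_neg]
  · have := qNum_natCast_ne_zero hN hs (k := m - a) (by omega) (by omega)
    rw [Nat.cast_sub (by omega)] at this
    rwa [show 2 * ((m : ℂ) / 2) - a = m - a by ring]

end Uniqueness

/-! ### Three tensor factors -/

section Triple

variable {n T : Type*} [Fintype n] [DecidableEq n] [Fintype T]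

/-- The action of `M` on the two factors that `e` puts first. -/
def liftMat (e : T ≃ (n × n) × n) (M : Matrix (n × n) (n × n) ℂ) : Matrix T T ℂ :=
  (M ⊗ₖ (1 : Matrix n n ℂ)).submatrix e e

theorem liftMat_mul_submatrix (e : T ≃ (n × n) × n) {M P Q : Matrix (n × n) (n × n) ℂ}
    (h : M * P = Q * M) (G : Matrix n n ℂ) :
    liftMat e M * (P ⊗ₖ G).submatrix e e = (Q ⊗ₖ G).submatrix e e * liftMat e M := by
  rw [liftMat, Matrix.submatrix_mul_equiv, Matrix.submatrix_mul_equiv, ← Matrix.mul_kronecker_mul,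
    ← Matrix.mul_kronecker_mul, h, one_mul, mul_one]

/-- The first and second factor. -/
def pairOneTwo (n : Type*) : n × n × n ≃ (n × n) × n where
  toFun a := ((a.1, a.2.1), a.2.2)
  invFun a := (a.1.1, a.1.2, a.2)

/-- The first and third factor. -/
def pairOneThree (n : Type*) : n × n × n ≃ (n × n) × n where
  toFun a := ((a.1, a.2.2), a.2.1)
  invFun a := (a.1.1, a.2, a.1.2)

/-- The second and third factor. -/
def pairTwoThree (n : Type*) : n × n × n ≃ (n × n) × n where
  toFun a := ((a.2.1, a.2.2), a.1)
  invFun a := (a.2, a.1.1, a.1.2)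

omit [Fintype n] [DecidableEq n] in
theorem kronecker_pairOneTwo (A B C : Matrix n n ℂ) :
    ((A ⊗ₖ B) ⊗ₖ C).submatrix (pairOneTwo n) (pairOneTwo n) = A ⊗ₖ (B ⊗ₖ C) := by
  ext a b
  simp only [Matrix.submatrix_apply, Matrix.kroneckerMap_apply, pairOneTwo, Equiv.coe_fn_mk]
  ring

omit [Fintype n] [DecidableEq n] in
theorem kronecker_pairOneThree (A B C : Matrix n n ℂ) :
    ((A ⊗ₖ C) ⊗ₖ B).submatrix (pairOneThree n) (pairOneThree n) = A ⊗ₖ (B ⊗ₖ C) := by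
  ext a b
  simp only [Matrix.submatrix_apply, Matrix.kroneckerMap_apply, pairOneThree, Equiv.coe_fn_mk]
  ring

omit [Fintype n] [DecidableEq n] in
theorem kronecker_pairTwoThree (A B C : Matrix n n ℂ) :
    ((B ⊗ₖ C) ⊗ₖ A).submatrix (pairTwoThree n) (pairTwoThree n) = A ⊗ₖ (B ⊗ₖ C) := by
  ext a b
  simp only [Matrix.submatrix_apply, Matrix.kroneckerMap_apply, pairTwoThree, Equiv.coe_fn_mk]
  ring

/-- `M` exchanges the two comultiplications of `X`, and commutes with `K ⊗ K` and `L ⊗ L`. -/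
structure Exchange (X₁ K₁ L₁ X₂ K₂ L₂ : Matrix n n ℂ) (M : Matrix (n × n) (n × n) ℂ) : Prop where
  raise : M * (X₁ ⊗ₖ K₂ + L₁ ⊗ₖ X₂) = (X₁ ⊗ₖ L₂ + K₁ ⊗ₖ X₂) * M
  torus : M * (K₁ ⊗ₖ K₂) = K₁ ⊗ₖ K₂ * M
  inv : M * (L₁ ⊗ₖ L₂) = L₁ ⊗ₖ L₂ * M

section ExchangeLift

variable {X₁ K₁ L₁ X₂ K₂ L₂ X₃ K₃ L₃ : Matrix n n ℂ} {M M' M'' : Matrix (n × n) (n × n) ℂ}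

theorem Exchange.lift_pairOneTwo (h : Exchange X₁ K₁ L₁ X₂ K₂ L₂ M) (G : Matrix n n ℂ) :
    liftMat (pairOneTwo n) M * (X₁ ⊗ₖ (K₂ ⊗ₖ G) + L₁ ⊗ₖ (X₂ ⊗ₖ G))
        = (X₁ ⊗ₖ (L₂ ⊗ₖ G) + K₁ ⊗ₖ (X₂ ⊗ₖ G)) * liftMat (pairOneTwo n) M ∧
      liftMat (pairOneTwo n) M * K₁ ⊗ₖ (K₂ ⊗ₖ G) = K₁ ⊗ₖ (K₂ ⊗ₖ G) * liftMat (pairOneTwo n) M ∧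
      liftMat (pairOneTwo n) M * L₁ ⊗ₖ (L₂ ⊗ₖ G) = L₁ ⊗ₖ (L₂ ⊗ₖ G) * liftMat (pairOneTwo n) M := by
  simp only [← kronecker_pairOneTwo]
  refine ⟨?_, liftMat_mul_submatrix _ h.torus G, liftMat_mul_submatrix _ h.inv G⟩
  have := liftMat_mul_submatrix (pairOneTwo n) h.raise G
  rwa [Matrix.add_kronecker, Matrix.add_kronecker, Matrix.submatrix_add, Matrix.submatrix_add]
    at this

theorem Exchange.lift_pairOneThree (h : Exchange X₁ K₁ L₁ X₃ K₃ L₃ M) (G : Matrix n n ℂ) :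
    liftMat (pairOneThree n) M * (X₁ ⊗ₖ (G ⊗ₖ K₃) + L₁ ⊗ₖ (G ⊗ₖ X₃))
        = (X₁ ⊗ₖ (G ⊗ₖ L₃) + K₁ ⊗ₖ (G ⊗ₖ X₃)) * liftMat (pairOneThree n) M ∧
      liftMat (pairOneThree n) M * K₁ ⊗ₖ (G ⊗ₖ K₃)
        = K₁ ⊗ₖ (G ⊗ₖ K₃) * liftMat (pairOneThree n) M ∧
      liftMat (pairOneThree n) M * L₁ ⊗ₖ (G ⊗ₖ L₃)
        = L₁ ⊗ₖ (G ⊗ₖ L₃) * liftMat (pairOneThree n) M := by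
  simp only [← kronecker_pairOneThree]
  refine ⟨?_, liftMat_mul_submatrix _ h.torus G, liftMat_mul_submatrix _ h.inv G⟩
  have := liftMat_mul_submatrix (pairOneThree n) h.raise G
  rwa [Matrix.add_kronecker, Matrix.add_kronecker, Matrix.submatrix_add, Matrix.submatrix_add]
    at this

theorem Exchange.lift_pairTwoThree (h : Exchange X₂ K₂ L₂ X₃ K₃ L₃ M) (G : Matrix n n ℂ) :
    liftMat (pairTwoThree n) M * (G ⊗ₖ (X₂ ⊗ₖ K₃) + G ⊗ₖ (L₂ ⊗ₖ X₃))
        = (G ⊗ₖ (X₂ ⊗ₖ L₃) + G ⊗ₖ (K₂ ⊗ₖ X₃)) * liftMat (pairTwoThree n) M ∧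
      liftMat (pairTwoThree n) M * G ⊗ₖ (K₂ ⊗ₖ K₃)
        = G ⊗ₖ (K₂ ⊗ₖ K₃) * liftMat (pairTwoThree n) M ∧
      liftMat (pairTwoThree n) M * G ⊗ₖ (L₂ ⊗ₖ L₃)
        = G ⊗ₖ (L₂ ⊗ₖ L₃) * liftMat (pairTwoThree n) M := by
  simp only [← kronecker_pairTwoThree]
  refine ⟨?_, liftMat_mul_submatrix _ h.torus G, liftMat_mul_submatrix _ h.inv G⟩
  have := liftMat_mul_submatrix (pairTwoThree n) h.raise G
  rwa [Matrix.add_kronecker, Matrix.add_kronecker, Matrix.submatrix_add, Matrix.submatrix_add]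
    at this

/-- The difference of the two sides of the Yang-Baxter equation. -/
def ybDiff (M₁₂ M₁₃ M₂₃ : Matrix (n × n) (n × n) ℂ) : Matrix (n × n × n) (n × n × n) ℂ :=
  liftMat (pairTwoThree n) M₂₃ * liftMat (pairOneThree n) M₁₃ * liftMat (pairOneTwo n) M₁₂
    - liftMat (pairOneTwo n) M₁₂ * liftMat (pairOneThree n) M₁₃ * liftMat (pairTwoThree n) M₂₃

/-- Each factor reverses the coproduct on one pair of sites and commutes with the torus factor of
the third term. Both triple products end at the completely reversed threefold coproduct. -/
theorem ybDiff_mul (h₁₂ : Exchange X₁ K₁ L₁ X₂ K₂ L₂ M) (h₁₃ : Exchange X₁ K₁ L₁ X₃ K₃ L₃ M')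
    (h₂₃ : Exchange X₂ K₂ L₂ X₃ K₃ L₃ M'') :
    ybDiff M M' M'' * (X₁ ⊗ₖ (K₂ ⊗ₖ K₃) + L₁ ⊗ₖ (X₂ ⊗ₖ K₃) + L₁ ⊗ₖ (L₂ ⊗ₖ X₃))
      = (X₁ ⊗ₖ (L₂ ⊗ₖ L₃) + K₁ ⊗ₖ (X₂ ⊗ₖ L₃) + K₁ ⊗ₖ (K₂ ⊗ₖ X₃)) * ybDiff M M' M'' := by
  set A := liftMat (pairOneTwo n) M with hA
  set B := liftMat (pairOneThree n) M' with hB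
  set C := liftMat (pairTwoThree n) M'' with hC
  have a1 : A * (X₁ ⊗ₖ (K₂ ⊗ₖ K₃) + L₁ ⊗ₖ (X₂ ⊗ₖ K₃) + L₁ ⊗ₖ (L₂ ⊗ₖ X₃))
      = (X₁ ⊗ₖ (L₂ ⊗ₖ K₃) + K₁ ⊗ₖ (X₂ ⊗ₖ K₃) + L₁ ⊗ₖ (L₂ ⊗ₖ X₃)) * A := by
    rw [mul_add, (h₁₂.lift_pairOneTwo K₃).1, (h₁₂.lift_pairOneTwo X₃).2.2, ← add_mul]
  have b1 : B * (X₁ ⊗ₖ (L₂ ⊗ₖ K₃) + K₁ ⊗ₖ (X₂ ⊗ₖ K₃) + L₁ ⊗ₖ (L₂ ⊗ₖ X₃))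
      = (X₁ ⊗ₖ (L₂ ⊗ₖ L₃) + K₁ ⊗ₖ (X₂ ⊗ₖ K₃) + K₁ ⊗ₖ (L₂ ⊗ₖ X₃)) * B := by
    rw [add_right_comm, mul_add, (h₁₃.lift_pairOneThree L₂).1, (h₁₃.lift_pairOneThree X₂).2.1,
      ← add_mul, add_right_comm]
  have c1 : C * (X₁ ⊗ₖ (L₂ ⊗ₖ L₃) + K₁ ⊗ₖ (X₂ ⊗ₖ K₃) + K₁ ⊗ₖ (L₂ ⊗ₖ X₃))
      = (X₁ ⊗ₖ (L₂ ⊗ₖ L₃) + K₁ ⊗ₖ (X₂ ⊗ₖ L₃) + K₁ ⊗ₖ (K₂ ⊗ₖ X₃)) * C := by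
    rw [add_assoc, mul_add, (h₂₃.lift_pairTwoThree K₁).1, (h₂₃.lift_pairTwoThree X₁).2.2,
      ← add_mul, add_assoc]
  have c2 : C * (X₁ ⊗ₖ (K₂ ⊗ₖ K₃) + L₁ ⊗ₖ (X₂ ⊗ₖ K₃) + L₁ ⊗ₖ (L₂ ⊗ₖ X₃))
      = (X₁ ⊗ₖ (K₂ ⊗ₖ K₃) + L₁ ⊗ₖ (X₂ ⊗ₖ L₃) + L₁ ⊗ₖ (K₂ ⊗ₖ X₃)) * C := by
    rw [add_assoc, mul_add, (h₂₃.lift_pairTwoThree L₁).1, (h₂₃.lift_pairTwoThree X₁).2.1,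
      ← add_mul, add_assoc]
  have b2 : B * (X₁ ⊗ₖ (K₂ ⊗ₖ K₃) + L₁ ⊗ₖ (X₂ ⊗ₖ L₃) + L₁ ⊗ₖ (K₂ ⊗ₖ X₃))
      = (X₁ ⊗ₖ (K₂ ⊗ₖ L₃) + L₁ ⊗ₖ (X₂ ⊗ₖ L₃) + K₁ ⊗ₖ (K₂ ⊗ₖ X₃)) * B := by
    rw [add_right_comm, mul_add, (h₁₃.lift_pairOneThree K₂).1, (h₁₃.lift_pairOneThree X₂).2.2,
      ← add_mul, add_right_comm]
  have a2 : A * (X₁ ⊗ₖ (K₂ ⊗ₖ L₃) + L₁ ⊗ₖ (X₂ ⊗ₖ L₃) + K₁ ⊗ₖ (K₂ ⊗ₖ X₃))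
      = (X₁ ⊗ₖ (L₂ ⊗ₖ L₃) + K₁ ⊗ₖ (X₂ ⊗ₖ L₃) + K₁ ⊗ₖ (K₂ ⊗ₖ X₃)) * A := by
    rw [mul_add, (h₁₂.lift_pairOneTwo L₃).1, (h₁₂.lift_pairOneTwo X₃).2.1, ← add_mul]
  have e1 : C * B * A * (X₁ ⊗ₖ (K₂ ⊗ₖ K₃) + L₁ ⊗ₖ (X₂ ⊗ₖ K₃) + L₁ ⊗ₖ (L₂ ⊗ₖ X₃))
      = (X₁ ⊗ₖ (L₂ ⊗ₖ L₃) + K₁ ⊗ₖ (X₂ ⊗ₖ L₃) + K₁ ⊗ₖ (K₂ ⊗ₖ X₃)) * (C * B * A) := by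
    rw [mul_assoc, a1, ← mul_assoc, mul_assoc C B, b1, ← mul_assoc, c1]
    simp only [mul_assoc]
  have e2 : A * B * C * (X₁ ⊗ₖ (K₂ ⊗ₖ K₃) + L₁ ⊗ₖ (X₂ ⊗ₖ K₃) + L₁ ⊗ₖ (L₂ ⊗ₖ X₃))
      = (X₁ ⊗ₖ (L₂ ⊗ₖ L₃) + K₁ ⊗ₖ (X₂ ⊗ₖ L₃) + K₁ ⊗ₖ (K₂ ⊗ₖ X₃)) * (A * B * C) := by
    rw [mul_assoc, c2, ← mul_assoc, mul_assoc A B, b2, ← mul_assoc, a2]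
    simp only [mul_assoc]
  rw [ybDiff, sub_mul, mul_sub, e1, e2]

end ExchangeLift

theorem ybDiff_apply (M₁₂ M₁₃ M₂₃ : Matrix (n × n) (n × n) ℂ) (a b : n × n × n) :
    ybDiff M₁₂ M₁₃ M₂₃ a b
      = ∑ c₁, ∑ c₂, ∑ c₃, M₂₃ (a.2.1, a.2.2) (c₂, c₃) * M₁₃ (a.1, c₃) (c₁, b.2.2)
          * M₁₂ (c₁, c₂) (b.1, b.2.1)
        - ∑ c₂, ∑ c₃, ∑ c₁, M₁₂ (a.1, a.2.1) (c₁, c₂) * M₁₃ (c₁, a.2.2) (b.1, c₃)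
          * M₂₃ (c₂, c₃) (b.2.1, b.2.2) := by
  have l12 : ∀ M (a b : n × n × n), liftMat (pairOneTwo n) M a b
      = if a.2.2 = b.2.2 then M (a.1, a.2.1) (b.1, b.2.1) else 0 := by
    intro M a b
    simp [liftMat, pairOneTwo, Matrix.kroneckerMap_apply, Matrix.one_apply]
  have l13 : ∀ M (a b : n × n × n), liftMat (pairOneThree n) M a b
      = if a.2.1 = b.2.1 then M (a.1, a.2.2) (b.1, b.2.2) else 0 := by
    intro M a b
    simp [liftMat, pairOneThree, Matrix.kroneckerMap_apply, Matrix.one_apply]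
  have l23 : ∀ M (a b : n × n × n), liftMat (pairTwoThree n) M a b
      = if a.1 = b.1 then M (a.2.1, a.2.2) (b.2.1, b.2.2) else 0 := by
    intro M a b
    simp [liftMat, pairTwoThree, Matrix.kroneckerMap_apply, Matrix.one_apply]
  rw [ybDiff, Matrix.sub_apply]
  congr 1
  · simp only [Matrix.mul_apply, l12, l13, l23, Fintype.sum_prod_type, ite_mul, mul_ite, zero_mul,
      mul_zero, Finset.sum_ite_irrel, Finset.sum_const_zero, Finset.sum_ite_eq, Finset.sum_ite_eq',
      Finset.mem_univ, if_true, Finset.sum_mul]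
  · simp only [Matrix.mul_apply, l12, l13, l23, Fintype.sum_prod_type, ite_mul, mul_ite, zero_mul,
      mul_zero, Finset.sum_ite_irrel, Finset.sum_const_zero, Finset.sum_ite_eq, Finset.sum_ite_eq',
      Finset.mem_univ, if_true, Finset.sum_mul]

end Triple

/-! ### Polynomial families of matrices -/

section PolynomialFamilies

-- If P = X^k Q, then Q satisfies the same relations and kills the same column, so its value at 0
-- does too and vanishes by `H`. Hence X divides Q. A polynomial matrix divisible by every power of
-- X is zero.
open Polynomial in
theorem eq_zero_of_polynomial_relations {ι J : Type*} [Fintype ι] [DecidableEq ι]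
    {P : Matrix ι ι ℂ[X]} {A B : J → Matrix ι ι ℂ[X]} (h : ∀ j, P * A j = B j * P) (o : ι)
    (ho : ∀ a, P a o = 0)
    (H : ∀ D : Matrix ι ι ℂ, (∀ j, D * (A j).map (eval 0) = (B j).map (eval 0) * D) →
      (∀ a, D a o = 0) → D = 0) : P = 0 := by
  have key : ∀ k : ℕ, ∃ Q : Matrix ι ι ℂ[X], P = (X ^ k : ℂ[X]) • Q := by
    intro k
    induction k with
    | zero => exact ⟨P, by simp⟩
    | succ k ih =>
      obtain ⟨Q, hQ⟩ := ih
      have hX : (X ^ k : ℂ[X]) ≠ 0 := pow_ne_zero _ X_ne_zero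
      have hinj : Function.Injective fun M : Matrix ι ι ℂ[X] => (X ^ k : ℂ[X]) • M := by
        intro M M' hM
        ext1 a b
        have := congrFun (congrFun hM a) b
        exact mul_left_cancel₀ hX this
      have hQ' : ∀ j, Q * A j = B j * Q := by
        intro j
        have := h j
        rw [hQ, smul_mul_assoc, mul_smul_comm] at this
        exact hinj this
      have h0 : Q.map (eval 0) = 0 := by
        refine H _ (fun j => ?_) (fun a => ?_)
        · have := congrArg (evalRingHom (0 : ℂ)).mapMatrix (hQ' j)
          rw [map_mul, map_mul] at this
          exact this
        · have := ho a
          rw [hQ, Matrix.smul_apply, smul_eq_mul] at this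
          rw [Matrix.map_apply, (mul_eq_zero.mp this).resolve_left hX, eval_zero]
      have hdvd : ∀ a b, ∃ q : ℂ[X], Q a b = X * q := by
        intro a b
        have := congrFun (congrFun h0 a) b
        rw [Matrix.map_apply, Matrix.zero_apply, ← coeff_zero_eq_eval_zero] at this
        exact X_dvd_iff.mpr this
      choose q hq using hdvd
      refine ⟨Matrix.of q, ?_⟩
      rw [hQ]
      ext1 a b
      simp only [Matrix.smul_apply, smul_eq_mul, Matrix.of_apply, hq]
      ring
  ext1 a b
  obtain ⟨Q, hQ⟩ := key ((P a b).natDegree + 1)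
  have h1 : (X : ℂ[X]) ^ ((P a b).natDegree + 1) ∣ P a b :=
    ⟨Q a b, congrFun (congrFun hQ a) b⟩
  by_contra hne
  have h2 := natDegree_le_of_dvd h1 hne
  rw [natDegree_X_pow] at h2
  omega

/-- Polynomial functions. -/
def IsPoly (f : ℂ → ℂ) : Prop := ∃ p : Polynomial ℂ, ∀ t, f t = p.eval t

theorem IsPoly.const (c : ℂ) : IsPoly fun _ => c := ⟨Polynomial.C c, fun _ => by simp⟩

theorem IsPoly.id : IsPoly fun t => t := ⟨Polynomial.X, fun _ => by simp⟩

theorem IsPoly.add {f g : ℂ → ℂ} (hf : IsPoly f) (hg : IsPoly g) : IsPoly fun t => f t + g t := by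
  obtain ⟨p, hp⟩ := hf
  obtain ⟨q, hq⟩ := hg
  exact ⟨p + q, fun t => by simp only [hp, hq, Polynomial.eval_add]⟩

theorem IsPoly.mul {f g : ℂ → ℂ} (hf : IsPoly f) (hg : IsPoly g) : IsPoly fun t => f t * g t := by
  obtain ⟨p, hp⟩ := hf
  obtain ⟨q, hq⟩ := hg
  exact ⟨p * q, fun t => by simp only [hp, hq, Polynomial.eval_mul]⟩

theorem IsPoly.sub {f g : ℂ → ℂ} (hf : IsPoly f) (hg : IsPoly g) : IsPoly fun t => f t - g t := by
  obtain ⟨p, hp⟩ := hf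
  obtain ⟨q, hq⟩ := hg
  exact ⟨p - q, fun t => by simp only [hp, hq, Polynomial.eval_sub]⟩

theorem IsPoly.sum {ι : Type*} {S : Finset ι} {f : ι → ℂ → ℂ} (hf : ∀ i ∈ S, IsPoly (f i)) :
    IsPoly fun t => ∑ i ∈ S, f i t := by
  classical
  induction S using Finset.induction_on with
  | empty => simpa using IsPoly.const 0
  | insert i S hi ih =>
    simp only [Finset.sum_insert hi]
    exact (hf i (Finset.mem_insert_self _ _)).add
      (ih fun j hj => hf j (Finset.mem_insert_of_mem hj))

theorem IsPoly.prod {ι : Type*} {S : Finset ι} {f : ι → ℂ → ℂ} (hf : ∀ i ∈ S, IsPoly (f i)) :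
    IsPoly fun t => ∏ i ∈ S, f i t := by
  classical
  induction S using Finset.induction_on with
  | empty => simpa using IsPoly.const 1
  | insert i S hi ih =>
    simp only [Finset.prod_insert hi]
    exact (hf i (Finset.mem_insert_self _ _)).mul
      (ih fun j hj => hf j (Finset.mem_insert_of_mem hj))

/-- Matrices whose entries are polynomial functions. -/
def IsPolyMat {m n : Type*} (D : ℂ → Matrix m n ℂ) : Prop := ∀ a b, IsPoly fun t => D t a b

section

variable {m n : Type*}

theorem IsPolyMat.const (M : Matrix m n ℂ) : IsPolyMat fun _ => M := fun _ _ => IsPoly.const _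

theorem IsPolyMat.add {D E : ℂ → Matrix m n ℂ} (hD : IsPolyMat D) (hE : IsPolyMat E) :
    IsPolyMat fun t => D t + E t := fun a b => (hD a b).add (hE a b)

theorem IsPolyMat.sub {D E : ℂ → Matrix m n ℂ} (hD : IsPolyMat D) (hE : IsPolyMat E) :
    IsPolyMat fun t => D t - E t := fun a b => (hD a b).sub (hE a b)

theorem IsPolyMat.smul {f : ℂ → ℂ} {D : ℂ → Matrix m n ℂ} (hf : IsPoly f) (hD : IsPolyMat D) :
    IsPolyMat fun t => f t • D t := fun a b => hf.mul (hD a b)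

theorem IsPolyMat.mul [Fintype m] {D E : ℂ → Matrix m m ℂ} (hD : IsPolyMat D) (hE : IsPolyMat E) :
    IsPolyMat fun t => D t * E t := fun a b => by
  simp only [Matrix.mul_apply]
  exact IsPoly.sum fun c _ => (hD a c).mul (hE c b)

theorem IsPolyMat.kronecker {p q : Type*} {D : ℂ → Matrix m n ℂ} {E : ℂ → Matrix p q ℂ}
    (hD : IsPolyMat D) (hE : IsPolyMat E) : IsPolyMat fun t => D t ⊗ₖ E t := fun a b =>
  (hD a.1 b.1).mul (hE a.2 b.2)

theorem IsPolyMat.liftMat {T : Type*} [Fintype m] [DecidableEq m] [Fintype T]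
    (e : T ≃ (m × m) × m) {D : ℂ → Matrix (m × m) (m × m) ℂ} (hD : IsPolyMat D) :
    IsPolyMat fun t => liftMat e (D t) := fun a b =>
  (hD.kronecker (IsPolyMat.const 1)) (e a) (e b)

end

theorem eq_zero_of_isPolyMat {ι J : Type*} [Fintype ι] [DecidableEq ι]
    {D : ℂ → Matrix ι ι ℂ} {A B : J → ℂ → Matrix ι ι ℂ} (hD : IsPolyMat D)
    (hA : ∀ j, IsPolyMat (A j)) (hB : ∀ j, IsPolyMat (B j))
    (h : ∀ j t, D t * A j t = B j t * D t) (o : ι) (ho : ∀ t a, D t a o = 0)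
    (H : ∀ D' : Matrix ι ι ℂ, (∀ j, D' * A j 0 = B j 0 * D') → (∀ a, D' a o = 0) → D' = 0) (t : ℂ) :
    D t = 0 := by
  choose P hP using hD
  choose PA hPA using hA
  choose PB hPB using hB
  have eD : ∀ t, D t = (Polynomial.evalRingHom t).mapMatrix (Matrix.of P) := fun t => by
    ext a b; exact hP a b t
  have eA : ∀ j t, A j t = (Polynomial.evalRingHom t).mapMatrix (Matrix.of (PA j)) := fun j t => by
    ext a b; exact hPA j a b t
  have eB : ∀ j t, B j t = (Polynomial.evalRingHom t).mapMatrix (Matrix.of (PB j)) := fun j t => by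
    ext a b; exact hPB j a b t
  have : Matrix.of P = 0 := by
    refine eq_zero_of_polynomial_relations (A := fun j => Matrix.of (PA j))
      (B := fun j => Matrix.of (PB j)) (fun j => ?_) o (fun a => ?_) (fun D' hD' hD0 => ?_)
    · ext1 a b
      refine Polynomial.funext fun t => ?_
      have := h j t
      rw [eD, eA, eB, ← map_mul (Polynomial.evalRingHom t).mapMatrix,
        ← map_mul (Polynomial.evalRingHom t).mapMatrix] at this
      exact congrFun (congrFun this a) b
    · refine Polynomial.funext fun t => ?_
      exact (hP a o t).symm.trans ((ho t a).trans Polynomial.eval_zero.symm)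
    · refine H D' (fun j => ?_) hD0
      rw [eA, eB]
      exact hD' j
  rw [eD, this, map_zero]

end PolynomialFamilies

/-! ### The Yang-Baxter equation in the irreducible case -/

section Kernel

variable {N : ℕ} {s : ℤ} {φ θ θ₁ θ₂ θ₃ : ℕ → ℂ} {p₁ p₂ p₃ : ℂ}

local notation "ε" => epsPow N s
local notation "qn" => qNum N s

/-- Neighbouring values differ exactly when [2] ≠ 0, that is for N ≥ 3. This is where the case N = 2
separates. -/
theorem crossVal_sub_crossVal_succ (hN : 2 ≤ N) (hs : IsCoprime s (N : ℤ)) (p : ℂ) (a : ℕ) :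
    crossVal N s p (ε 2) a - crossVal N s p (ε 2) (a + 1) = ε (2 * (p - a)) * qn 2 := by
  have hE : ε 1 ^ 2 - 1 ≠ 0 := eps_one_sq_sub_one_ne_zero hN hs
  have h0 := eps_ne_zero (N := N) (s := s)
  simp only [crossVal]
  rw [qNum_two hN hs, show (2 : ℂ) = 1 + 1 by norm_num]
  push_cast
  simp only [qNum_eq hN hs, add_mul, one_mul, mul_add, mul_sub, eps_add, eps_sub, eps_neg]
  field_simp
  ring

theorem sum_mul_lowerMat (w : Fin N → ℂ) (b : Fin N) :
    ∑ c, w c * (raiseMat θ φ N).transpose c b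
      = if h : (b : ℕ) + 1 < N then w ⟨b + 1, h⟩ * (θ b * φ b) else 0 := by
  simp only [Matrix.transpose_apply, raiseMat, Matrix.of_apply]
  split_ifs with h
  · rw [Finset.sum_eq_single (⟨b + 1, h⟩ : Fin N)]
    · simp
    · intro c _ hc
      rw [if_neg fun h' => hc (Fin.ext h'.symm), mul_zero]
    · simp
  · refine Finset.sum_eq_zero fun c _ => ?_
    rw [if_neg (by omega), mul_zero]

theorem sum_mul_diagonal {n : Type*} [Fintype n] [DecidableEq n] (w g : n → ℂ) (b : n) :
    ∑ c, w c * Matrix.diagonal g c b = w b * g b := by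
  simp [Matrix.diagonal_apply]

theorem sum_mul_kronecker {n : Type*} [Fintype n] (w : n × n × n → ℂ) (A B C : Matrix n n ℂ)
    (b : n × n × n) : ∑ c, w c * (A ⊗ₖ (B ⊗ₖ C)) c b
      = ∑ c₁, (∑ c₂, (∑ c₃, w (c₁, c₂, c₃) * C c₃ b.2.2) * B c₂ b.2.1) * A c₁ b.1 := by
  simp only [Fintype.sum_prod_type, Finset.sum_mul, Matrix.kroneckerMap_apply]
  exact Finset.sum_congr rfl fun _ _ => Finset.sum_congr rfl fun _ _ =>
    Finset.sum_congr rfl fun _ _ => by ring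

/-- `X⁻` by the comultiplication on three factors. -/
def lowerTriple (N : ℕ) (s : ℤ) (p₁ p₂ p₃ : ℂ) (φ θ₁ θ₂ θ₃ : ℕ → ℂ) :
    Matrix (Fin N × Fin N × Fin N) (Fin N × Fin N × Fin N) ℂ :=
  (raiseMat θ₁ φ N).transpose ⊗ₖ (torusMat N s p₂ N ⊗ₖ torusMat N s p₃ N)
    + torusInv N s p₁ N ⊗ₖ ((raiseMat θ₂ φ N).transpose ⊗ₖ torusMat N s p₃ N)
    + torusInv N s p₁ N ⊗ₖ (torusInv N s p₂ N ⊗ₖ (raiseMat θ₃ φ N).transpose)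

/-- The operator X⁺ ⊗ ε^(-H/2) ⊗ ε^(-H/2) is what remains of the rescaled X₀⁻ at parameter 0. Its
twisted commutator with X⁻ sees only the first site and so measures the first index. -/
theorem lowerTriple_cross (hN : 2 ≤ N) (hs : IsCoprime s (N : ℤ))
    (hφ : ∀ k : ℕ, φ k ^ 2 = qn ((k : ℂ) + 1)) (hθ₁ : ∀ k : ℕ, θ₁ k ^ 2 = qn (2 * p₁ - k)) :
    raiseMat θ₁ φ N ⊗ₖ (torusInv N s p₂ N ⊗ₖ torusInv N s p₃ N)
          * lowerTriple N s p₁ p₂ p₃ φ θ₁ θ₂ θ₃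
        - ε 2 • (lowerTriple N s p₁ p₂ p₃ φ θ₁ θ₂ θ₃
          * raiseMat θ₁ φ N ⊗ₖ (torusInv N s p₂ N ⊗ₖ torusInv N s p₃ N))
      = Matrix.diagonal fun a : Fin N × Fin N × Fin N => crossVal N s p₁ (ε 2) a.1 := by
  have h3 : ε 2 * ε (-1) = ε 1 := by rw [← eps_add]; norm_num
  have hd : (Matrix.diagonal fun a : Fin N × Fin N × Fin N => crossVal N s p₁ (ε 2) a.1)
      = (raiseMat θ₁ φ N * (raiseMat θ₁ φ N).transpose
        - ε 2 • ((raiseMat θ₁ φ N).transpose * raiseMat θ₁ φ N)) ⊗ₖ (1 ⊗ₖ 1) := by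
    rw [raiseMat_mul_lowerMat hN hs hφ hθ₁, lowerMat_mul_raiseMat hφ hθ₁, ← Matrix.diagonal_smul,
      Matrix.diagonal_sub, Matrix.one_kronecker_one, ← Matrix.diagonal_one,
      Matrix.diagonal_kronecker_diagonal]
    congr 1; ext a
    simp only [mul_one]
    rfl
  rw [hd]
  simp only [lowerTriple, add_mul, mul_add, ← Matrix.mul_kronecker_mul,
    torusMat_mul_torusInv, torusInv_mul_torusMat, torusInv_mul_lowerMat, torusInv_mul_raiseMat,
    Matrix.smul_kronecker, Matrix.kronecker_smul, smul_add, smul_smul, h3, sub_eq_add_neg,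
    Matrix.add_kronecker]
  rw [← neg_one_smul ℂ (ε 2 • _), Matrix.smul_kronecker, Matrix.smul_kronecker]
  module

/-- A matrix that is compatible with these operators and kills the highest weight vector is zero. -/
theorem eq_zero_of_triple_relations (hN : 3 ≤ N) (hs : IsCoprime s (N : ℤ))
    (hφ : ∀ k : ℕ, φ k ^ 2 = qn ((k : ℂ) + 1)) (hθ₁ : ∀ k : ℕ, θ₁ k ^ 2 = qn (2 * p₁ - k))
    (hc₁ : ∀ a, a + 1 < N → θ₁ a * φ a ≠ 0) (hc₂ : ∀ a, a + 1 < N → θ₂ a * φ a ≠ 0)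
    (hc₃ : ∀ a, a + 1 < N → θ₃ a * φ a ≠ 0)
    {D F' L' U' : Matrix (Fin N × Fin N × Fin N) (Fin N × Fin N × Fin N) ℂ}
    (hF : D * lowerTriple N s p₁ p₂ p₃ φ θ₁ θ₂ θ₃ = F' * D)
    (hL : D * torusMat N s p₁ N ⊗ₖ (torusMat N s p₂ N ⊗ₖ (raiseMat θ₃ φ N).transpose) = L' * D)
    (hU : D * raiseMat θ₁ φ N ⊗ₖ (torusInv N s p₂ N ⊗ₖ torusInv N s p₃ N) = U' * D)
    (h0 : ∀ a, D a (⟨0, three_pos.trans_le hN⟩, ⟨0, three_pos.trans_le hN⟩,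
      ⟨0, three_pos.trans_le hN⟩) = 0) : D = 0 := by
  have hN2 : 2 ≤ N := by omega
  have h2 : qn 2 ≠ 0 := by
    have := qNum_natCast_ne_zero hN2 hs (k := 2) (by omega) (by omega)
    exact_mod_cast this
  -- The diagonal operator is a polynomial in operators that D intertwines, so D intertwines its
  -- product with X⁻ as well.
  have hY : D * ((Matrix.diagonal fun a : Fin N × Fin N × Fin N => crossVal N s p₁ (ε 2) a.1)
      * lowerTriple N s p₁ p₂ p₃ φ θ₁ θ₂ θ₃) = (U' * F' - ε 2 • (F' * U')) * F' * D := by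
    rw [← lowerTriple_cross (p₂ := p₂) (p₃ := p₃) (θ₂ := θ₂) (θ₃ := θ₃) hN2 hs hφ hθ₁, ← mul_assoc,
      mul_sub, ← mul_assoc, hU, mul_smul_comm, ← mul_assoc, hF, mul_assoc U', hF, mul_assoc F', hU,
      ← mul_assoc, ← mul_assoc, ← smul_mul_assoc, ← sub_mul, mul_assoc, hF, ← mul_assoc]
  have zero_of : ∀ {M M' : Matrix (Fin N × Fin N × Fin N) (Fin N × Fin N × Fin N) ℂ},
      D * M = M' * D → ∀ b, (∀ a, D a b = 0) → ∀ a, ∑ c, D a c * M c b = 0 := by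
    intro M M' h b hb a
    rw [← Matrix.mul_apply, h, Matrix.mul_apply]
    exact Finset.sum_eq_zero fun c _ => by rw [hb, mul_zero]
  have lower : ∀ (w : Fin N × Fin N × Fin N → ℂ) (b : Fin N × Fin N × Fin N),
      ∑ c, w c * lowerTriple N s p₁ p₂ p₃ φ θ₁ θ₂ θ₃ c b
        = (if h : (b.1 : ℕ) + 1 < N then w (⟨b.1 + 1, h⟩, b.2.1, b.2.2)
            * (ε (p₃ - (b.2.2 : ℕ)) * ε (p₂ - (b.2.1 : ℕ)) * (θ₁ b.1 * φ b.1)) else 0)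
          + (if h : (b.2.1 : ℕ) + 1 < N then w (b.1, ⟨b.2.1 + 1, h⟩, b.2.2)
            * (ε (p₃ - (b.2.2 : ℕ)) * (θ₂ b.2.1 * φ b.2.1) * ε (-(p₁ - (b.1 : ℕ)))) else 0)
          + (if h : (b.2.2 : ℕ) + 1 < N then w (b.1, b.2.1, ⟨b.2.2 + 1, h⟩)
            * ((θ₃ b.2.2 * φ b.2.2) * ε (-(p₂ - (b.2.1 : ℕ))) * ε (-(p₁ - (b.1 : ℕ)))) else 0) := by
    intro w b
    simp only [lowerTriple, Matrix.add_apply, mul_add, Finset.sum_add_distrib, sum_mul_kronecker,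
      torusMat, torusInv, sum_mul_diagonal, sum_mul_lowerMat]
    congr 1
    · congr 1
      · split_ifs <;> ring
      · split_ifs <;> ring
    · split_ifs <;> ring
  have step : ∀ b : Fin N × Fin N × Fin N, (∀ a, D a b = 0) →
      (∀ h : (b.1 : ℕ) + 1 < N, ∀ a, D a (⟨b.1 + 1, h⟩, b.2.1, b.2.2) = 0) ∧
      (∀ h : (b.2.1 : ℕ) + 1 < N, ∀ a, D a (b.1, ⟨b.2.1 + 1, h⟩, b.2.2) = 0) ∧
      (∀ h : (b.2.2 : ℕ) + 1 < N, ∀ a, D a (b.1, b.2.1, ⟨b.2.2 + 1, h⟩) = 0) := by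
    intro b hb
    have e0 := eps_ne_zero (N := N) (s := s)
    -- `hL` lowers the third site alone.
    have s3 : ∀ h : (b.2.2 : ℕ) + 1 < N, ∀ a, D a (b.1, b.2.1, ⟨b.2.2 + 1, h⟩) = 0 := by
      intro h a
      have z := zero_of hL b hb a
      simp only [sum_mul_kronecker, torusMat, sum_mul_diagonal, sum_mul_lowerMat, dif_pos h] at z
      simpa [e0, hc₃ _ h] using z
    -- Plain X⁻ and X⁻ weighted by `crossVal` give two equations for the remaining neighbours. The
    -- second-site neighbour carries the value at b₁ and the first-site one the value at b₁ + 1, so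
    -- a combination isolates the latter.
    have s1 : ∀ h : (b.1 : ℕ) + 1 < N, ∀ a, D a (⟨b.1 + 1, h⟩, b.2.1, b.2.2) = 0 := by
      intro h a
      have z1 := zero_of hF b hb a
      have z2 := zero_of (M := _ * _) hY b hb a
      simp only [Matrix.diagonal_mul, ← mul_assoc] at z2
      rw [lower (fun c => D a c * crossVal N s p₁ (ε 2) c.1)] at z2
      rw [lower] at z1
      rw [dif_pos h] at z1 z2
      simp only [s3, zero_mul, dite_eq_ite, ite_self, add_zero] at z1 z2
      have hne := crossVal_sub_crossVal_succ hN2 hs p₁ (b.1 : ℕ)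
      have : D a (⟨b.1 + 1, h⟩, b.2.1, b.2.2) * (ε (p₃ - (b.2.2 : ℕ)) * ε (p₂ - (b.2.1 : ℕ))
          * (θ₁ b.1 * φ b.1)) * (ε (2 * (p₁ - (b.1 : ℕ))) * qn 2) = 0 := by
        rw [← hne]
        by_cases h' : (b.2.1 : ℕ) + 1 < N
        · rw [dif_pos h'] at z1 z2
          linear_combination crossVal N s p₁ (ε 2) b.1 * z1 - z2
        · rw [dif_neg h'] at z1 z2
          linear_combination crossVal N s p₁ (ε 2) b.1 * z1 - z2
      simpa [e0, hc₁ _ h, h2] using this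
    refine ⟨s1, fun h a => ?_, s3⟩
    have z1 := zero_of hF b hb a
    rw [lower, dif_pos h] at z1
    simp only [s3, s1, zero_mul, dite_eq_ite, ite_self, add_zero, zero_add] at z1
    simpa [e0, hc₂ _ h] using z1
  have key : ∀ w : ℕ, ∀ b : Fin N × Fin N × Fin N, (b.1 : ℕ) + b.2.1 + b.2.2 = w →
      ∀ a, D a b = 0 := by
    intro w
    induction w with
    | zero =>
      rintro ⟨⟨b₁, h₁⟩, ⟨b₂, h₂⟩, ⟨b₃, h₃⟩⟩ hb a
      simp only at hb
      obtain rfl : b₁ = 0 := by omega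
      obtain rfl : b₂ = 0 := by omega
      obtain rfl : b₃ = 0 := by omega
      exact h0 a
    | succ w ih =>
      rintro ⟨⟨b₁, h₁⟩, ⟨b₂, h₂⟩, ⟨b₃, h₃⟩⟩ hb a
      simp only at hb
      rcases b₁ with _ | b₁
      · rcases b₂ with _ | b₂
        · obtain ⟨b₃, rfl⟩ : ∃ b, b₃ = b + 1 := ⟨b₃ - 1, by omega⟩
          exact (step (⟨0, h₁⟩, ⟨0, h₂⟩, ⟨b₃, by omega⟩) (ih _ (by simp only; omega))).2.2 h₃ a
        · exact (step (⟨0, h₁⟩, ⟨b₂, by omega⟩, ⟨b₃, h₃⟩) (ih _ (by simp only; omega))).2.1 h₂ a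
      · exact (step (⟨b₁, by omega⟩, ⟨b₂, h₂⟩, ⟨b₃, h₃⟩) (ih _ (by simp only; omega))).1 h₁ a
  ext a b
  exact key _ b rfl a

end Kernel

/-! ### Polynomial R-matrices and the scaling argument -/

section YangBaxter

variable {N : ℕ} {s : ℤ} {φ θ₁ θ₂ θ₃ : ℕ → ℂ} {p₁ p₂ p₃ x y : ℂ}

local notation "ε" => epsPow N s
local notation "qn" => qNum N s

/-- The coefficients `gCoeff` with denominators cleared, as polynomials in the spectral
parameter. -/
def gHat (N : ℕ) (s : ℤ) (P x : ℂ) (n : ℕ) : ℂ :=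
  (∏ k ∈ Finset.range n, (x * epsPow N s (2 * (P - k)) - 1))
    * ∏ k ∈ Finset.Ico n (N - 1), (epsPow N s (2 * (P - k)) - x)

theorem gHat_recursion (P x : ℂ) {n : ℕ} (hn : n + 1 < N) :
    gHat N s P x (n + 1) * (ε (P - n) - x * ε (-(P - n)))
      - gHat N s P x n * (x * ε (P - n) - ε (-(P - n))) = 0 := by
  have h0 := eps_ne_zero (N := N) (s := s) (P - n)
  rw [gHat, gHat, Finset.prod_range_succ, Finset.prod_eq_prod_Ico_succ_bot (by omega : n < N - 1),
    eps_two_mul, eps_neg]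
  field_simp
  ring

theorem IsPoly.gHat {f : ℂ → ℂ} (hf : IsPoly f) (P : ℂ) (n : ℕ) :
    IsPoly fun t => gHat N s P (f t) n :=
  (IsPoly.prod fun _ _ => (hf.mul (IsPoly.const _)).sub (IsPoly.const _)).mul
    (IsPoly.prod fun _ _ => (IsPoly.const _).sub hf)

/-- The `R`-matrix with denominators cleared. -/
def rHat (N : ℕ) (s : ℤ) (p₁ p₂ : ℂ) (φ θ₁ θ₂ : ℕ → ℂ) (x : ℂ) :
    Matrix (Fin N × Fin N) (Fin N × Fin N) ℂ :=
  rGen N s p₁ p₂ φ θ₁ θ₂ (gHat N s (p₁ + p₂) x)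

theorem IsPolyMat.rHat {f : ℂ → ℂ} (hf : IsPoly f) :
    IsPolyMat fun t => rHat N s p₁ p₂ φ θ₁ θ₂ (f t) := fun _ _ =>
  IsPoly.sum fun _ _ => (((hf.gHat _ _).mul (IsPoly.const _)).mul (IsPoly.const _)).mul
    (IsPoly.const _)

theorem affineRel_rHat (h : RootData N s p₁ p₂ φ θ₁ θ₂) (x : ℂ) :
    AffineRel (raiseMat θ₁ φ N) (torusMat N s p₁ N) (torusInv N s p₁ N) (raiseMat θ₂ φ N)
      (torusMat N s p₂ N) (torusInv N s p₂ N) x (rHat N s p₁ p₂ φ θ₁ θ₂ x) :=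
  affineRel_rGen h fun _ hn => mul_eq_zero_of_right _ (gHat_recursion _ _ hn)

section

variable {n : Type*} [Fintype n] [DecidableEq n] {X₁ K₁ L₁ X₂ K₂ L₂ : Matrix n n ℂ}
  {M : Matrix (n × n) (n × n) ℂ}

omit [DecidableEq n] in
theorem AffineRel.exchange (h : AffineRel X₁ K₁ L₁ X₂ K₂ L₂ x M) :
    Exchange X₁.transpose K₁ L₁ X₂.transpose K₂ L₂ M :=
  ⟨h.2.2.2.1, h.1, h.2.1⟩

-- For the affine node H₀ = -H, so the roles of K and L are exchanged. The spectral parameter is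
-- distributed over the sites as weights whose ratio is x, so that three pairwise relations can
-- share one threefold coproduct.
omit [DecidableEq n] in
theorem AffineRel.exchange_lower (h : AffineRel X₁ K₁ L₁ X₂ K₂ L₂ x M) {z₁ z₂ : ℂ}
    (hz : z₁ = x * z₂) :
    Exchange (z₁ • X₁.transpose) L₁ K₁ (z₂ • X₂.transpose) L₂ K₂ M := by
  refine ⟨?_, h.2.1, h.1⟩
  have e := congrArg (fun A => z₂ • A) h.2.2.2.2.1
  simp only at e
  rw [← mul_smul_comm, ← smul_mul_assoc] at e
  simp only [smul_add, smul_smul] at e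
  rw [Matrix.smul_kronecker, Matrix.kronecker_smul, Matrix.smul_kronecker, Matrix.kronecker_smul,
    hz, mul_comm x]
  exact e

omit [DecidableEq n] in
theorem AffineRel.exchange_raise (h : AffineRel X₁ K₁ L₁ X₂ K₂ L₂ x M) {w₁ w₂ : ℂ}
    (hw : w₂ = x * w₁) : Exchange (w₁ • X₁) L₁ K₁ (w₂ • X₂) L₂ K₂ M := by
  refine ⟨?_, h.2.1, h.1⟩
  have e := congrArg (fun A => w₁ • A) h.2.2.2.2.2
  simp only at e
  rw [← mul_smul_comm, ← smul_mul_assoc] at e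
  simp only [smul_add, smul_smul] at e
  rw [Matrix.smul_kronecker, Matrix.kronecker_smul, Matrix.smul_kronecker, Matrix.kronecker_smul,
    hw, mul_comm x]
  exact e

end

/-- If `M` fixes the weights, the highest weight vector is an eigenvector of all products. -/
theorem ybDiff_apply_zero {d : ℕ} (hd : 0 < d)
    {M₁₂ M₁₃ M₂₃ : Matrix (Fin d × Fin d) (Fin d × Fin d) ℂ}
    (h₁₂ : ∀ a, a ≠ (⟨0, hd⟩, ⟨0, hd⟩) → M₁₂ a (⟨0, hd⟩, ⟨0, hd⟩) = 0)
    (h₁₃ : ∀ a, a ≠ (⟨0, hd⟩, ⟨0, hd⟩) → M₁₃ a (⟨0, hd⟩, ⟨0, hd⟩) = 0)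
    (h₂₃ : ∀ a, a ≠ (⟨0, hd⟩, ⟨0, hd⟩) → M₂₃ a (⟨0, hd⟩, ⟨0, hd⟩) = 0)
    (a : Fin d × Fin d × Fin d) : ybDiff M₁₂ M₁₃ M₂₃ a (⟨0, hd⟩, ⟨0, hd⟩, ⟨0, hd⟩) = 0 := by
  set o : Fin d := ⟨0, hd⟩
  have f12 : ∀ a, M₁₂ a (o, o) = if a = (o, o) then M₁₂ (o, o) (o, o) else 0 := fun a => by
    split_ifs with h
    · rw [h]
    · exact h₁₂ a h
  have f13 : ∀ a, M₁₃ a (o, o) = if a = (o, o) then M₁₃ (o, o) (o, o) else 0 := fun a => by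
    split_ifs with h
    · rw [h]
    · exact h₁₃ a h
  have f23 : ∀ a, M₂₃ a (o, o) = if a = (o, o) then M₂₃ (o, o) (o, o) else 0 := fun a => by
    split_ifs with h
    · rw [h]
    · exact h₂₃ a h
  have l12 : (liftMat (pairOneTwo (Fin d)) M₁₂).mulVec (Pi.single (o, o, o) 1)
      = M₁₂ (o, o) (o, o) • Pi.single (o, o, o) 1 := by
    ext a
    rw [Matrix.mulVec_single_one, Matrix.col_apply, liftMat, Matrix.submatrix_apply,
      Matrix.kroneckerMap_apply]
    simp only [pairOneTwo, Equiv.coe_fn_mk]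
    rw [f12]
    obtain ⟨a₁, a₂, a₃⟩ := a
    by_cases h1 : a₁ = o <;> by_cases h2 : a₂ = o <;> by_cases h3 : a₃ = o <;>
      simp [h1, h2, h3, pairOneTwo, Matrix.one_apply]
  have l13 : (liftMat (pairOneThree (Fin d)) M₁₃).mulVec (Pi.single (o, o, o) 1)
      = M₁₃ (o, o) (o, o) • Pi.single (o, o, o) 1 := by
    ext a
    rw [Matrix.mulVec_single_one, Matrix.col_apply, liftMat, Matrix.submatrix_apply,
      Matrix.kroneckerMap_apply]
    simp only [pairOneThree, Equiv.coe_fn_mk]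
    rw [f13]
    obtain ⟨a₁, a₂, a₃⟩ := a
    by_cases h1 : a₁ = o <;> by_cases h2 : a₂ = o <;> by_cases h3 : a₃ = o <;>
      simp [h1, h2, h3, pairOneThree, Matrix.one_apply]
  have l23 : (liftMat (pairTwoThree (Fin d)) M₂₃).mulVec (Pi.single (o, o, o) 1)
      = M₂₃ (o, o) (o, o) • Pi.single (o, o, o) 1 := by
    ext a
    rw [Matrix.mulVec_single_one, Matrix.col_apply, liftMat, Matrix.submatrix_apply,
      Matrix.kroneckerMap_apply]
    simp only [pairTwoThree, Equiv.coe_fn_mk]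
    rw [f23]
    obtain ⟨a₁, a₂, a₃⟩ := a
    by_cases h1 : a₁ = o <;> by_cases h2 : a₂ = o <;> by_cases h3 : a₃ = o <;>
      simp [h1, h2, h3, pairTwoThree, Matrix.one_apply]
  have : (ybDiff M₁₂ M₁₃ M₂₃).mulVec (Pi.single (o, o, o) 1) = 0 := by
    rw [ybDiff, Matrix.sub_mulVec, ← Matrix.mulVec_mulVec, l12, Matrix.mulVec_smul,
      ← Matrix.mulVec_mulVec, l13, Matrix.mulVec_smul, l23, ← Matrix.mulVec_mulVec, l23,
      Matrix.mulVec_smul, ← Matrix.mulVec_mulVec, l13, Matrix.mulVec_smul, l12]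
    simp only [smul_smul]
    rw [← sub_smul]
    rw [show M₁₂ (o, o) (o, o) * (M₁₃ (o, o) (o, o) * M₂₃ (o, o) (o, o))
      - M₂₃ (o, o) (o, o) * (M₁₃ (o, o) (o, o) * M₁₂ (o, o) (o, o)) = 0 by ring, zero_smul]
  have h := congrFun this a
  rwa [Matrix.mulVec_single_one, Matrix.col_apply] at h

theorem rGen_apply_zero (G : ℕ → ℂ) (hd : 0 < N) (a : Fin N × Fin N)
    (ha : a ≠ (⟨0, hd⟩, ⟨0, hd⟩)) :
    rGen N s p₁ p₂ φ θ₁ θ₂ G a (⟨0, hd⟩, ⟨0, hd⟩) = 0 := by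
  refine rGen_apply_of_ne fun h => ha ?_
  simp only at h
  exact Prod.ext (Fin.ext (by simp only; omega)) (Fin.ext (by simp only; omega))

/-- The difference is embedded in a polynomial family in t whose value at t = 1 is wanted and whose
relations are tractable at t = 0. -/
theorem ybDiff_rHat_of_irreducible (hN : 3 ≤ N) (h₁₂ : RootData N s p₁ p₂ φ θ₁ θ₂)
    (h₁₃ : RootData N s p₁ p₃ φ θ₁ θ₃) (h₂₃ : RootData N s p₂ p₃ φ θ₂ θ₃)
    (hp₁ : IrreducibleColor N s p₁) (hp₂ : IrreducibleColor N s p₂)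
    (hp₃ : IrreducibleColor N s p₃) (x y : ℂ) :
    ybDiff (rHat N s p₁ p₂ φ θ₁ θ₂ x) (rHat N s p₁ p₃ φ θ₁ θ₃ (x * y))
      (rHat N s p₂ p₃ φ θ₂ θ₃ y) = 0 := by
  have hφ0 : ∀ a, a + 1 < N → φ a ≠ 0 := fun a ha h => by
    have := h₁₂.sq_phi a
    rw [h, zero_pow two_ne_zero] at this
    exact qNum_succ_ne_zero h₁₂.two_le h₁₂.coprime ha this.symm
  have hc : ∀ (θ : ℕ → ℂ) (p : ℂ), (∀ k : ℕ, θ k ^ 2 = qn (2 * p - k)) → IrreducibleColor N s p →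
      ∀ a, a + 1 < N → θ a * φ a ≠ 0 := fun θ p hθ hp a ha => by
    refine mul_ne_zero (fun h => ?_) (hφ0 a ha)
    have := hθ a
    rw [h, zero_pow two_ne_zero] at this
    exact hp a ha this.symm
  set X₁ := raiseMat θ₁ φ N with hX₁
  set X₂ := raiseMat θ₂ φ N with hX₂
  set X₃ := raiseMat θ₃ φ N with hX₃
  set K₁ := torusMat N s p₁ N with hK₁
  set K₂ := torusMat N s p₂ N with hK₂
  set K₃ := torusMat N s p₃ N with hK₃
  set L₁ := torusInv N s p₁ N with hL₁
  set L₂ := torusInv N s p₂ N with hL₂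
  set L₃ := torusInv N s p₃ N with hL₃
  -- Both x and y are scaled by t, hence xy by t². The site weights t²xy, ty, 1 for X⁻ and 1, tx,
  -- t²xy for X⁺ then have the required ratios, are polynomial in t, and at t = 0 leave a single
  -- term each.
  have a12 := fun t : ℂ => affineRel_rHat h₁₂ (t * x)
  have a13 := fun t : ℂ => affineRel_rHat h₁₃ (t * t * (x * y))
  have a23 := fun t : ℂ => affineRel_rHat h₂₃ (t * y)
  have key := eq_zero_of_isPolyMat (ι := Fin N × Fin N × Fin N) (J := Fin 3)
    (D := fun t => ybDiff (rHat N s p₁ p₂ φ θ₁ θ₂ (t * x)) (rHat N s p₁ p₃ φ θ₁ θ₃ (t * t * (x * y)))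
      (rHat N s p₂ p₃ φ θ₂ θ₃ (t * y)))
    (A := ![fun _ => X₁.transpose ⊗ₖ (K₂ ⊗ₖ K₃) + L₁ ⊗ₖ (X₂.transpose ⊗ₖ K₃)
        + L₁ ⊗ₖ (L₂ ⊗ₖ X₃.transpose),
      fun t => ((t * t * (x * y)) • X₁.transpose) ⊗ₖ (L₂ ⊗ₖ L₃)
        + K₁ ⊗ₖ (((t * y) • X₂.transpose) ⊗ₖ L₃) + K₁ ⊗ₖ (K₂ ⊗ₖ ((1 : ℂ) • X₃.transpose)),
      fun t => ((1 : ℂ) • X₁) ⊗ₖ (L₂ ⊗ₖ L₃)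
        + K₁ ⊗ₖ (((t * x) • X₂) ⊗ₖ L₃) + K₁ ⊗ₖ (K₂ ⊗ₖ ((t * t * (x * y)) • X₃))])
    (B := ![fun _ => X₁.transpose ⊗ₖ (L₂ ⊗ₖ L₃) + K₁ ⊗ₖ (X₂.transpose ⊗ₖ L₃)
        + K₁ ⊗ₖ (K₂ ⊗ₖ X₃.transpose),
      fun t => ((t * t * (x * y)) • X₁.transpose) ⊗ₖ (K₂ ⊗ₖ K₃)
        + L₁ ⊗ₖ (((t * y) • X₂.transpose) ⊗ₖ K₃) + L₁ ⊗ₖ (L₂ ⊗ₖ ((1 : ℂ) • X₃.transpose)),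
      fun t => ((1 : ℂ) • X₁) ⊗ₖ (K₂ ⊗ₖ K₃)
        + L₁ ⊗ₖ (((t * x) • X₂) ⊗ₖ K₃) + L₁ ⊗ₖ (L₂ ⊗ₖ ((t * t * (x * y)) • X₃))])
    ?_ ?_ ?_ ?_ (⟨0, three_pos.trans_le hN⟩,
      ⟨0, three_pos.trans_le hN⟩, ⟨0, three_pos.trans_le hN⟩) ?_ ?_ 1
  · simpa only [one_mul] using key
  · have p1 : IsPoly fun t => t * x := IsPoly.id.mul (IsPoly.const _)
    have p2 : IsPoly fun t => t * y := IsPoly.id.mul (IsPoly.const _)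
    have p3 : IsPoly fun t => t * t * (x * y) := (IsPoly.id.mul IsPoly.id).mul (IsPoly.const _)
    have m1 := (IsPolyMat.rHat (N := N) (s := s) (φ := φ) (p₁ := p₁) (p₂ := p₂) (θ₁ := θ₁)
      (θ₂ := θ₂) p1).liftMat (pairOneTwo (Fin N))
    have m2 := (IsPolyMat.rHat (N := N) (s := s) (φ := φ) (p₁ := p₂) (p₂ := p₃) (θ₁ := θ₂)
      (θ₂ := θ₃) p2).liftMat (pairTwoThree (Fin N))
    have m3 := (IsPolyMat.rHat (N := N) (s := s) (φ := φ) (p₁ := p₁) (p₂ := p₃) (θ₁ := θ₁)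
      (θ₂ := θ₃) p3).liftMat (pairOneThree (Fin N))
    exact ((m2.mul m3).mul m1).sub ((m1.mul m3).mul m2)
  · have p1 : IsPoly fun t => t * x := IsPoly.id.mul (IsPoly.const _)
    have p2 : IsPoly fun t => t * y := IsPoly.id.mul (IsPoly.const _)
    have p3 : IsPoly fun t => t * t * (x * y) := (IsPoly.id.mul IsPoly.id).mul (IsPoly.const _)
    have c := fun M : Matrix (Fin N) (Fin N) ℂ => IsPolyMat.const M
    intro j
    fin_cases j
    · exact IsPolyMat.const _
    · exact ((((c _).smul p3).kronecker ((c _).kronecker (c _))).add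
        ((c _).kronecker (((c _).smul p2).kronecker (c _)))).add
          ((c _).kronecker ((c _).kronecker (c _)))
    · exact (((c _).kronecker ((c _).kronecker (c _))).add
        ((c _).kronecker (((c _).smul p1).kronecker (c _)))).add
          ((c _).kronecker ((c _).kronecker ((c _).smul p3)))
  · have p1 : IsPoly fun t => t * x := IsPoly.id.mul (IsPoly.const _)
    have p2 : IsPoly fun t => t * y := IsPoly.id.mul (IsPoly.const _)
    have p3 : IsPoly fun t => t * t * (x * y) := (IsPoly.id.mul IsPoly.id).mul (IsPoly.const _)
    have c := fun M : Matrix (Fin N) (Fin N) ℂ => IsPolyMat.const M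
    intro j
    fin_cases j
    · exact IsPolyMat.const _
    · exact ((((c _).smul p3).kronecker ((c _).kronecker (c _))).add
        ((c _).kronecker (((c _).smul p2).kronecker (c _)))).add
          ((c _).kronecker ((c _).kronecker (c _)))
    · exact (((c _).kronecker ((c _).kronecker (c _))).add
        ((c _).kronecker (((c _).smul p1).kronecker (c _)))).add
          ((c _).kronecker ((c _).kronecker ((c _).smul p3)))
  · intro j t
    fin_cases j
    · exact ybDiff_mul (a12 t).exchange (a13 t).exchange (a23 t).exchange
    · exact ybDiff_mul ((a12 t).exchange_lower (by ring)) ((a13 t).exchange_lower (by ring))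
        ((a23 t).exchange_lower (by ring))
    · exact ybDiff_mul ((a12 t).exchange_raise (by ring)) ((a13 t).exchange_raise (by ring))
        ((a23 t).exchange_raise (by ring))
  · intro t a
    exact ybDiff_apply_zero (by omega) (rGen_apply_zero _ _) (rGen_apply_zero _ _)
      (rGen_apply_zero _ _) a
  · intro D hD h0
    have r0 := hD 0
    have r1 := hD 1
    have r2 := hD 2
    simp only [Matrix.cons_val, zero_mul, zero_smul, one_smul, Matrix.zero_kronecker,
      Matrix.kronecker_zero, zero_add, add_zero] at r0 r1 r2
    exact eq_zero_of_triple_relations hN h₁₂.coprime h₁₂.sq_phi h₁₂.sq_left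
      (hc _ _ h₁₂.sq_left hp₁) (hc _ _ h₂₃.sq_left hp₂) (hc _ _ h₂₃.sq_right hp₃) r0 r1 r2 h0

end YangBaxter

/-! ### Continuity in the highest weights -/

open Filter Topology in
theorem qNum_add_mul_eventually_ne_zero {N : ℕ} {s : ℤ} (hN : 2 ≤ N) (hs : IsCoprime s (N : ℤ))
    (x : ℂ) {c : ℂ} (hc : c ≠ 0) : ∀ᶠ t in 𝓝[≠] (0 : ℂ), qNum N s (x + c * t) ≠ 0 := by
  have hs0 : s ≠ 0 := fun h => by
    rw [h, isCoprime_zero_left, Int.isUnit_iff] at hs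
    omega
  have hd : HasDerivAt (fun t => epsPow N s (2 * (x + c * t)))
      (epsPow N s (2 * (x + c * 0)) * (Real.pi * Complex.I * s * (2 * (c * 1)) / N)) 0 := by
    unfold epsPow
    exact (((((hasDerivAt_id (0 : ℂ)).const_mul c).const_add x).const_mul 2).const_mul
      (Real.pi * Complex.I * s : ℂ)).div_const (N : ℂ) |>.cexp
  have hne : epsPow N s (2 * (x + c * 0)) * (Real.pi * Complex.I * s * (2 * (c * 1)) / N) ≠ 0 := by
    have h1 : (N : ℂ) ≠ 0 := by exact_mod_cast (by omega : N ≠ 0)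
    have h2 : (s : ℂ) ≠ 0 := by exact_mod_cast hs0
    have h3 : (Real.pi : ℂ) ≠ 0 := by exact_mod_cast Real.pi_ne_zero
    exact mul_ne_zero (eps_ne_zero _) (div_ne_zero (mul_ne_zero (mul_ne_zero (mul_ne_zero h3
      Complex.I_ne_zero) h2) (mul_ne_zero two_ne_zero (mul_ne_zero hc one_ne_zero))) h1)
  -- A nonzero derivative keeps ε^(2(x + ct)) away from 1 in a punctured neighbourhood, whether or
  -- not it equals 1 at t = 0.
  filter_upwards [hd.eventually_ne (c := 1) hne] with t ht h
  exact ht ((qNum_eq_zero_iff hN hs _).mp h)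

/-- A square root close to a given number. -/
theorem exists_sq_eq_norm_sub_sq_le (w c : ℂ) : ∃ v : ℂ, v ^ 2 = w ∧ ‖v - c‖ ^ 2 ≤ ‖w - c ^ 2‖ := by
  obtain ⟨v, hv⟩ := IsAlgClosed.exists_pow_nat_eq w (n := 2) two_pos
  rcases le_total ‖v - c‖ ‖v + c‖ with h | h
  · refine ⟨v, hv, ?_⟩
    rw [← hv, show v ^ 2 - c ^ 2 = (v - c) * (v + c) by ring, norm_mul, sq]
    exact mul_le_mul_of_nonneg_left h (norm_nonneg _)
  · refine ⟨-v, by rw [neg_sq, hv], ?_⟩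
    rw [← hv, show v ^ 2 - c ^ 2 = (v - c) * (v + c) by ring, norm_mul, sq,
      show -v - c = -(v + c) by ring, norm_neg]
    exact mul_le_mul_of_nonneg_right h (norm_nonneg _)

open Filter Topology in
/-- Square roots can be continued to nearby parameters. -/
theorem exists_continuousAt_roots {f : ℂ → ℕ → ℂ} (hf : ∀ k, ContinuousAt (fun t => f t k) 0)
    {θ : ℕ → ℂ} (hθ : ∀ k, θ k ^ 2 = f 0 k) :
    ∃ Θ : ℂ → ℕ → ℂ, (∀ t k, Θ t k ^ 2 = f t k) ∧ Θ 0 = θ ∧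
      ∀ k, ContinuousAt (fun t => Θ t k) 0 := by
  -- Taking at each t the root nearer to θ k gives continuity at 0, which is all that is needed; the
  -- given choice of roots need not be continuous anywhere.
  choose Θ h1 h2 using fun t k => exists_sq_eq_norm_sub_sq_le (f t k) (θ k)
  have h0 : Θ 0 = θ := by
    ext k
    have := h2 0 k
    rw [hθ k, sub_self, norm_zero] at this
    exact sub_eq_zero.mp (norm_eq_zero.mp (pow_eq_zero_iff two_ne_zero |>.mp
      (le_antisymm this (sq_nonneg _))))
  refine ⟨Θ, h1, h0, fun k => ?_⟩
  have l : Tendsto (fun t => Real.sqrt ‖f t k - θ k ^ 2‖) (𝓝 0) (𝓝 0) := by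
    have c : ContinuousAt (fun t => Real.sqrt ‖f t k - θ k ^ 2‖) 0 :=
      Real.continuous_sqrt.continuousAt.comp ((hf k).sub continuousAt_const).norm
    have := c.tendsto
    rwa [← hθ k, sub_self, norm_zero, Real.sqrt_zero] at this
  rw [ContinuousAt, h0, tendsto_iff_norm_sub_tendsto_zero]
  exact squeeze_zero (fun _ => norm_nonneg _) (fun t => Real.le_sqrt_of_sq_le (h2 t k)) l

section Continuity

variable {N : ℕ} {s : ℤ} {φ : ℕ → ℂ}

open Filter Topology

theorem continuousAt_cgVec {p₁ p₂ : ℂ → ℂ} {θ₁ θ₂ : ℂ → ℕ → ℂ} {t₀ : ℂ} (h₁ : ContinuousAt p₁ t₀)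
    (h₂ : ContinuousAt p₂ t₀) (g₁ : ∀ k, ContinuousAt (fun t => θ₁ t k) t₀)
    (g₂ : ∀ k, ContinuousAt (fun t => θ₂ t k) t₀) (n z : ℕ) (a : Fin N × Fin N) :
    ContinuousAt (fun t => cgVec N s (p₁ t) (p₂ t) φ (θ₁ t) (θ₂ t) n z a) t₀ := by
  have ce : ∀ {f : ℂ → ℂ}, ContinuousAt f t₀ → ContinuousAt (fun t => epsPow N s (f t)) t₀ :=
    fun h => continuous_epsPow.continuousAt.comp h
  have ct : ∀ {θ : ℂ → ℕ → ℂ}, (∀ k, ContinuousAt (fun t => θ t k) t₀) → ∀ n b i j,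
      ContinuousAt (fun t => thetaProd (θ t) n b i j) t₀ := fun h n b i j =>
    (tendsto_finsetProd _ fun k _ => h _).mul (tendsto_finsetProd _ fun k _ => h _)
  simp only [cgVec]
  split_ifs
  · refine (continuousAt_const.mul (ce (by fun_prop))).mul (tendsto_finsetSum _ fun ij _ => ?_)
    exact ((continuousAt_const.mul (ce (by fun_prop))).mul continuousAt_const).mul
      ((ct g₁ _ _ _ _).mul (ct g₂ _ _ _ _))
  · exact continuousAt_const

theorem continuousAt_cgNorm {P : ℂ → ℂ} {t₀ : ℂ} (hP : ContinuousAt P t₀)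
    (h : ∀ k : ℤ, qNum N s (2 * P t₀ + k) ≠ 0) (n z : ℕ) :
    ContinuousAt (fun t => cgNorm N s (P t) n z) t₀ := by
  have cq : ∀ {f : ℂ → ℂ}, ContinuousAt f t₀ → ContinuousAt (fun t => qNum N s (f t)) t₀ :=
    fun h => continuous_qNum.continuousAt.comp h
  refine (((cq (by fun_prop)).mul continuousAt_const).mul continuousAt_const).div
    (tendsto_finsetProd _ fun k _ => cq (by fun_prop)) ?_
  have := qFalling_ne_zero h (-n + 1) (n + z + 1)
  push_cast at this
  rwa [show 2 * P t₀ - n + 1 = 2 * P t₀ + (-n + 1) by ring]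

theorem continuousAt_gHat {P : ℂ → ℂ} {t₀ : ℂ} (hP : ContinuousAt P t₀) (x : ℂ) (n : ℕ) :
    ContinuousAt (fun t => gHat N s (P t) x n) t₀ := by
  have ce : ∀ {f : ℂ → ℂ}, ContinuousAt f t₀ → ContinuousAt (fun t => epsPow N s (f t)) t₀ :=
    fun h => continuous_epsPow.continuousAt.comp h
  exact (tendsto_finsetProd _ fun k _ =>
      (continuousAt_const.mul (ce (by fun_prop))).sub continuousAt_const).mul
    (tendsto_finsetProd _ fun k _ => (ce (by fun_prop)).sub continuousAt_const)

theorem continuousAt_rHat {p₁ p₂ : ℂ → ℂ} {θ₁ θ₂ : ℂ → ℕ → ℂ} {t₀ : ℂ} (h₁ : ContinuousAt p₁ t₀)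
    (h₂ : ContinuousAt p₂ t₀) (g₁ : ∀ k, ContinuousAt (fun t => θ₁ t k) t₀)
    (g₂ : ∀ k, ContinuousAt (fun t => θ₂ t k) t₀)
    (h : ∀ k : ℤ, qNum N s (2 * (p₁ t₀ + p₂ t₀) + k) ≠ 0) (x : ℂ) (a b : Fin N × Fin N) :
    ContinuousAt (fun t => rHat N s (p₁ t) (p₂ t) φ (θ₁ t) (θ₂ t) x a b) t₀ := by
  refine tendsto_finsetSum _ fun m _ => ?_
  exact (((continuousAt_gHat (h₁.add h₂) _ _).mul (continuousAt_cgNorm (h₁.add h₂) h _ _)).mul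
    (continuousAt_cgVec h₂ h₁ g₂ g₁ _ _ _)).mul (continuousAt_cgVec h₁ h₂ g₁ g₂ _ _ _)

/-- Vanishing depends only on k modulo N, so the condition is a finite intersection of open ones. -/
theorem eventually_qNum_add_int_ne_zero (hN : 2 ≤ N) (hs : IsCoprime s (N : ℤ)) {P : ℂ → ℂ} {t₀ : ℂ}
    (hP : ContinuousAt P t₀) (h : ∀ k : ℤ, qNum N s (P t₀ + k) ≠ 0) :
    ∀ᶠ t in 𝓝 t₀, ∀ k : ℤ, qNum N s (P t + k) ≠ 0 := by
  have h1 : ∀ᶠ t in 𝓝 t₀, ∀ k : Fin N, qNum N s (P t + (k : ℕ)) ≠ 0 := by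
    refine eventually_all.mpr fun k => ?_
    have c : ContinuousAt (fun t => qNum N s (P t + (k : ℕ))) t₀ :=
      continuous_qNum.continuousAt.comp (hP.add continuousAt_const)
    exact c.eventually_ne (by exact_mod_cast h (k : ℕ))
  filter_upwards [h1] with t ht k hk
  have hN0 : (0 : ℤ) < N := by omega
  have e1 := Int.emod_nonneg k hN0.ne'
  have e2 := Int.emod_lt_of_pos k hN0
  refine ht ⟨(k % N).toNat, by omega⟩ ?_
  rw [← qNum_add_mul_self hN hs _ (k / N)]
  convert hk using 2
  have e3 : (((k % N).toNat : ℤ)) = k % N := Int.toNat_of_nonneg e1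
  have e4 : ((k % N : ℤ) : ℂ) + ((k / N : ℤ) : ℂ) * N = k := by
    exact_mod_cast (by rw [mul_comm]; exact Int.emod_add_mul_ediv k N : k % N + k / N * N = k)
  rw [show (((k % N).toNat : ℕ) : ℂ) = (((k % N).toNat : ℤ) : ℂ) by norm_cast, e3, add_assoc, e4]

end Continuity

section YangBaxter

variable {N : ℕ} {s : ℤ} {φ θ₁ θ₂ θ₃ : ℕ → ℂ} {p₁ p₂ p₃ x y : ℂ}

open Filter Topology

theorem eventually_irreducibleColor (hN : 2 ≤ N) (hs : IsCoprime s (N : ℤ)) (p : ℂ) :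
    ∀ᶠ t in 𝓝[≠] (0 : ℂ), IrreducibleColor N s (p + t) := by
  have : ∀ᶠ t in 𝓝[≠] (0 : ℂ), ∀ k : Fin N, qNum N s (2 * p - (k : ℕ) + 2 * t) ≠ 0 :=
    eventually_all.mpr fun k => qNum_add_mul_eventually_ne_zero hN hs _ two_ne_zero
  filter_upwards [this] with t ht k hk
  have := ht ⟨k, by omega⟩
  rwa [show 2 * (p + t) - (k : ℂ) = 2 * p - k + 2 * t by ring]

theorem RootData.eventually_add {Θ₁ Θ₂ : ℂ → ℕ → ℂ} (h : RootData N s p₁ p₂ φ θ₁ θ₂)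
    (h₁ : ∀ t k, Θ₁ t k ^ 2 = qNum N s (2 * (p₁ + t) - k))
    (h₂ : ∀ t k, Θ₂ t k ^ 2 = qNum N s (2 * (p₂ + t) - k)) :
    ∀ᶠ t in 𝓝 (0 : ℂ), RootData N s (p₁ + t) (p₂ + t) φ (Θ₁ t) (Θ₂ t) := by
  filter_upwards [eventually_qNum_add_int_ne_zero h.two_le h.coprime
    (P := fun t => 2 * (p₁ + t + (p₂ + t))) (t₀ := 0) (by fun_prop)
    (by simpa only [add_zero] using h.generic)] with t ht
  exact ⟨h.two_le, h.coprime, h.sq_phi, h₁ t, h₂ t, ht⟩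

/-- The Yang-Baxter equation for `3 ≤ N`, by continuity from the irreducible case. -/
theorem ybDiff_rHat_of_three_le (hN : 3 ≤ N) (h₁₂ : RootData N s p₁ p₂ φ θ₁ θ₂)
    (h₁₃ : RootData N s p₁ p₃ φ θ₁ θ₃) (h₂₃ : RootData N s p₂ p₃ φ θ₂ θ₃) (x y : ℂ) :
    ybDiff (rHat N s p₁ p₂ φ θ₁ θ₂ x) (rHat N s p₁ p₃ φ θ₁ θ₃ (x * y))
      (rHat N s p₂ p₃ φ θ₂ θ₃ y) = 0 := by
  have hN2 : 2 ≤ N := by omega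
  have hs := h₁₂.coprime
  have cont : ∀ (p : ℂ) (k : ℕ), ContinuousAt (fun t => qNum N s (2 * (p + t) - k)) 0 := fun p k =>
    continuous_qNum.continuousAt.comp (by fun_prop)
  obtain ⟨Θ₁, r₁, z₁, c₁⟩ := exists_continuousAt_roots (cont p₁) (θ := θ₁)
    (by simpa only [add_zero] using h₁₂.sq_left)
  obtain ⟨Θ₂, r₂, z₂, c₂⟩ := exists_continuousAt_roots (cont p₂) (θ := θ₂)
    (by simpa only [add_zero] using h₂₃.sq_left)
  obtain ⟨Θ₃, r₃, z₃, c₃⟩ := exists_continuousAt_roots (cont p₃) (θ := θ₃)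
    (by simpa only [add_zero] using h₂₃.sq_right)
  have cR : ∀ {p q : ℂ} {θ θ' : ℕ → ℂ} {Θ Θ' : ℂ → ℕ → ℂ}, RootData N s p q φ θ θ' →
      (∀ k, ContinuousAt (fun t => Θ t k) 0) → (∀ k, ContinuousAt (fun t => Θ' t k) 0) →
      ∀ z a b, ContinuousAt (fun t => rHat N s (p + t) (q + t) φ (Θ t) (Θ' t) z a b) 0 := by
    intro p q θ θ' Θ Θ' h c c' z a b
    exact continuousAt_rHat (by fun_prop) (by fun_prop) c c'
      (by simpa only [add_zero] using h.generic) z a b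
  ext a b
  have lim : ContinuousAt (fun t => ybDiff (rHat N s (p₁ + t) (p₂ + t) φ (Θ₁ t) (Θ₂ t) x)
      (rHat N s (p₁ + t) (p₃ + t) φ (Θ₁ t) (Θ₃ t) (x * y))
      (rHat N s (p₂ + t) (p₃ + t) φ (Θ₂ t) (Θ₃ t) y) a b) 0 := by
    simp only [ybDiff_apply]
    refine ContinuousAt.sub ?_ ?_ <;>
      refine tendsto_finsetSum _ fun i _ => tendsto_finsetSum _ fun j _ =>
        tendsto_finsetSum _ fun k _ => ?_
    · exact ((cR h₂₃ c₂ c₃ _ _ _).mul (cR h₁₃ c₁ c₃ _ _ _)).mul (cR h₁₂ c₁ c₂ _ _ _)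
    · exact ((cR h₁₂ c₁ c₂ _ _ _).mul (cR h₁₃ c₁ c₃ _ _ _)).mul (cR h₂₃ c₂ c₃ _ _ _)
  have lim' := lim.tendsto.mono_left (nhdsWithin_le_nhds (s := {0}ᶜ))
  simp only [add_zero, z₁, z₂, z₃] at lim'
  -- Shifting all p_i by a small t ≠ 0 makes the three modules irreducible and keeps the pairwise
  -- sums generic, so the function vanishes on a punctured neighbourhood and so does its limit.
  refine tendsto_nhds_unique lim' (tendsto_const_nhds.congr' ?_)
  filter_upwards [nhdsWithin_le_nhds (h₁₂.eventually_add r₁ r₂),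
    nhdsWithin_le_nhds (h₁₃.eventually_add r₁ r₃), nhdsWithin_le_nhds (h₂₃.eventually_add r₂ r₃),
    eventually_irreducibleColor hN2 hs p₁, eventually_irreducibleColor hN2 hs p₂,
    eventually_irreducibleColor hN2 hs p₃] with t a1 a2 a3 i1 i2 i3
  rw [ybDiff_rHat_of_irreducible hN a1 a2 a3 i1 i2 i3]

end YangBaxter

/-! ### The case N = 2 -/

/-- The weights of a six vertex model of free fermion type, with roots `c₁`, `c₂`. -/
def sixVertex (q x l₁ l₂ c₁ c₂ : ℂ) : Matrix (Fin 2 × Fin 2) (Fin 2 × Fin 2) ℂ :=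
  Matrix.of fun a b =>
    ![![![![l₁ * l₂ - x, 0], ![0, 0]], ![![0, l₂ - x * l₁], ![2 * q * c₁ * c₂, 0]]],
      ![![![0, 2 * q * x * c₁ * c₂], ![l₁ - x * l₂, 0]], ![![0, 0], ![0, x * (l₁ * l₂) - 1]]]]
      a.1 a.2 b.1 b.2

-- Every entry is a polynomial identity modulo the three relations, which eliminate the squares of
-- the roots c_i.
set_option maxHeartbeats 400000 in
theorem ybDiff_sixVertex {q x y l₁ l₂ l₃ c₁ c₂ c₃ : ℂ} (h₁ : 2 * q * c₁ ^ 2 = l₁ ^ 2 - 1)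
    (h₂ : 2 * q * c₂ ^ 2 = l₂ ^ 2 - 1) (h₃ : 2 * q * c₃ ^ 2 = l₃ ^ 2 - 1) :
    ybDiff (sixVertex q x l₁ l₂ c₁ c₂) (sixVertex q (x * y) l₁ l₃ c₁ c₃)
      (sixVertex q y l₂ l₃ c₂ c₃) = 0 := by
  ext ⟨a₁, a₂, a₃⟩ ⟨b₁, b₂, b₃⟩
  rw [ybDiff_apply]
  simp only [Fin.sum_univ_two, sixVertex, Matrix.of_apply, Matrix.zero_apply]
  fin_cases a₁ <;> fin_cases a₂ <;> fin_cases a₃ <;> fin_cases b₁ <;> fin_cases b₂ <;>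
    fin_cases b₃ <;> simp <;> grind

section SixVertexEntries

variable {q e f t w T W D x g : ℂ}

/-- Dictionary for this group: q = ε, e = ε^(p₁), f = ε^(p₂), t = θ₁ 0, w = θ₂ 0, T = θ₁ 1, W = θ₂
1, D = [2p₁ + 2p₂], g = φ 0. The two summands are the components n = 0 and n = 1. -/
theorem sixVertex_diagonal (hq : q ≠ 0) (he : e ≠ 0) (hf : f ≠ 0) (hD : D ≠ 0) (hg : g ^ 2 = 1)
  (t₁ : t ^ 2 * (2 * q * e ^ 2) = (e ^ 2) ^ 2 - 1) (t₂ : w ^ 2 * (2 * q * f ^ 2) = (f ^ 2) ^ 2 - 1)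
  (tP : D * (2 * q * (e ^ 2 * f ^ 2)) = (e ^ 2 * f ^ 2) ^ 2 - 1) :
  (e ^ 2 * f ^ 2 - x) * D⁻¹ * (g * e * w) * (g * e⁻¹ * w) + -((x * (e ^ 2 * f ^ 2) - 1) * D⁻¹ * (g * f⁻¹ * t) * (g * f * t)) = f ^ 2 - x * e ^ 2 := by
  have h : (e ^ 2 * f ^ 2 - x) * D⁻¹ * (g * e * w) * (g * e⁻¹ * w) + -((x * (e ^ 2 * f ^ 2) - 1) * D⁻¹ * (g * f⁻¹ * t) * (g * f * t))
    = g ^ 2 * ((e ^ 2 * f ^ 2 - x) * w ^ 2 - (x * (e ^ 2 * f ^ 2) - 1) * t ^ 2) / D := by field_simp; ring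
  rw [h, hg, one_mul, div_eq_iff hD]
  refine mul_left_cancel₀ (mul_ne_zero hq (mul_ne_zero (pow_ne_zero 2 he) (pow_ne_zero 2 hf))) ?_
  linear_combination (e ^ 2 * f ^ 2 - x) * e ^ 2 / 2 * t₂ - (x * (e ^ 2 * f ^ 2) - 1) * f ^ 2 / 2 * t₁ - (f ^ 2 - x * e ^ 2) / 2 * tP

theorem sixVertex_lower (hq : q ≠ 0) (he : e ≠ 0) (hf : f ≠ 0) (hD : D ≠ 0) (hg : g ^ 2 = 1)
  (tP : D * (2 * q * (e ^ 2 * f ^ 2)) = (e ^ 2 * f ^ 2) ^ 2 - 1) :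
  (e ^ 2 * f ^ 2 - x) * D⁻¹ * (g * e * w) * (g * f * t) + ((x * (e ^ 2 * f ^ 2) - 1) * D⁻¹ * (g * f⁻¹ * t) * (g * e⁻¹ * w)) = 2 * q * (e * t) * (f * w) := by
  have h : (e ^ 2 * f ^ 2 - x) * D⁻¹ * (g * e * w) * (g * f * t) + ((x * (e ^ 2 * f ^ 2) - 1) * D⁻¹ * (g * f⁻¹ * t) * (g * e⁻¹ * w))
    = g ^ 2 * (((e ^ 2 * f ^ 2) ^ 2 - 1) * w * t) / (e * f * D) := by field_simp; ring
  rw [h, hg, one_mul, ← tP]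
  field_simp

theorem sixVertex_upper (hq : q ≠ 0) (he : e ≠ 0) (hf : f ≠ 0) (hD : D ≠ 0) (hg : g ^ 2 = 1)
  (tP : D * (2 * q * (e ^ 2 * f ^ 2)) = (e ^ 2 * f ^ 2) ^ 2 - 1) :
  (e ^ 2 * f ^ 2 - x) * D⁻¹ * (g * f⁻¹ * t) * (g * e⁻¹ * w) + ((x * (e ^ 2 * f ^ 2) - 1) * D⁻¹ * (g * e * w) * (g * f * t)) = 2 * q * x * (e * t) * (f * w) := by
  have h : (e ^ 2 * f ^ 2 - x) * D⁻¹ * (g * f⁻¹ * t) * (g * e⁻¹ * w) + ((x * (e ^ 2 * f ^ 2) - 1) * D⁻¹ * (g * e * w) * (g * f * t))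
    = g ^ 2 * (((e ^ 2 * f ^ 2) ^ 2 - 1) * x * w * t) / (e * f * D) := by field_simp; ring
  rw [h, hg, one_mul, ← tP]
  field_simp

/-- Only the component n = 1 reaches the lowest weight. Both of its coefficients there are
proportional to D, which cancels against the norm. -/
theorem sixVertex_last (q2 : q ^ 2 = -1) (he : e ≠ 0) (hf : f ≠ 0) (hD : D ≠ 0) (hg : g ^ 2 = 1)
  (t₁ : e ^ 2 * T ^ 2 * 2 = -(e ^ 4 + 1)) (t₂ : f ^ 2 * W ^ 2 * 2 = -(f ^ 4 + 1))
  (tP : D * (2 * q * (e ^ 2 * f ^ 2)) = (e ^ 2 * f ^ 2) ^ 2 - 1) :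
  -((x * (e ^ 2 * f ^ 2) - 1) * (D ^ 2)⁻¹ * (g ^ 2 * e ^ 2 * (W ^ 2 - (f ^ 2)⁻¹ * (e ^ 2)⁻¹ * T ^ 2)) * (g ^ 2 * f ^ 2 * (T ^ 2 - (e ^ 2)⁻¹ * (f ^ 2)⁻¹ * W ^ 2))) = x * (e ^ 2 * f ^ 2) - 1 := by
  have hW : W ^ 2 = -(f ^ 4 + 1) / (2 * f ^ 2) := by field_simp; linear_combination t₂
  have hT : T ^ 2 = -(e ^ 4 + 1) / (2 * e ^ 2) := by field_simp; linear_combination t₁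
  have a : e ^ 2 * (W ^ 2 - (f ^ 2)⁻¹ * (e ^ 2)⁻¹ * T ^ 2) = - q * D := by
    rw [hW, hT]; field_simp; linear_combination tP
  have b : f ^ 2 * (T ^ 2 - (e ^ 2)⁻¹ * (f ^ 2)⁻¹ * W ^ 2) = - q * D := by
    rw [hW, hT]; field_simp; linear_combination tP
  rw [hg, one_mul, one_mul, a, b]
  field_simp
  linear_combination -(x * (e ^ 2 * f ^ 2) - 1) * q2

end SixVertexEntries

section TwoStates

variable {N : ℕ} {s : ℤ} {φ θ₁ θ₂ : ℕ → ℂ} {p₁ p₂ x : ℂ}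

local notation "ε" => epsPow N s
local notation "qn" => qNum N s

theorem cgSum_zero (b₁ b₂ : ℕ) : cgSum N s p₁ p₂ θ₁ θ₂ 0 b₁ b₂
    = (qFact N s b₁)⁻¹ * (qFact N s b₂)⁻¹
      * ((∏ k ∈ Finset.range b₁, θ₁ k) * ∏ k ∈ Finset.range b₂, θ₂ k) := by
  simp [cgSum, cgTerm, thetaProd, invFactSub, qFact, epsPow]

theorem cgSum_one (hN : 2 ≤ N) (hs : IsCoprime s (N : ℤ)) (b₁ b₂ : ℕ) :
    cgSum N s p₁ p₂ θ₁ θ₂ 1 b₁ b₂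
    = invFactSub N s b₁ 0 * invFactSub N s b₂ 1
        * (thetaProd θ₁ 1 b₁ 0 1 * thetaProd θ₂ 1 b₂ 1 0)
      - ε (-(2 * (p₁ + p₂))) * invFactSub N s b₁ 1 * invFactSub N s b₂ 0
        * (thetaProd θ₁ 1 b₁ 1 0 * thetaProd θ₂ 1 b₂ 0 1) := by
  rw [cgSum, Finset.Nat.antidiagonal_succ]
  simp only [Finset.Nat.antidiagonal_zero, Finset.map_singleton, Finset.sum_cons,
    Finset.sum_singleton, cgTerm, Function.Embedding.prodMap, Function.Embedding.coeFn_mk,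
    Prod.map, Function.Embedding.refl_apply, Nat.succ_eq_add_one, zero_add]
  have h1 : qFact N s 1 = 1 := by simp [qFact, qNum_one hN hs]
  have h2 : ε (-((1 : ℕ) : ℂ) * (2 * p₁ + 2 * p₂ - ((1 : ℕ) : ℂ) + 1)) = ε (-(2 * (p₁ + p₂))) := by
    congr 1; push_cast; ring
  have h3 : ε (-((0 : ℕ) : ℂ) * (2 * p₁ + 2 * p₂ - ((1 : ℕ) : ℂ) + 1)) = 1 := by simp [epsPow]
  rw [h1, h2, h3]
  simp [qFact]
  ring

theorem cgVal_zero_zero_zero : cgVal N s p₁ p₂ φ θ₁ θ₂ 0 0 0 = 1 := by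
  simp [cgVal, cgSum_zero, qFact, epsPow]

theorem cgVal_zero_one_zero (hN : 2 ≤ N) (hs : IsCoprime s (N : ℤ)) :
    cgVal N s p₁ p₂ φ θ₁ θ₂ 0 1 0 = φ 0 * ε p₂ * θ₁ 0 := by
  simp [cgVal, cgSum_zero, qFact, qNum_one hN hs]

theorem cgVal_zero_zero_one (hN : 2 ≤ N) (hs : IsCoprime s (N : ℤ)) :
    cgVal N s p₁ p₂ φ θ₁ θ₂ 0 0 1 = φ 0 * (ε p₁)⁻¹ * θ₂ 0 := by
  simp [cgVal, cgSum_zero, qFact, qNum_one hN hs, eps_neg]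

theorem cgVal_one_one_zero (hN : 2 ≤ N) (hs : IsCoprime s (N : ℤ)) :
    cgVal N s p₁ p₂ φ θ₁ θ₂ 1 1 0 = -(φ 0 * (ε p₁)⁻¹ * θ₂ 0) := by
  have e : ε (p₁ + (1 + 1) * p₂) = ε p₁ * ε p₂ ^ 2 := by rw [one_add_one_eq_two, eps_add, eps_two_mul]
  have := eps_ne_zero (N := N) (s := s) p₁
  have := eps_ne_zero (N := N) (s := s) p₂
  simp [cgVal, cgSum_one hN hs, invFactSub, thetaProd, qFact, eps_neg, e, eps_two_mul, eps_add]
  field_simp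

theorem cgVal_one_zero_one (hN : 2 ≤ N) (hs : IsCoprime s (N : ℤ)) :
    cgVal N s p₁ p₂ φ θ₁ θ₂ 1 0 1 = φ 0 * ε p₂ * θ₁ 0 := by
  simp [cgVal, cgSum_one hN hs, invFactSub, thetaProd, qFact]

theorem cgVal_one_one_one (hN : 2 ≤ N) (hs : IsCoprime s (N : ℤ)) :
    cgVal N s p₁ p₂ φ θ₁ θ₂ 1 1 1 = φ 0 ^ 2 * ε p₂ ^ 2
      * (θ₁ 1 ^ 2 - (ε p₁ ^ 2)⁻¹ * (ε p₂ ^ 2)⁻¹ * θ₂ 1 ^ 2) := by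
  have e : ε ((1 + 1) * p₂) = ε p₂ ^ 2 := by rw [one_add_one_eq_two, eps_two_mul]
  have f1 : qFact N s 1 = 1 := by simp [qFact, qNum_one hN hs]
  simp [cgVal, cgSum_one hN hs, invFactSub, thetaProd, f1, e, eps_neg, eps_two_mul, eps_add,
    qFact_zero]
  ring

/-- For N = 2 one has [2] = ε + ε⁻¹ = 0. -/
theorem eps_one_sq (hs : IsCoprime s ((2 : ℕ) : ℤ)) : epsPow 2 s 1 ^ 2 = -1 := by
  have hN : 2 ≤ 2 := le_rfl
  have a := qNum_natCast_self hN hs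
  rw [Nat.cast_ofNat, qNum_two hN hs, eps_neg] at a
  have := eps_ne_zero (N := 2) (s := s) 1
  field_simp at a
  linear_combination a

theorem two_eps_mul_qNum_two (hs : IsCoprime s ((2 : ℕ) : ℤ)) (z : ℂ) :
    qNum 2 s z * (2 * epsPow 2 s 1 * epsPow 2 s z) = epsPow 2 s z ^ 2 - 1 := by
  have qi : (epsPow 2 s 1)⁻¹ = -epsPow 2 s 1 :=
    inv_eq_of_mul_eq_one_right (by linear_combination -eps_one_sq hs)
  have h := qNum_mul_den le_rfl hs z
  have h0 := eps_ne_zero (N := 2) (s := s) z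
  rw [eps_neg, eps_neg, qi] at h
  field_simp at h
  linear_combination h

set_option maxHeartbeats 400000 in
theorem rHat_two (h : RootData 2 s p₁ p₂ φ θ₁ θ₂) (x : ℂ) :
    rHat 2 s p₁ p₂ φ θ₁ θ₂ x = sixVertex (epsPow 2 s 1) x (epsPow 2 s (2 * p₁))
      (epsPow 2 s (2 * p₂)) (epsPow 2 s p₁ * θ₁ 0) (epsPow 2 s p₂ * θ₂ 0) := by
  have hN := h.two_le
  have hs := h.coprime
  have hφ : φ 0 ^ 2 = 1 := by rw [h.sq_phi, Nat.cast_zero, zero_add, qNum_one hN hs]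
  have q2 := eps_one_sq hs
  have hq := eps_ne_zero (N := 2) (s := s) 1
  have he₁ := eps_ne_zero (N := 2) (s := s) p₁
  have he₂ := eps_ne_zero (N := 2) (s := s) p₂
  have hz := two_eps_mul_qNum_two hs
  have hP := h.generic 0
  rw [Int.cast_zero, add_zero] at hP
  have eP : epsPow 2 s (2 * (p₁ + p₂)) = epsPow 2 s p₁ ^ 2 * epsPow 2 s p₂ ^ 2 := by
    rw [eps_two_mul, eps_add, mul_pow]
  have t₁ := hz (2 * p₁)
  have t₂ := hz (2 * p₂)
  have tP := hz (2 * (p₁ + p₂))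
  have r₁ := h.sq_left 0
  have r₂ := h.sq_right 0
  rw [Nat.cast_zero, sub_zero] at r₁ r₂
  rw [← r₁, eps_two_mul] at t₁
  rw [← r₂, eps_two_mul] at t₂
  have g₁ : epsPow 2 s p₁ ^ 2 * θ₁ 1 ^ 2 * 2 = -(epsPow 2 s p₁ ^ 4 + 1) := by
    have := hz (2 * p₁ - 1)
    rw [eps_sub, eps_two_mul] at this
    rw [h.sq_left, Nat.cast_one]
    field_simp at this
    linear_combination -this + (2 * qNum 2 s (2 * p₁ - 1) * epsPow 2 s p₁ ^ 2 + 1) * q2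
  have g₂ : epsPow 2 s p₂ ^ 2 * θ₂ 1 ^ 2 * 2 = -(epsPow 2 s p₂ ^ 4 + 1) := by
    have := hz (2 * p₂ - 1)
    rw [eps_sub, eps_two_mul] at this
    rw [h.sq_right, Nat.cast_one]
    field_simp at this
    linear_combination -this + (2 * qNum 2 s (2 * p₂ - 1) * epsPow 2 s p₂ ^ 2 + 1) * q2
  rw [eP] at tP
  have k00 : cgNorm 2 s (p₁ + p₂) 0 0 = 1 := by
    have := h.generic 1
    rw [Int.cast_one] at this
    simp [cgNorm, qFalling, qFact, this]
  have f1 : qFact 2 s 1 = 1 := by simp [qFact, qNum_one hN hs]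
  have k01 : cgNorm 2 s (p₁ + p₂) 0 1 = (qNum 2 s (2 * (p₁ + p₂)))⁻¹ := by
    have := h.generic 1
    rw [Int.cast_one] at this
    simp [cgNorm, qFalling, f1, qFact_zero, Finset.prod_range_succ]
    field_simp
  have k10 : cgNorm 2 s (p₁ + p₂) 1 0 = (qNum 2 s (2 * (p₁ + p₂)))⁻¹ := by
    have := h.generic (-1)
    rw [Int.cast_neg, Int.cast_one, ← sub_eq_add_neg] at this
    rw [cgNorm, show 2 * (p₁ + p₂) - 2 * ((1 : ℕ) : ℂ) + 1 = 2 * (p₁ + p₂) - 1 by push_cast; ring]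
    simp [qFalling, f1, qFact_zero, Finset.prod_range_succ]
    field_simp
  have k11 : cgNorm 2 s (p₁ + p₂) 1 1 = -(qNum 2 s (2 * (p₁ + p₂)) ^ 2)⁻¹ := by
    have := h.generic (-1)
    rw [Int.cast_neg, Int.cast_one, ← sub_eq_add_neg] at this
    have e : qNum 2 s (2 * (p₁ + p₂) - 2) = -qNum 2 s (2 * (p₁ + p₂)) := by
      have a : qNum 2 s 2 = 0 := by exact_mod_cast qNum_natCast_self hN hs
      rw [sub_eq_add_neg, qNum_add', qNum_neg, a, neg_neg, show (2 : ℂ) = 2 * 1 by ring, eps_two_mul,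
        q2]
      ring
    rw [cgNorm, show 2 * (p₁ + p₂) - 2 * ((1 : ℕ) : ℂ) + 1 = 2 * (p₁ + p₂) - 1 by push_cast; ring]
    simp [qFalling, f1, Finset.prod_range_succ, e]
    field_simp
  have G0 : gHat 2 s (p₁ + p₂) x 0 = epsPow 2 s p₁ ^ 2 * epsPow 2 s p₂ ^ 2 - x := by
    simp [gHat, eP]
  have G1 : gHat 2 s (p₁ + p₂) x 1 = x * (epsPow 2 s p₁ ^ 2 * epsPow 2 s p₂ ^ 2) - 1 := by
    simp [gHat, eP]
  ext ⟨a₁, a₂⟩ ⟨b₁, b₂⟩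
  simp only [rHat, rGen, Matrix.of_apply, Fintype.sum_prod_type, Fin.sum_univ_two, cgVec, sixVertex]
  fin_cases a₁ <;> fin_cases a₂ <;> fin_cases b₁ <;> fin_cases b₂ <;>
    simp [k00, k01, k10, k11, G0, G1, cgVal_zero_zero_zero, cgVal_zero_one_zero hN hs,
      cgVal_zero_zero_one hN hs, cgVal_one_one_zero hN hs, cgVal_one_zero_one hN hs,
      cgVal_one_one_one hN hs, eps_two_mul]
  · exact sixVertex_diagonal hq he₁ he₂ hP hφ t₁ t₂ tP
  · exact sixVertex_lower hq he₁ he₂ hP hφ tP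
  · exact sixVertex_upper hq he₁ he₂ hP hφ tP
  · linear_combination sixVertex_diagonal (x := x) hq he₂ he₁ hP hφ t₂ t₁
      (by linear_combination tP)
  · exact sixVertex_last q2 he₁ he₂ hP hφ g₁ g₂ tP

theorem ybDiff_rHat_two {θ₃ : ℕ → ℂ} {p₃ : ℂ} (h₁₂ : RootData 2 s p₁ p₂ φ θ₁ θ₂)
    (h₁₃ : RootData 2 s p₁ p₃ φ θ₁ θ₃) (h₂₃ : RootData 2 s p₂ p₃ φ θ₂ θ₃) (x y : ℂ) :
    ybDiff (rHat 2 s p₁ p₂ φ θ₁ θ₂ x) (rHat 2 s p₁ p₃ φ θ₁ θ₃ (x * y))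
      (rHat 2 s p₂ p₃ φ θ₂ θ₃ y) = 0 := by
  have hc : ∀ {θ : ℕ → ℂ} {p : ℂ}, (∀ k : ℕ, θ k ^ 2 = qNum 2 s (2 * p - k)) →
      2 * epsPow 2 s 1 * (epsPow 2 s p * θ 0) ^ 2 = epsPow 2 s (2 * p) ^ 2 - 1 := by
    intro θ p hθ
    have h0 := hθ 0
    rw [Nat.cast_zero, sub_zero] at h0
    rw [mul_pow, h0, ← eps_two_mul]
    linear_combination two_eps_mul_qNum_two h₁₂.coprime (2 * p)
  rw [rHat_two h₁₂, rHat_two h₁₃, rHat_two h₂₃]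
  exact ybDiff_sixVertex (hc h₁₂.sq_left) (hc h₂₃.sq_left) (hc h₂₃.sq_right)

/-- The Yang-Baxter equation. -/
theorem ybDiff_rHat {θ₃ : ℕ → ℂ} {p₃ : ℂ} (h₁₂ : RootData N s p₁ p₂ φ θ₁ θ₂)
    (h₁₃ : RootData N s p₁ p₃ φ θ₁ θ₃) (h₂₃ : RootData N s p₂ p₃ φ θ₂ θ₃) (x y : ℂ) :
    ybDiff (rHat N s p₁ p₂ φ θ₁ θ₂ x) (rHat N s p₁ p₃ φ θ₁ θ₃ (x * y))
      (rHat N s p₂ p₃ φ θ₂ θ₃ y) = 0 := by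
  rcases h₁₂.two_le.eq_or_lt with rfl | hN
  · exact ybDiff_rHat_two h₁₂ h₁₃ h₂₃ x y
  · exact ybDiff_rHat_of_three_le hN h₁₂ h₁₃ h₂₃ x y

end TwoStates

/-! ### The Yang-Baxter equation for the Boltzmann weights -/

section Weights

variable {N : ℕ} {s : ℤ} {r : ℂ → ℂ}

local notation "ε" => epsPow N s
local notation "qn" => qNum N s

/-- Both sequences satisfy the same first order recursion with nonvanishing leading coefficient, and
g starts at 1. -/
theorem gHat_eq_mul_gCoeff (hN : 2 ≤ N) (hs : IsCoprime s (N : ℤ)) {p₁ p₂ u : ℂ}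
    (hu : ∀ k : ℕ, k + 1 < N → qn (u + p₁ + p₂ - k) ≠ 0) {n : ℕ} (hn : n < N) :
    gHat N s (p₁ + p₂) (ε (-2 * u)) n
      = gHat N s (p₁ + p₂) (ε (-2 * u)) 0 * gCoeff N s p₁ p₂ n u := by
  induction n with
  | zero => simp [gCoeff]
  | succ n ih =>
    have hA := eps_sub_ne_zero_of_qNum hN hs (u := u) (P := p₁ + p₂ - n)
      (by rw [show u + (p₁ + p₂ - n) = u + p₁ + p₂ - n by ring]; exact hu n hn)
    have h1 := gHat_recursion (N := N) (s := s) (p₁ + p₂) (ε (-2 * u)) hn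
    have h2 := gCoeff_recursion hN hs (hu n hn)
    refine mul_right_cancel₀ hA ?_
    rw [ih (by omega)] at h1
    linear_combination h1 - gHat N s (p₁ + p₂) (ε (-2 * u)) 0 * h2

theorem gHat_zero_ne_zero (hN : 2 ≤ N) (hs : IsCoprime s (N : ℤ)) {p₁ p₂ u : ℂ}
    (hu : ∀ k : ℕ, k + 1 < N → qn (u + p₁ + p₂ - k) ≠ 0) :
    gHat N s (p₁ + p₂) (ε (-2 * u)) 0 ≠ 0 := by
  rw [gHat, Finset.range_zero, Finset.prod_empty, one_mul]
  refine Finset.prod_ne_zero_iff.mpr fun k hk => ?_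
  rw [Finset.mem_Ico] at hk
  have hA := eps_sub_ne_zero_of_qNum hN hs (u := u) (P := p₁ + p₂ - k)
    (by rw [show u + (p₁ + p₂ - k) = u + p₁ + p₂ - k by ring]; exact hu k (by omega))
  have h0 := eps_ne_zero (N := N) (s := s) (p₁ + p₂ - k)
  have e : ε (2 * (p₁ + p₂ - k)) - ε (-2 * u)
      = ε (p₁ + p₂ - k) * (ε (p₁ + p₂ - k) - ε (-2 * u) * ε (-(p₁ + p₂ - k))) := by
    rw [eps_two_mul, eps_neg]
    field_simp
  rw [e]
  exact mul_ne_zero h0 hA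

theorem rHat_eq_smul_rColor (hN : 2 ≤ N) (hs : IsCoprime s (N : ℤ)) (hr : IsRootChoice N s r)
    {p₁ p₂ u : ℂ} (hg : Generic N s p₁ p₂ u) :
    rHat N s p₁ p₂ (fun k => r (k + 1)) (fun k => r (2 * p₁ - k)) (fun k => r (2 * p₂ - k))
      (ε (-2 * u)) = gHat N s (p₁ + p₂) (ε (-2 * u)) 0 • rColor N s r p₁ p₂ u := by
  rw [rColor_eq hr]
  ext a b
  simp only [rHat, rGen, Matrix.of_apply, Matrix.smul_apply, smul_eq_mul, Finset.mul_sum]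
  refine Finset.sum_congr rfl fun m _ => ?_
  rw [gHat_eq_mul_gCoeff hN hs hg.2 m.1.2]
  ring

theorem Generic.symm {p₁ p₂ u : ℂ} (h : Generic N s p₁ p₂ u) : Generic N s p₂ p₁ u := by
  refine ⟨fun k => ?_, fun k hk => ?_⟩
  · rw [add_comm (2 * p₂)]
    exact h.1 k
  · rw [add_right_comm]
    exact h.2 k hk

theorem ybDiff_rColor (hN : 2 ≤ N) (hs : IsCoprime s (N : ℤ)) (hr : IsRootChoice N s r)
    {p₁ p₂ p₃ u v w : ℂ} (hw : w = u + v) (h₁₂ : Generic N s p₁ p₂ u) (h₁₃ : Generic N s p₁ p₃ w)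
    (h₂₃ : Generic N s p₂ p₃ v) :
    ybDiff (rColor N s r p₁ p₂ u) (rColor N s r p₁ p₃ w) (rColor N s r p₂ p₃ v) = 0 := by
  have h := ybDiff_rHat (rootData hN hs hr h₁₂.1) (rootData hN hs hr h₁₃.1)
    (rootData hN hs hr h₂₃.1) (ε (-2 * u)) (ε (-2 * v))
  rw [← eps_add, show -2 * u + -2 * v = -2 * w by rw [hw]; ring,
    rHat_eq_smul_rColor hN hs hr h₁₂, rHat_eq_smul_rColor hN hs hr h₁₃,
    rHat_eq_smul_rColor hN hs hr h₂₃] at h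
  have c₁ := gHat_zero_ne_zero hN hs h₁₂.2
  have c₂ := gHat_zero_ne_zero hN hs h₁₃.2
  have c₃ := gHat_zero_ne_zero hN hs h₂₃.2
  ext a b
  have e := congrFun (congrFun h a) b
  rw [Matrix.zero_apply]
  rw [ybDiff_apply, Matrix.zero_apply] at e
  rw [ybDiff_apply]
  refine mul_left_cancel₀ (mul_ne_zero c₁ (mul_ne_zero c₂ c₃)) ?_
  rw [mul_zero, ← e, mul_sub]
  simp only [Matrix.smul_apply, smul_eq_mul, Finset.mul_sum]
  congr 1 <;>
    exact Finset.sum_congr rfl fun i _ => Finset.sum_congr rfl fun j _ =>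
      Finset.sum_congr rfl fun k _ => by ring

/-- A weight with colors (α_i, α_j) is an R-matrix for (p_j, p_i), so this is the matrix equation
for the sites in the order p₃, p₂, p₁ with all indices reversed; the spectral parameters u₂ - u₃ and
u₁ - u₂ add up to u₁ - u₃. -/
theorem weight_yangBaxter (hN : 2 ≤ N) (hs : IsCoprime s (N : ℤ)) (hr : IsRootChoice N s r)
    {p₁ p₂ p₃ u₁ u₂ u₃ : ℂ} (h₁₂ : Generic N s p₁ p₂ (u₁ - u₂))
    (h₁₃ : Generic N s p₁ p₃ (u₁ - u₃)) (h₂₃ : Generic N s p₂ p₃ (u₂ - u₃))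
    (a₁ a₂ a₃ b₁ b₂ b₃ : Fin N) :
    ∑ c₁ : Fin N, ∑ c₂ : Fin N, ∑ c₃ : Fin N,
        weight N s r p₁ p₂ (u₁ - u₂) a₁ a₂ c₂ c₁ * weight N s r p₁ p₃ (u₁ - u₃) c₁ a₃ c₃ b₁
          * weight N s r p₂ p₃ (u₂ - u₃) c₂ c₃ b₃ b₂
      = ∑ c₁ : Fin N, ∑ c₂ : Fin N, ∑ c₃ : Fin N,
        weight N s r p₂ p₃ (u₂ - u₃) a₂ a₃ c₃ c₂ * weight N s r p₁ p₃ (u₁ - u₃) a₁ c₃ b₃ c₁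
          * weight N s r p₁ p₂ (u₁ - u₂) c₁ c₂ b₂ b₁ := by
  have h := congrFun (congrFun (ybDiff_rColor hN hs hr (w := u₁ - u₃) (by ring) h₂₃.symm h₁₃.symm
    h₁₂.symm) (a₃, a₂, a₁)) (b₃, b₂, b₁)
  rw [ybDiff_apply, Matrix.zero_apply, sub_eq_zero] at h
  simp only [weight]
  calc _ = _ := ?_
    _ = _ := h
    _ = _ := Finset.sum_comm
  rw [Finset.sum_comm]
  refine (Finset.sum_congr rfl fun j _ => Finset.sum_comm).trans ?_
  rw [Finset.sum_comm]

end Weights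

end ColoredVertex

end

theorem mainTheorem5 (N : ℕ) (hN : 2 ≤ N) (s : ℤ) (hs : IsCoprime s (N : ℤ))
    (r : ℂ → ℂ) (hr : ColoredVertex.IsRootChoice N s r) :
    -- two color representations: the explicit matrix is the R-matrix
    (∀ p₁ p₂ u : ℂ, ColoredVertex.Generic N s p₁ p₂ u →
      ColoredVertex.IsRMatrix N s r p₁ N p₂ N (ColoredVertex.epsPow N s (-2 * u))
          (ColoredVertex.rColor N s r p₁ p₂ u) ∧
        ColoredVertex.rColor N s r p₁ p₂ u (⟨0, by omega⟩, ⟨0, by omega⟩)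
          (⟨0, by omega⟩, ⟨0, by omega⟩) = 1 ∧
        (ColoredVertex.IrreducibleColor N s p₁ → ColoredVertex.IrreducibleColor N s p₂ →
          ∀ T : Matrix (Fin N × Fin N) (Fin N × Fin N) ℂ,
            ColoredVertex.IsRMatrix N s r p₁ N p₂ N (ColoredVertex.epsPow N s (-2 * u)) T →
              ∃ c : ℂ, T = c • ColoredVertex.rColor N s r p₁ p₂ u)) ∧
    -- colored vertex model: the Boltzmann weights satisfy the Yang-Baxter relation
    (∀ p₁ p₂ p₃ u₁ u₂ u₃ : ℂ,
      ColoredVertex.Generic N s p₁ p₂ (u₁ - u₂) →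
      ColoredVertex.Generic N s p₁ p₃ (u₁ - u₃) →
      ColoredVertex.Generic N s p₂ p₃ (u₂ - u₃) →
      ∀ a₁ a₂ a₃ b₁ b₂ b₃ : Fin N,
        ∑ c₁ : Fin N, ∑ c₂ : Fin N, ∑ c₃ : Fin N,
            ColoredVertex.weight N s r p₁ p₂ (u₁ - u₂) a₁ a₂ c₂ c₁
              * ColoredVertex.weight N s r p₁ p₃ (u₁ - u₃) c₁ a₃ c₃ b₁
              * ColoredVertex.weight N s r p₂ p₃ (u₂ - u₃) c₂ c₃ b₃ b₂
          = ∑ c₁ : Fin N, ∑ c₂ : Fin N, ∑ c₃ : Fin N,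
            ColoredVertex.weight N s r p₂ p₃ (u₂ - u₃) a₂ a₃ c₃ c₂
              * ColoredVertex.weight N s r p₁ p₃ (u₁ - u₃) a₁ c₃ b₃ c₁
              * ColoredVertex.weight N s r p₁ p₂ (u₁ - u₂) c₁ c₂ b₂ b₁) ∧
    -- a color representation and a spin m / 2 representation
    (∀ (p₁ : ℂ) (m : ℕ) (u : ℂ), m + 2 ≤ N → ColoredVertex.GenericMixed N s p₁ m u →
      ColoredVertex.IsRMatrix N s r p₁ N ((m : ℂ) / 2) (m + 1)
          (ColoredVertex.epsPow N s (-2 * u)) (ColoredVertex.rMixed N s r p₁ m u) ∧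
        ColoredVertex.rMixed N s r p₁ m u (⟨0, by omega⟩, ⟨0, by omega⟩)
          (⟨0, by omega⟩, ⟨0, by omega⟩) = 1 ∧
        ∀ T : Matrix (Fin N × Fin (m + 1)) (Fin N × Fin (m + 1)) ℂ,
          ColoredVertex.IsRMatrix N s r p₁ N ((m : ℂ) / 2) (m + 1)
              (ColoredVertex.epsPow N s (-2 * u)) T →
            ∃ c : ℂ, T = c • ColoredVertex.rMixed N s r p₁ m u) := by
  refine ⟨fun p₁ p₂ u hg => ⟨ColoredVertex.isRMatrix_rColor hN hs hr hg, ?_, fun h₁ h₂ T hT =>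
      ColoredVertex.rColor_unique hN hs hr hg h₁ h₂ hT⟩,
    fun p₁ p₂ p₃ u₁ u₂ u₃ h₁₂ h₁₃ h₂₃ => ColoredVertex.weight_yangBaxter hN hs hr h₁₂ h₁₃ h₂₃,
    fun p₁ m u hm hg => ⟨ColoredVertex.isRMatrix_rMixed hN hs hr hm hg,
      ColoredVertex.rMixed_zero_zero hN hr hm hg, fun T hT =>
      ColoredVertex.rMixed_unique hN hs hr hm hg hT⟩⟩
  rw [ColoredVertex.rColor_eq hr, ColoredVertex.rGen_zero_zero hN
    (ColoredVertex.rootData hN hs hr hg.1).generic]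
  simp [ColoredVertex.gCoeff]
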